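/- Let $N\ge 2$, let $\Omega\subset\mathbb R^N$ be bounded and open. Let $h>0$ be continuous on $(0,\infty)$ and locally integrable on $[0,\infty)$, let $a\in C([0,\infty))$ with $a(0)=0$ and $a(s)>0$ for $s>0$, and put $H(v)=\int_0^v h(r)\,dr$ and $F(v)=h(v)a(v)$ for $v>0$, $F(0)=0$. Assume that $F$ is nondecreasing and locally Lipschitz on $[0,\infty)$. Let $p_1,q_1,c_3,\gamma_1,\beta,c_4>0$ be such that the following derivatives exist and $$[H^{p_1}F]'(s)\ \ge\ c_3H(s)^{q_1},\qquad [H^{\gamma_1+1}]'(s)\ \le\ c_4H(s)^{\beta}\qquad\text{for all } s\in[0,\infty)$$ (one-sided at $s=0$), with $\beta>q_1/2$. Let $\delta_1=\frac{p_1+1}{\gamma_1+1}$, assume $1\le\delta_1<2$, and let $$\delta_2=1\ \text{ if } 1\le\delta_1\le\tfrac{N}{N-1},\qquad \delta_2=\frac{\delta_1N}{N+\delta_1}\ \text{ if }\tfrac{N}{N-1}<\delta_1<2,\qquad p_0=\Big(\beta-\frac{q_1}{2}\Big)\frac{2\delta_2}{2-\delta_2}.$$ Then there is a constant $k>0$,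 independent of $t_0$, $u_0$ and $u$, such that the following holds for every $t_0\in\mathbb R$. Let $u\ge0$ be a strong solution of $$[H(u)]_t-F(u)\Delta u\le 0\ \text{ a.e. in }\Omega\times(t_0,\infty),\qquad u(\cdot,t_0)=u_0,\qquad u=0\ \text{ on }\partial\Omega\times(t_0,\infty),$$ in the following sense: $[H(u)]_t\in L^2(\Omega\times(t_0,\infty))$, with $H(u(\cdot,t))=H(u_0)+\int_{t_0}^t[H(u)]_t\,ds$ a.e. in $\Omega$ for every $t\ge t_0$; for a.e. $t>t_0$ the function $u(\cdot,t)\in L^1_{loc}(\Omega)$ has a weak gradient in $L^2_{loc}(\Omega)$ and a weak Laplacian in $L^1_{loc}(\Omega)$; $F(u)\Delta u\in L^2(\Omega\times(t_0,\infty))$; and the boundary condition is understood as $[H(u(\cdot,t))]^{p_1}F(u(\cdot,t))\in W^{1,2}_0(\Omega)$ for a.e. $t>t_0$. Suppose $H(u_0)\in L^{p_1+1}(\Omega)$, and set $$Y(t)=\int_\Omega[H(u(x,t))]^{p_1+1}dx,\qquad Z(t)=\int_\Omega[H(u(x,t))]^{p_0}dx\in[0,\infty].$$ Then $Y$ is finite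 and nonincreasing on $[t_0,\infty)$, and for a.e. $t>t_0$ the derivative $Y'(t)$ exists and $$Y'(t)+\frac{k}{[Z(t)+1]^{\frac{2-\delta_2}{\delta_2}}}\,[Y(t)]^{\frac{2}{\delta_1}}\le0,$$ where the fraction is $0$ if $Z(t)=\infty$. -/

import Mathlib

open MeasureTheory Set Filter Topology TopologicalSpace
open scoped ENNReal Distributions

noncomputable section

namespace Einstein

/-- The Euclidean space `ℝᴺ`. -/
abbrev Euc (N : ℕ) : Type := EuclideanSpace ℝ (Fin N)

/-- `H(v) = ∫₀ᵛ h(r) dr`. -/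
def H (h : ℝ → ℝ) (v : ℝ) : ℝ := ∫ r in (0 : ℝ)..v, h r

/-- `F(v) = h(v) a(v)`. -/
def F (h a : ℝ → ℝ) (v : ℝ) : ℝ := h v * a v

/-- Standing assumptions on the weight `h` and on the diffusion coefficient `a`.
(`H(0) = 0` and `F(0) = 0` follow from the definitions and from `a(0) = 0`.) -/
structure IsAdmissible (h a : ℝ → ℝ) : Prop where
  h_pos : ∀ v > 0, 0 < h v
  h_cont : ContinuousOn h (Ioi 0)
  h_int : LocallyIntegrableOn h (Ici 0)
  a_cont : ContinuousOn a (Ici 0)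
  a_zero : a 0 = 0
  a_pos : ∀ v > 0, 0 < a v
  F_lip : LocallyLipschitzOn (Ici 0) (F h a)
  F_mono : MonotoneOn (F h a) (Ici 0)

variable {N : ℕ}

/-- `g` is the weak gradient of `f` in the open set `Ω`. -/
def HasWeakGradient (Ω : Opens (Euc N)) (f : Euc N → ℝ) (g : Euc N → Euc N) : Prop :=
  LocallyIntegrableOn f Ω ∧ LocallyIntegrableOn g Ω ∧
    ∀ φ : 𝓓(Ω, ℝ), ∫ x in Ω, f x • gradient (⇑φ) x = -∫ x in Ω, φ x • g x

/-- `l` is the weak divergence of the vector field `g` in the open set `Ω`. If `g` is the weak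
gradient of `f`, this says that `l` is the weak Laplacian of `f`. -/
def HasWeakDivergence (Ω : Opens (Euc N)) (g : Euc N → Euc N) (l : Euc N → ℝ) : Prop :=
  LocallyIntegrableOn g Ω ∧ LocallyIntegrableOn l Ω ∧
    ∀ φ : 𝓓(Ω, ℝ), ∫ x in Ω, inner ℝ (g x) (gradient (⇑φ) x) = -∫ x in Ω, φ x * l x

/-- `f ∈ W₀^{1,2}(Ω)`, the closure of the test functions in `W^{1,2}(Ω)`. -/
def MemW012 (Ω : Opens (Euc N)) (f : Euc N → ℝ) : Prop :=
  ∃ g : Euc N → Euc N,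
    MemLp f 2 (volume.restrict Ω) ∧ MemLp g 2 (volume.restrict Ω) ∧
    ∃ φ : ℕ → 𝓓(Ω, ℝ),
      Tendsto (fun n ↦ eLpNorm (fun x ↦ φ n x - f x) 2 (volume.restrict Ω)) atTop (𝓝 0) ∧
      Tendsto (fun n ↦ eLpNorm (fun x ↦ gradient (⇑(φ n)) x - g x) 2 (volume.restrict Ω))
        atTop (𝓝 0)

/-- `u` is a nonnegative strong solution of `[H(u)]_t - F(u) Δu ≤ 0` in `Ω × (t₀, ∞)` with
`u(·, t₀) = u₀`, where `w = [H(u)]_t`, `g = ∇u` and `l = Δu`.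
The time derivative `w` is the weak one: `H(u)` is the time integral of `w`, which also fixes the
sense in which the initial value is attained. -/
structure IsSolutionWith (Ω : Opens (Euc N)) (h a : ℝ → ℝ) (t₀ : ℝ) (u₀ : Euc N → ℝ)
    (u : ℝ → Euc N → ℝ) (w : ℝ → Euc N → ℝ) (g : ℝ → Euc N → Euc N) (l : ℝ → Euc N → ℝ) :
    Prop where
  meas : AEMeasurable (fun z : ℝ × Euc N ↦ u z.1 z.2)
    ((volume.restrict (Ioi t₀)).prod (volume.restrict Ω))
  nonneg : ∀ t ≥ t₀, ∀ x ∈ Ω, 0 ≤ u t x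
  initial : ∀ᵐ x ∂(volume.restrict Ω), u t₀ x = u₀ x
  time_sq : MemLp (fun z : ℝ × Euc N ↦ w z.1 z.2) 2
    ((volume.restrict (Ioi t₀)).prod (volume.restrict Ω))
  time_deriv : ∀ t ≥ t₀, ∀ᵐ x ∂(volume.restrict Ω),
    H h (u t x) = H h (u₀ x) + ∫ s in t₀..t, w s x
  grad : ∀ᵐ t ∂(volume.restrict (Ioi t₀)), HasWeakGradient Ω (u t) (g t)
  grad_sq : ∀ᵐ t ∂(volume.restrict (Ioi t₀)), LocallyIntegrableOn (fun x ↦ ‖g t x‖ ^ 2) Ω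
  lapl : ∀ᵐ t ∂(volume.restrict (Ioi t₀)), HasWeakDivergence Ω (g t) (l t)
  diff_sq : MemLp (fun z : ℝ × Euc N ↦ F h a (u z.1 z.2) * l z.1 z.2) 2
    ((volume.restrict (Ioi t₀)).prod (volume.restrict Ω))
  ineq : ∀ᵐ z : ℝ × Euc N ∂((volume.restrict (Ioi t₀)).prod (volume.restrict Ω)),
    w z.1 z.2 - F h a (u z.1 z.2) * l z.1 z.2 ≤ 0

/-- `u` is a nonnegative strong solution of `[H(u)]_t - F(u) Δu ≤ 0` in `Ω × (t₀, ∞)` with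
`u(·, t₀) = u₀`. The lateral boundary condition `u = 0` on `∂Ω` is not part of this
predicate: it is expressed by membership of `H(u)^p F(u)` in `W₀^{1,2}(Ω)`. -/
def IsSolution (Ω : Opens (Euc N)) (h a : ℝ → ℝ) (t₀ : ℝ) (u₀ : Euc N → ℝ)
    (u : ℝ → Euc N → ℝ) : Prop :=
  ∃ (w : ℝ → Euc N → ℝ) (g : ℝ → Euc N → Euc N) (l : ℝ → Euc N → ℝ),
    IsSolutionWith Ω h a t₀ u₀ u w g l

/-- `Y(t) = ∫_Ω H(u(x,t))^m dx`. -/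
def Y (Ω : Opens (Euc N)) (h : ℝ → ℝ) (m : ℝ) (u : ℝ → Euc N → ℝ) (t : ℝ) : ℝ :=
  ∫ x in Ω, H h (u t x) ^ m

/-- `Z(t) = ∫_Ω H(u(x,t))^m dx` with values in `[0, ∞]`. -/
def Z (Ω : Opens (Euc N)) (h : ℝ → ℝ) (m : ℝ) (u : ℝ → Euc N → ℝ) (t : ℝ) : ℝ≥0∞ :=
  ∫⁻ x in Ω, ENNReal.ofReal (H h (u t x) ^ m)

/-- `δ₂ = 1` if `δ₁ ≤ N / (N - 1)`, and `δ₂ = δ₁ N / (N + δ₁)` otherwise. -/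
def delta₂ (N : ℕ) (δ₁ : ℝ) : ℝ :=
  if δ₁ ≤ (N : ℝ) / ((N : ℝ) - 1) then 1 else δ₁ * N / (N + δ₁)

end Einstein

end

/-! Let `Φ = H ^ p₁ * F` be the flux. Formally, multiplying the inequality by `H(u) ^ p₁` and
integrating over `Ω` gives `Y' / (p₁ + 1) ≤ ∫ Φ(u) Δu = -∫ Φ'(u) |∇u|²`; there is no boundary term
because `Φ(u)` lies in `W₀^{1,2}(Ω)`. It remains to bound `Y` by this energy. Sobolev's inequality
for `v = H(u) ^ (γ₁ + 1)` controls `Y ^ (1 / δ₁)`, the `L^δ₁` norm of `v`, by the `L^δ₂` norm of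
`∇v`. Since `|∇v| ≤ c₄ H ^ β |∇u|` and `c₃ H ^ q₁ ≤ Φ'`, the gradient is at most a constant times `H
^ (β - q₁ / 2)` times the root of the energy density. Hölder's inequality with exponents `2 δ₂ / (2
- δ₂)` and `2` then yields `Y ^ (2 / δ₁) ≤ K Z ^ ((2 - δ₂) / δ₂) ∫ Φ'(u) |∇u|²`
(`exists_interpolation`), and the two estimates combine.

To make this rigorous, the basic variable is `f = Φ(u)`, the function known to be in `W₀^{1,2}(Ω)`.
The growth hypothesis makes `Φ` an increasing bijection of `[0, ∞)` with inverse `U = fluxInv`, so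
`u = U(f)` and the energy density is `U'(f) |∇f|²`. As `U'` may blow up at `0` and `Φ(u) Δu` need
not be integrable, the identity function of `f` is replaced by `ramp j`, which vanishes near `0` and
is constant for large values. In space, `integral_ramp_mul` gives `-∫ ramp j (f) Δu = ∫ bump j (f)
U'(f) |∇f|²`. In time, the multiplier `ramp j (Φ) / F` is bounded and increases to `H ^ p₁`, and its
primitive is a Lipschitz function of the absolutely continuous `H(u)`.

The truncated energies `E j` are nonnegative and increase with `j`, whence `Y t₂ - Y t₁ ≤ -(p₁ + 1)
∫ E j` for every fixed `j` (`Y_sub_le`). This is differentiated at almost every `t`, for all `j` at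
once; only afterwards does `j` tend to infinity, by Fatou's lemma in space.

All weak chain rules come from one device: test functions converging to `f` almost everywhere
together with their gradients, dominated by a square integrable function (`DominatedApprox`). -/

noncomputable section

open scoped NNReal

/-! ### Dominated approximation in `W₀^{1,2}` and smoothing of Lipschitz functions -/

section

namespace Einstein

/-- A sequence with summable squared `L²` norms tends to zero almost everywhere and is dominated
by a square integrable function. -/
lemma exists_dominated_of_eLpNorm_le {α E : Type*} [MeasurableSpace α] {μ : Measure α}
    [NormedAddCommGroup E] {d : ℕ → α → E} (hd : ∀ n, AEStronglyMeasurable (d n) μ)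
    (h : ∀ n, eLpNorm (d n) 2 μ ≤ (2⁻¹ : ℝ≥0∞) ^ n) :
    ∃ G : α → ℝ, MemLp G 2 μ ∧
      ∀ᵐ x ∂μ, (∀ n, ‖d n x‖ ≤ G x) ∧ Tendsto (fun n ↦ d n x) atTop (𝓝 0) := by
  -- The integral of `S` is at most `∑ 4⁻ⁿ`, so `S` is finite almost everywhere. Then `√S` dominates
  -- every term, and the terms of a convergent series tend to zero.
  set S : α → ℝ≥0∞ := fun x ↦ ∑' n, ‖d n x‖ₑ ^ (2 : ℝ) with hS
  have hSm : AEMeasurable S μ :=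
    AEMeasurable.tsum fun n ↦ ((hd n).enorm.pow_const _)
  have hSint : ∫⁻ x, S x ∂μ ≠ ∞ := by
    rw [lintegral_tsum fun n ↦ ((hd n).enorm.pow_const _)]
    have hle : ∀ n, ∫⁻ x, ‖d n x‖ₑ ^ (2 : ℝ) ∂μ ≤ (4⁻¹ : ℝ≥0∞) ^ n := by
      intro n
      have := eLpNorm_nnreal_pow_eq_lintegral (f := d n) (μ := μ) (p := 2) (by norm_num)
      norm_num at this
      norm_num
      rw [← this]
      calc eLpNorm (d n) 2 μ ^ 2 ≤ ((2⁻¹ : ℝ≥0∞) ^ n) ^ 2 := by gcongr; exact h n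
        _ = (4⁻¹ : ℝ≥0∞) ^ n := by
          rw [← pow_mul, mul_comm, pow_mul, ← ENNReal.inv_pow]; norm_num
    refine ne_top_of_le_ne_top ?_ (ENNReal.tsum_le_tsum hle)
    rw [ENNReal.tsum_geometric]
    simp only [ne_eq, ENNReal.inv_eq_top, tsub_eq_zero_iff_le, not_le]
    exact ENNReal.inv_lt_one.2 (by norm_num)
  have hfin : ∀ᵐ x ∂μ, S x < ∞ := ae_lt_top' hSm hSint
  refine ⟨fun x ↦ √(S x).toReal, ?_, ?_⟩
  · rw [memLp_two_iff_integrable_sq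
      (hSm.ennreal_toReal.sqrt).aestronglyMeasurable]
    simp only [Real.sq_sqrt ENNReal.toReal_nonneg]
    exact integrable_toReal_of_lintegral_ne_top hSm hSint
  · filter_upwards [hfin] with x hx
    constructor
    · intro n
      apply Real.le_sqrt_of_sq_le
      have h1 : ‖d n x‖ₑ ^ (2 : ℝ) ≤ S x := ENNReal.le_tsum n
      have := ENNReal.toReal_mono hx.ne h1
      simpa using this
    · have h0 := ENNReal.tendsto_atTop_zero_of_tsum_ne_top hx.ne
      rw [tendsto_zero_iff_enorm_tendsto_zero]
      have := (ENNReal.continuous_rpow_const (y := (2 : ℝ)⁻¹)).tendsto 0 |>.comp h0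
      rw [ENNReal.zero_rpow_of_pos (by norm_num)] at this
      refine this.congr fun n ↦ ?_
      rw [Function.comp_apply, ← ENNReal.rpow_mul]
      norm_num

variable {N : ℕ} {Ω : Opens (Euc N)}

/-- The functions `η n` approximate `f`, with gradients approximating `g`, almost everywhere and
dominated by the square integrable function `G`. -/
structure DominatedApprox (Ω : Opens (Euc N)) (f : Euc N → ℝ) (g : Euc N → Euc N)
    (η : ℕ → 𝓓(Ω, ℝ)) (G : Euc N → ℝ) : Prop where
  memLp : MemLp G 2 (volume.restrict Ω)
  tendsto : ∀ᵐ x ∂(volume.restrict (Ω : Set (Euc N))), Tendsto (fun n ↦ η n x) atTop (𝓝 (f x))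
  tendsto_gradient : ∀ᵐ x ∂(volume.restrict (Ω : Set (Euc N))),
    Tendsto (fun n ↦ gradient (⇑(η n)) x) atTop (𝓝 (g x))
  le : ∀ᵐ x ∂(volume.restrict (Ω : Set (Euc N))), ∀ n, |η n x| ≤ G x
  gradient_le : ∀ᵐ x ∂(volume.restrict (Ω : Set (Euc N))), ∀ n, ‖gradient (⇑(η n)) x‖ ≤ G x

lemma _root_.TestFunction.continuous_gradient (φ : 𝓓(Ω, ℝ)) : Continuous (gradient (⇑φ)) := by
  have h : ContDiff ℝ 1 (⇑φ) := φ.contDiff.of_le (by simp)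
  exact (InnerProductSpace.toDual ℝ (Euc N)).symm.continuous.comp (h.continuous_fderiv one_ne_zero)

/-- Along a subsequence for which the functions and their gradients are both within `2⁻ⁿ` of their
`L²` limits, the differences are dominated and tend to zero almost everywhere; adding `|f|` and
`‖g‖` dominates the sequence itself. -/
lemma MemW012.exists_dominatedApprox {f : Euc N → ℝ} (hf : MemW012 Ω f) :
    ∃ g η G, DominatedApprox Ω f g η G := by
  obtain ⟨g, hf2, hg2, φ, h1, h2⟩ := hf
  have hex : ∀ n : ℕ, ∃ m : ℕ,
      eLpNorm (fun x ↦ φ m x - f x) 2 (volume.restrict Ω) ≤ (2⁻¹ : ℝ≥0∞) ^ n ∧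
      eLpNorm (fun x ↦ gradient (⇑(φ m)) x - g x) 2 (volume.restrict Ω) ≤ (2⁻¹ : ℝ≥0∞) ^ n := by
    intro n
    have hpos : (0 : ℝ≥0∞) < (2⁻¹ : ℝ≥0∞) ^ n := by
      apply ENNReal.pow_pos; norm_num
    exact ((h1.eventually_le_const hpos).and (h2.eventually_le_const hpos)).exists
  choose m hm1 hm2 using hex
  obtain ⟨G1, hG1, hx1⟩ := exists_dominated_of_eLpNorm_le
    (fun n ↦ ((φ (m n)).continuous.aestronglyMeasurable.sub hf2.1)) hm1
  obtain ⟨G2, hG2, hx2⟩ := exists_dominated_of_eLpNorm_le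
    (fun n ↦ ((φ (m n)).continuous_gradient.aestronglyMeasurable.sub hg2.1)) hm2
  refine ⟨g, fun n ↦ φ (m n), fun x ↦ |G1 x| + |G2 x| + |f x| + ‖g x‖, ?_, ?_, ?_, ?_, ?_⟩
  · exact ((hG1.abs.add hG2.abs).add hf2.abs).add hg2.norm
  · filter_upwards [hx1] with x hx
    simpa using hx.2.add_const (f x)
  · filter_upwards [hx2] with x hx
    simpa using hx.2.add_const (g x)
  · filter_upwards [hx1] with x hx n
    have h3 := hx.1 n
    simp only [Pi.sub_apply, Real.norm_eq_abs] at h3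
    have h4 := le_abs_self (G1 x)
    have h5 := abs_nonneg (G2 x)
    have h6 := norm_nonneg (g x)
    have h7 := abs_sub_abs_le_abs_sub (φ (m n) x) (f x)
    linarith
  · filter_upwards [hx2] with x hx n
    have h3 := hx.1 n
    simp only [Pi.sub_apply] at h3
    have h4 := le_abs_self (G2 x)
    have h5 := abs_nonneg (G1 x)
    have h6 := abs_nonneg (f x)
    have h7 := norm_sub_norm_le (gradient (⇑(φ (m n))) x) (g x)
    linarith

namespace DominatedApprox

variable {f : Euc N → ℝ} {g : Euc N → Euc N} {η : ℕ → 𝓓(Ω, ℝ)} {G : Euc N → ℝ}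

lemma aestronglyMeasurable (h : DominatedApprox Ω f g η G) :
    AEStronglyMeasurable f (volume.restrict Ω) :=
  aestronglyMeasurable_of_tendsto_ae atTop (fun n ↦ (η n).continuous.aestronglyMeasurable)
    h.tendsto

lemma aestronglyMeasurable_gradient (h : DominatedApprox Ω f g η G) :
    AEStronglyMeasurable g (volume.restrict Ω) :=
  aestronglyMeasurable_of_tendsto_ae atTop
    (fun n ↦ (η n).continuous_gradient.aestronglyMeasurable) h.tendsto_gradient

lemma abs_le (h : DominatedApprox Ω f g η G) :
    ∀ᵐ x ∂(volume.restrict (Ω : Set (Euc N))), |f x| ≤ G x := by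
  filter_upwards [h.tendsto, h.le] with x h1 h2
  exact le_of_tendsto' h1.abs h2

lemma norm_gradient_le (h : DominatedApprox Ω f g η G) :
    ∀ᵐ x ∂(volume.restrict (Ω : Set (Euc N))), ‖g x‖ ≤ G x := by
  filter_upwards [h.tendsto_gradient, h.gradient_le] with x h1 h2
  exact le_of_tendsto' h1.norm h2

end DominatedApprox

/-- Averages of a Lipschitz function over `[r, r + 1 / (m + 1)]` are continuously differentiable,
and their derivatives tend to the right derivative. -/
lemma exists_contDiff_approx {W D : ℝ → ℝ} {K : ℝ≥0} {ε : ℝ} (hε : 0 < ε) (hW : LipschitzWith K W)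
    (hW0 : ∀ r ≤ ε, W r = 0) (hD : ∀ r, HasDerivWithinAt W (D r) (Ioi r) r) :
    ∃ V : ℕ → ℝ → ℝ, (∀ m, ContDiff ℝ 1 (V m)) ∧ (∀ m, V m 0 = 0) ∧
      (∀ m r, |deriv (V m) r| ≤ K) ∧ (∀ m r, |V m r| ≤ K * |r|) ∧
      (∀ r, Tendsto (fun m ↦ V m r) atTop (𝓝 (W r))) ∧
      (∀ r, Tendsto (fun m ↦ deriv (V m) r) atTop (𝓝 (D r))) := by
  set I : ℝ → ℝ := fun r ↦ ∫ s in (0 : ℝ)..r, W s with hI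
  have hIder : ∀ r, HasDerivAt I (W r) r := fun r ↦
    intervalIntegral.integral_hasDerivAt_right (hW.continuous.intervalIntegrable _ _)
      (hW.continuous.stronglyMeasurableAtFilter _ _) hW.continuous.continuousAt
  -- Shifting the index by `m₀` keeps the window `[0, c m]` where `W` vanishes. This gives `V m 0 =
  -- 0`, so that composing with a test function preserves compact support.
  obtain ⟨m₀, hm₀⟩ := exists_nat_one_div_lt hε
  set c : ℕ → ℝ := fun m ↦ 1 / ((m + m₀ : ℕ) + 1 : ℝ) with hc
  have hcpos : ∀ m, 0 < c m := fun m ↦ by positivity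
  have hcle : ∀ m, c m ≤ ε := fun m ↦ by
    refine le_trans ?_ hm₀.le
    simp only [hc]
    gcongr
    simp
  have hc0 : Tendsto c atTop (𝓝 0) :=
    (tendsto_add_atTop_iff_nat (f := fun n : ℕ ↦ 1 / ((n : ℝ) + 1)) m₀).2
      tendsto_one_div_add_atTop_nhds_zero_nat
  -- The derivative of this average is a forward difference quotient of `W`. It converges to the
  -- right derivative at every point, kinks included, so no level set of `f` has to be treated
  -- separately.
  set V : ℕ → ℝ → ℝ := fun m r ↦ (c m)⁻¹ * (I (r + c m) - I r) with hV
  have hVder : ∀ m r, HasDerivAt (V m) ((c m)⁻¹ * (W (r + c m) - W r)) r := fun m r ↦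
    (((hIder (r + c m)).comp_add_const r (c m)).sub (hIder r)).const_mul _
  have hVderiv : ∀ m, deriv (V m) = fun r ↦ (c m)⁻¹ * (W (r + c m) - W r) := fun m ↦
    funext fun r ↦ (hVder m r).deriv
  have hV0 : ∀ m, V m 0 = 0 := by
    intro m
    simp only [hV, zero_add, hI, intervalIntegral.integral_same, sub_zero]
    rw [intervalIntegral.integral_congr (g := fun _ ↦ (0 : ℝ))]
    · simp
    · intro s hs
      rw [uIcc_of_le (hcpos m).le] at hs
      exact hW0 s (hs.2.trans (hcle m))
  have hbd : ∀ m r, |deriv (V m) r| ≤ K := by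
    intro m r
    rw [hVderiv]
    simp only [abs_mul, abs_inv, abs_of_pos (hcpos m)]
    rw [inv_mul_le_iff₀ (hcpos m)]
    have := hW.dist_le_mul (r + c m) r
    simp only [Real.dist_eq, add_sub_cancel_left, abs_of_pos (hcpos m)] at this
    linarith
  have hdiff : ∀ m, Differentiable ℝ (V m) := fun m r ↦ (hVder m r).differentiableAt
  refine ⟨V, ?_, hV0, hbd, ?_, ?_, ?_⟩
  · intro m
    rw [contDiff_one_iff_deriv]
    refine ⟨hdiff m, ?_⟩
    rw [hVderiv]
    have := hW.continuous
    fun_prop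
  · intro m r
    have := Convex.norm_image_sub_le_of_norm_deriv_le (𝕜 := ℝ) (f := V m) (C := K) (s := univ)
      (x := 0) (y := r) (fun x _ ↦ hdiff m x) (fun x _ ↦ hbd m x) convex_univ trivial trivial
    simpa [hV0] using this
  · intro r
    have hslope := (hIder r).tendsto_slope.comp (f := fun m ↦ r + c m) (x := atTop) (by
      rw [tendsto_nhdsWithin_iff]
      refine ⟨by simpa using tendsto_const_nhds.add hc0, Eventually.of_forall fun m ↦ ?_⟩
      simp [(hcpos m).ne'])
    refine hslope.congr fun m ↦ ?_
    simp [slope, hV]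
  · intro r
    have hslope := (hasDerivWithinAt_iff_tendsto_slope' self_notMem_Ioi).1 (hD r) |>.comp
      (f := fun m ↦ r + c m) (x := atTop) (by
      rw [tendsto_nhdsWithin_iff]
      refine ⟨by simpa using tendsto_const_nhds.add hc0, Eventually.of_forall fun m ↦ ?_⟩
      simp [hcpos m])
    refine hslope.congr fun m ↦ ?_
    rw [hVderiv]
    simp [slope]

end Einstein

end

/-! ### Weak chain rule and Sobolev's inequality for functions of `f` -/

section

namespace Einstein

variable {N : ℕ} {Ω : Opens (Euc N)}

lemma gradient_comp {W : ℝ → ℝ} {f : Euc N → ℝ} {x : Euc N} (hW : DifferentiableAt ℝ W (f x))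
    (hf : DifferentiableAt ℝ f x) :
    gradient (fun y ↦ W (f y)) x = deriv W (f x) • gradient f x := by
  have h := hW.hasDerivAt.comp_hasFDerivAt x hf.hasFDerivAt
  have h2 : fderiv ℝ (fun y ↦ W (f y)) x = deriv W (f x) • fderiv ℝ f x := h.fderiv
  simp [gradient, h2]

lemma gradient_mul {f₁ f₂ : Euc N → ℝ} {x : Euc N} (h₁ : DifferentiableAt ℝ f₁ x)
    (h₂ : DifferentiableAt ℝ f₂ x) :
    gradient (fun y ↦ f₁ y * f₂ y) x = f₁ x • gradient f₂ x + f₂ x • gradient f₁ x := by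
  simp [gradient, fderiv_fun_mul h₁ h₂]

lemma inner_gradient (f : Euc N → ℝ) (x v : Euc N) :
    inner ℝ v (gradient f x) = fderiv ℝ f x v := by
  rw [real_inner_comm]
  simp [gradient]

end Einstein

namespace TestFunction

open Einstein

variable {N : ℕ} {Ω : Opens (Euc N)}

lemma differentiable (ξ : 𝓓(Ω, ℝ)) : Differentiable ℝ (⇑ξ) :=
  ξ.contDiff.differentiable (by simp)

lemma eq_zero_of_notMem (ξ : 𝓓(Ω, ℝ)) {x : Euc N} (hx : x ∉ tsupport ξ) : ξ x = 0 :=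
  image_eq_zero_of_notMem_tsupport hx

lemma gradient_eq_zero_of_notMem (ξ : 𝓓(Ω, ℝ)) {x : Euc N} (hx : x ∉ tsupport ξ) :
    gradient (⇑ξ) x = 0 := by
  have : fderiv ℝ (⇑ξ) x = 0 := by
    by_contra h
    exact hx (support_fderiv_subset ℝ h)
  simp [gradient, this]

lemma exists_bound (ξ : 𝓓(Ω, ℝ)) :
    ∃ C : ℝ, 0 ≤ C ∧ (∀ x, |ξ x| ≤ (tsupport ξ).indicator (fun _ ↦ C) x) ∧
      ∀ x, ‖gradient (⇑ξ) x‖ ≤ (tsupport ξ).indicator (fun _ ↦ C) x := by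
  obtain ⟨C₁, h₁⟩ := ξ.continuous.bounded_above_of_compact_support ξ.hasCompactSupport
  have hs : HasCompactSupport (gradient (⇑ξ)) :=
    HasCompactSupport.intro ξ.hasCompactSupport fun x hx ↦ ξ.gradient_eq_zero_of_notMem hx
  obtain ⟨C₂, h₂⟩ := ξ.continuous_gradient.bounded_above_of_compact_support hs
  refine ⟨max (max C₁ C₂) 0, le_max_right _ _, fun x ↦ ?_, fun x ↦ ?_⟩
  · by_cases hx : x ∈ tsupport ξ
    · rw [indicator_of_mem hx]
      exact (h₁ x).trans ((le_max_left _ _).trans (le_max_left _ _))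
    · simp [indicator_of_notMem hx, ξ.eq_zero_of_notMem hx]
  · by_cases hx : x ∈ tsupport ξ
    · rw [indicator_of_mem hx]
      exact (h₂ x).trans ((le_max_right _ _).trans (le_max_left _ _))
    · simp [indicator_of_notMem hx, ξ.gradient_eq_zero_of_notMem hx]

/-- The product of a smooth function and a test function. -/
def smoothMul (ψ : Euc N → ℝ) (hψ : ContDiff ℝ (⊤ : ℕ∞) ψ) (ξ : 𝓓(Ω, ℝ)) : 𝓓(Ω, ℝ) where
  toFun x := ψ x * ξ x
  contDiff' := hψ.mul ξ.contDiff
  hasCompactSupport' := ξ.hasCompactSupport.mul_left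
  tsupport_subset' := (tsupport_mul_subset_right).trans ξ.tsupport_subset

/-- The composition of a test function with a smooth function vanishing at zero. -/
def smoothComp (Θ : ℝ → ℝ) (hΘ : ContDiff ℝ (⊤ : ℕ∞) Θ) (h0 : Θ 0 = 0) (ξ : 𝓓(Ω, ℝ)) :
    𝓓(Ω, ℝ) where
  toFun x := Θ (ξ x)
  contDiff' := hΘ.comp ξ.contDiff
  hasCompactSupport' := ξ.hasCompactSupport.comp_left h0
  tsupport_subset' := (closure_mono (Function.support_comp_subset h0 _)).trans ξ.tsupport_subset

/-- Integration by parts for a continuously differentiable function and a test function. -/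
lemma integral_smul_gradient (ξ : 𝓓(Ω, ℝ)) {ψ : Euc N → ℝ} (hψ : ContDiff ℝ 1 ψ) :
    ∫ x in Ω, ψ x • gradient (⇑ξ) x = -∫ x in Ω, ξ x • gradient ψ x := by
  have hξ0 : ∀ x ∉ (Ω : Set (Euc N)), x ∉ tsupport ξ := fun x hx h ↦ hx (ξ.tsupport_subset h)
  have hgψ : Continuous (gradient ψ) :=
    (InnerProductSpace.toDual ℝ (Euc N)).symm.continuous.comp (hψ.continuous_fderiv one_ne_zero)
  have hs : HasCompactSupport (gradient (⇑ξ)) :=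
    HasCompactSupport.intro ξ.hasCompactSupport fun x hx ↦ ξ.gradient_eq_zero_of_notMem hx
  rw [setIntegral_eq_integral_of_forall_compl_eq_zero
      fun x hx ↦ by rw [ξ.gradient_eq_zero_of_notMem (hξ0 x hx), smul_zero],
    setIntegral_eq_integral_of_forall_compl_eq_zero
      fun x hx ↦ by rw [ξ.eq_zero_of_notMem (hξ0 x hx), zero_smul]]
  have i1 : Integrable (fun x ↦ ψ x • gradient (⇑ξ) x) :=
    (hψ.continuous.smul ξ.continuous_gradient).integrable_of_hasCompactSupport hs.smul_left
  have i2 : Integrable (fun x ↦ ξ x • gradient ψ x) :=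
    (ξ.continuous.smul hgψ).integrable_of_hasCompactSupport ξ.hasCompactSupport.smul_right
  refine ext_inner_left ℝ fun v ↦ ?_
  rw [inner_neg_right, ← integral_inner i1, ← integral_inner i2]
  simp only [inner_smul_right, inner_gradient]
  rw [integral_mul_fderiv_eq_neg_fderiv_mul_of_integrable]
  · simp only [mul_comm]
  · have := i2.const_inner (𝕜 := ℝ) v
    simp only [inner_smul_right, inner_gradient] at this
    simpa only [mul_comm] using this
  · have := i1.const_inner (𝕜 := ℝ) v
    simpa only [inner_smul_right, inner_gradient] using this
  · exact (hψ.continuous.mul ξ.continuous).integrable_of_hasCompactSupport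
      ξ.hasCompactSupport.mul_left
  · exact fun x _ ↦ hψ.differentiable one_ne_zero x
  · exact fun x _ ↦ ξ.differentiable x

end TestFunction

namespace Einstein

variable {N : ℕ} {Ω : Opens (Euc N)}

/-- Fatou's lemma suffices on the left, while the right side converges by domination; hence no bound
on `u n` is required. -/
lemma eLpNorm_le_of_tendsto_of_dominated {α E E' : Type*} [MeasurableSpace α] {μ : Measure α}
    [NormedAddCommGroup E] [NormedAddCommGroup E'] {u : ℕ → α → E} {v : ℕ → α → E'}
    {u₀ : α → E} {v₀ : α → E'} {G : α → ℝ} {p : ℝ≥0} {q : ℝ≥0∞} {C : ℝ≥0} (hp : p ≠ 0)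
    (hu : ∀ n, AEStronglyMeasurable (u n) μ) (hv : ∀ n, AEStronglyMeasurable (v n) μ)
    (hG : MemLp G p μ) (hvG : ∀ n, ∀ᵐ x ∂μ, ‖v n x‖ ≤ G x)
    (hlu : ∀ᵐ x ∂μ, Tendsto (fun n ↦ u n x) atTop (𝓝 (u₀ x)))
    (hlv : ∀ᵐ x ∂μ, Tendsto (fun n ↦ v n x) atTop (𝓝 (v₀ x)))
    (h : ∀ n, eLpNorm (u n) q μ ≤ C * eLpNorm (v n) p μ) :
    eLpNorm u₀ q μ ≤ C * eLpNorm v₀ p μ := by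
  have hp' : (p : ℝ≥0∞) ≠ 0 := by simpa using hp
  have hp0 : (0 : ℝ) < p := by exact_mod_cast pos_iff_ne_zero.2 hp
  have hv' : Tendsto (fun n ↦ eLpNorm (v n) p μ) atTop (𝓝 (eLpNorm v₀ p μ)) := by
    simp only [eLpNorm_eq_lintegral_rpow_enorm_toReal hp' ENNReal.coe_ne_top, ENNReal.coe_toReal]
    refine (ENNReal.continuous_rpow_const.tendsto _).comp ?_
    refine tendsto_lintegral_of_dominated_convergence' (fun x ↦ ‖G x‖ₑ ^ (p : ℝ))
      (fun n ↦ (hv n).enorm.pow_const _) ?_ ?_ ?_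
    · intro n
      filter_upwards [hvG n] with x hx
      gcongr
      rw [← ofReal_norm, ← ofReal_norm]
      exact ENNReal.ofReal_le_ofReal (hx.trans (le_abs_self _))
    · have := lintegral_rpow_enorm_lt_top_of_eLpNorm_lt_top hp' ENNReal.coe_ne_top hG.2
      simpa using this.ne
    · filter_upwards [hlv] with x hx
      exact (ENNReal.continuous_rpow_const.tendsto _).comp hx.enorm
  calc eLpNorm u₀ q μ ≤ liminf (fun n ↦ eLpNorm (u n) q μ) atTop :=
        Lp.eLpNorm_lim_le_liminf_eLpNorm hu u₀ hlu
    _ ≤ liminf (fun n ↦ C * eLpNorm (v n) p μ) atTop :=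
        liminf_le_liminf (Eventually.of_forall h)
    _ = C * eLpNorm v₀ p μ :=
        (ENNReal.Tendsto.const_mul hv' (Or.inr ENNReal.coe_ne_top)).liminf_eq

namespace DominatedApprox

variable {f : Euc N → ℝ} {g : Euc N → Euc N} {η : ℕ → 𝓓(Ω, ℝ)} {G : Euc N → ℝ}

/-- Weak chain rule for a Lipschitz function with a right derivative everywhere. -/
lemma integral_comp_smul_gradient [IsFiniteMeasure (volume.restrict (Ω : Set (Euc N)))]
    (h : DominatedApprox Ω f g η G) {W D : ℝ → ℝ} {K : ℝ≥0} {ε : ℝ}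
    (hε : 0 < ε) (hW : LipschitzWith K W) (hW0 : ∀ r ≤ ε, W r = 0)
    (hD : ∀ r, HasDerivWithinAt W (D r) (Ioi r) r) (ξ : 𝓓(Ω, ℝ)) :
    ∫ x in Ω, W (f x) • gradient (⇑ξ) x = -∫ x in Ω, ξ x • D (f x) • g x := by
  obtain ⟨V, hV1, hV0, hVK, hVle, hVW, hVD⟩ := exists_contDiff_approx hε hW hW0 hD
  obtain ⟨C, hC, hξ, hξ'⟩ := ξ.exists_bound
  have hξ : ∀ x, |ξ x| ≤ C := fun x ↦ (hξ x).trans (indicator_le_self' (fun _ _ ↦ hC) x)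
  have hξ' : ∀ x, ‖gradient (⇑ξ) x‖ ≤ C :=
    fun x ↦ (hξ' x).trans (indicator_le_self' (fun _ _ ↦ hC) x)
  have hb : Integrable (fun x ↦ K * G x * C) (volume.restrict Ω) :=
    ((h.memLp.integrable (by norm_num)).const_mul _).mul_const _
  have hVc : ∀ m, Continuous (deriv (V m)) := fun m ↦ (hV1 m).continuous_deriv le_rfl
  -- The limit in `n` is taken with `m` fixed, because `deriv (V m)` is continuous whereas `D` need
  -- not be. The limit in `m` follows, with `f` already in place.
  have hstep : ∀ m, ∫ x in Ω, V m (f x) • gradient (⇑ξ) x =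
      -∫ x in Ω, ξ x • deriv (V m) (f x) • g x := by
    intro m
    have hd : Differentiable ℝ (V m) := (hV1 m).differentiable one_ne_zero
    have hn : ∀ n, ∫ x in Ω, V m (η n x) • gradient (⇑ξ) x =
        -∫ x in Ω, ξ x • deriv (V m) (η n x) • gradient (⇑(η n)) x := by
      intro n
      have hη : ContDiff ℝ 1 (⇑(η n)) := (η n).contDiff.of_le (by simp)
      rw [ξ.integral_smul_gradient (ψ := fun x ↦ V m (η n x)) ((hV1 m).comp hη)]
      congr 2 with x
      rw [gradient_comp (hd _) ((η n).differentiable x)]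
    refine tendsto_nhds_unique (tendsto_integral_of_dominated_convergence
      (F := fun n x ↦ V m (η n x) • gradient (⇑ξ) x) _ (fun n ↦ ?_) hb (fun n ↦ ?_) ?_)
      (((tendsto_integral_of_dominated_convergence
      (F := fun n x ↦ ξ x • deriv (V m) (η n x) • gradient (⇑(η n)) x) _ (fun n ↦ ?_) hb
        (fun n ↦ ?_) ?_).neg).congr fun n ↦ (hn n).symm)
    · exact (((hV1 m).continuous.comp (η n).continuous).smul
        ξ.continuous_gradient).aestronglyMeasurable
    · filter_upwards [h.le] with x hx
      rw [norm_smul]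
      refine mul_le_mul ((hVle m _).trans ?_) (hξ' x) (norm_nonneg _) ?_
      · exact mul_le_mul_of_nonneg_left (hx n) K.2
      · exact mul_nonneg K.2 ((abs_nonneg _).trans (hx n))
    · filter_upwards [h.tendsto] with x hx
      exact (((hV1 m).continuous.tendsto _).comp hx).smul_const _
    · exact (ξ.continuous.smul (((hVc m).comp (η n).continuous).smul
        (η n).continuous_gradient)).aestronglyMeasurable
    · filter_upwards [h.gradient_le] with x hx
      rw [norm_smul, norm_smul, mul_comm]
      refine mul_le_mul (mul_le_mul (hVK m _) (hx n) (norm_nonneg _) K.2) (hξ x) (norm_nonneg _) ?_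
      exact mul_nonneg K.2 ((norm_nonneg _).trans (hx n))
    · filter_upwards [h.tendsto, h.tendsto_gradient] with x hx hx'
      exact ((((hVc m).tendsto _).comp hx).smul hx').const_smul _
  refine tendsto_nhds_unique (tendsto_integral_of_dominated_convergence
      (F := fun m x ↦ V m (f x) • gradient (⇑ξ) x) _ (fun n ↦ ?_) hb (fun n ↦ ?_) ?_)
      (((tendsto_integral_of_dominated_convergence
      (F := fun m x ↦ ξ x • deriv (V m) (f x) • g x) _ (fun n ↦ ?_) hb
        (fun n ↦ ?_) ?_).neg).congr fun n ↦ (hstep n).symm)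
  · exact ((hV1 n).continuous.comp_aestronglyMeasurable h.aestronglyMeasurable).smul
      ξ.continuous_gradient.aestronglyMeasurable
  · filter_upwards [h.abs_le] with x hx
    rw [norm_smul]
    refine mul_le_mul ((hVle n _).trans ?_) (hξ' x) (norm_nonneg _) ?_
    · exact mul_le_mul_of_nonneg_left hx K.2
    · exact mul_nonneg K.2 ((abs_nonneg _).trans hx)
  · exact Eventually.of_forall fun x ↦ (hVW _).smul_const _
  · exact ξ.continuous.aestronglyMeasurable.smul
      (((hVc n).comp_aestronglyMeasurable h.aestronglyMeasurable).smul
        h.aestronglyMeasurable_gradient)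
  · filter_upwards [h.norm_gradient_le] with x hx
    rw [norm_smul, norm_smul, mul_comm]
    refine mul_le_mul (mul_le_mul (hVK n _) hx (norm_nonneg _) K.2) (hξ x) (norm_nonneg _) ?_
    exact mul_nonneg K.2 ((norm_nonneg _).trans hx)
  · exact Eventually.of_forall fun x ↦ ((hVD _).smul_const _).const_smul _

/-- Sobolev's inequality for a Lipschitz function, vanishing near zero, of an element of
`W₀^{1,2}(Ω)`. -/
lemma eLpNorm_comp_le [IsFiniteMeasure (volume.restrict (Ω : Set (Euc N)))]
    (hΩ : Bornology.IsBounded (Ω : Set (Euc N)))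
    (h : DominatedApprox Ω f g η G) {W D : ℝ → ℝ} {K : ℝ≥0} {ε : ℝ}
    (hε : 0 < ε) (hW : LipschitzWith K W) (hW0 : ∀ r ≤ ε, W r = 0)
    (hD : ∀ r, HasDerivWithinAt W (D r) (Ioi r) r) {p q : ℝ≥0} (hp : 1 ≤ p) (hp2 : p ≤ 2)
    (hpN : p < (N : ℝ≥0)) (hpq : (p : ℝ)⁻¹ - (N : ℝ)⁻¹ ≤ (q : ℝ)⁻¹) :
    eLpNorm (fun x ↦ W (f x)) q (volume.restrict Ω) ≤
      eLpNormLESNormFDerivOfLeConst ℝ (volume : Measure (Euc N)) Ω p q *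
        eLpNorm (fun x ↦ D (f x) • g x) p (volume.restrict Ω) := by
  obtain ⟨V, hV1, hV0, hVK, hVle, hVW, hVD⟩ := exists_contDiff_approx hε hW hW0 hD
  have hp0 : p ≠ 0 := (zero_lt_one.trans_le hp).ne'
  have hVc : ∀ m, Continuous (deriv (V m)) := fun m ↦ (hV1 m).continuous_deriv le_rfl
  have hG : MemLp (fun x ↦ K * G x) p (volume.restrict Ω) :=
    (h.memLp.mono_exponent (by exact_mod_cast hp2)).const_mul _
  have hstep : ∀ m, eLpNorm (fun x ↦ V m (f x)) q (volume.restrict Ω) ≤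
      eLpNormLESNormFDerivOfLeConst ℝ (volume : Measure (Euc N)) Ω p q *
        eLpNorm (fun x ↦ deriv (V m) (f x) • g x) p (volume.restrict Ω) := by
    intro m
    have hd : Differentiable ℝ (V m) := (hV1 m).differentiable one_ne_zero
    refine eLpNorm_le_of_tendsto_of_dominated hp0 (u := fun n x ↦ V m (η n x))
      (v := fun n x ↦ deriv (V m) (η n x) • gradient (⇑(η n)) x) (fun n ↦ ?_) (fun n ↦ ?_) hG
      (fun n ↦ ?_) ?_ ?_ fun n ↦ ?_
    · exact ((hV1 m).continuous.comp (η n).continuous).aestronglyMeasurable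
    · exact (((hVc m).comp (η n).continuous).smul (η n).continuous_gradient).aestronglyMeasurable
    · filter_upwards [h.gradient_le] with x hx
      rw [norm_smul]
      exact mul_le_mul (hVK m _) (hx n) (norm_nonneg _) K.2
    · filter_upwards [h.tendsto] with x hx
      exact (((hV1 m).continuous.tendsto _).comp hx)
    · filter_upwards [h.tendsto, h.tendsto_gradient] with x hx hx'
      exact (((hVc m).tendsto _).comp hx).smul hx'
    · have hη : ContDiff ℝ 1 (⇑(η n)) := (η n).contDiff.of_le (by simp)
      have hsup : (fun x ↦ V m (η n x)).support ⊆ (Ω : Set (Euc N)) := by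
        intro x hx
        refine (η n).tsupport_subset (subset_closure ?_)
        intro h0
        exact hx (by simp [h0, hV0])
      have hsob := eLpNorm_le_eLpNorm_fderiv_of_le (F := ℝ) (volume : Measure (Euc N))
        ((hV1 m).comp hη) hsup hp (by simpa using hpN) (by simpa using hpq) hΩ
      rw [eLpNorm_restrict_eq_of_support_subset hsup]
      refine hsob.trans ?_
      gcongr
      have hfd : ∀ x, ‖fderiv ℝ (V m ∘ ⇑(η n)) x‖ = ‖deriv (V m) (η n x) • gradient (⇑(η n)) x‖ := by
        intro x
        rw [← gradient_comp (hd _) ((η n).differentiable x)]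
        simp [gradient, Function.comp_def]
      rw [eLpNorm_congr_norm_ae (Eventually.of_forall hfd), eLpNorm_restrict_eq_of_support_subset]
      intro x hx
      by_contra hxΩ
      refine hx ?_
      simp only
      rw [(η n).gradient_eq_zero_of_notMem fun h ↦ hxΩ ((η n).tsupport_subset h), smul_zero]
  refine eLpNorm_le_of_tendsto_of_dominated hp0 (u := fun m x ↦ V m (f x))
    (v := fun m x ↦ deriv (V m) (f x) • g x) (fun m ↦ ?_) (fun m ↦ ?_) hG (fun m ↦ ?_) ?_ ?_ hstep
  · exact (hV1 m).continuous.comp_aestronglyMeasurable h.aestronglyMeasurable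
  · exact ((hVc m).comp_aestronglyMeasurable h.aestronglyMeasurable).smul
      h.aestronglyMeasurable_gradient
  · filter_upwards [h.norm_gradient_le] with x hx
    rw [norm_smul]
    exact mul_le_mul (hVK m _) hx (norm_nonneg _) K.2
  · exact Eventually.of_forall fun x ↦ hVW _
  · exact Eventually.of_forall fun x ↦ (hVD _).smul_const _

end DominatedApprox

end Einstein

end

/-! ### Green's formula and identification of the weak gradient -/

section

namespace Einstein

variable {N : ℕ} {Ω : Opens (Euc N)}

/-- A smooth function which is `0` on `(-∞, 0]`, `1` on `[ε, ∞)`, and has a bounded derivative. -/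
lemma exists_smooth_cutoff {ε : ℝ} (hε : 0 < ε) :
    ∃ χ : ℝ → ℝ, ContDiff ℝ (⊤ : ℕ∞) χ ∧ χ 0 = 0 ∧ (∀ r ≥ ε, χ r = 1) ∧ (∀ r, |χ r| ≤ 1) ∧
      (∀ r > ε, deriv χ r = 0) ∧ ∃ C : ℝ, 0 ≤ C ∧ ∀ r, |deriv χ r| ≤ C := by
  set χ : ℝ → ℝ := fun r ↦ Real.smoothTransition (r / ε) with hχ
  have hsm : ContDiff ℝ (⊤ : ℕ∞) χ := Real.smoothTransition.contDiff.comp (contDiff_id.div_const ε)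
  have h1 : ∀ r ≥ ε, χ r = 1 := fun r hr ↦
    Real.smoothTransition.one_of_one_le ((one_le_div₀ hε).2 hr)
  have h0 : ∀ r ≤ 0, χ r = 0 := fun r hr ↦
    Real.smoothTransition.zero_of_nonpos (div_nonpos_of_nonpos_of_nonneg hr hε.le)
  have hd1 : ∀ r > ε, deriv χ r = 0 := fun r hr ↦ by
    have : χ =ᶠ[𝓝 r] fun _ ↦ (1 : ℝ) := by
      filter_upwards [lt_mem_nhds hr] with s hs using h1 s hs.le
    rw [this.deriv_eq, deriv_const]
  have hd0 : ∀ r < 0, deriv χ r = 0 := fun r hr ↦ by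
    have : χ =ᶠ[𝓝 r] fun _ ↦ (0 : ℝ) := by
      filter_upwards [gt_mem_nhds hr] with s hs using h0 s (le_of_lt hs)
    rw [this.deriv_eq, deriv_const]
  have hcs : HasCompactSupport (deriv χ) := by
    refine HasCompactSupport.intro (isCompact_Icc (a := 0) (b := ε)) fun r hr ↦ ?_
    rcases lt_or_ge r 0 with h | h
    · exact hd0 r h
    · exact hd1 r (not_le.1 fun h' ↦ hr ⟨h, h'⟩)
  obtain ⟨C, hC⟩ := (hsm.continuous_deriv (by simp)).bounded_above_of_compact_support hcs
  refine ⟨χ, hsm, h0 0 le_rfl, h1, fun r ↦ ?_, hd1, C, (norm_nonneg _).trans (hC 0), hC⟩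
  rw [abs_of_nonneg (Real.smoothTransition.nonneg _)]
  exact Real.smoothTransition.le_one _

lemma memLp_indicator_of_locallyIntegrableOn_sq {gu : Euc N → Euc N} {K : Set (Euc N)}
    (hgu : LocallyIntegrableOn gu Ω) (hgu2 : LocallyIntegrableOn (fun x ↦ ‖gu x‖ ^ 2) Ω)
    (hK : IsCompact K) (hKΩ : K ⊆ Ω) : MemLp (K.indicator gu) 2 (volume.restrict Ω) := by
  rw [memLp_indicator_iff_restrict hK.measurableSet, Measure.restrict_restrict hK.measurableSet,
    inter_eq_self_of_subset_left hKΩ, memLp_two_iff_integrable_sq_norm]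
  · exact hgu2.integrableOn_compact_subset hKΩ hK
  · exact (hgu.integrableOn_compact_subset hKΩ hK).aestronglyMeasurable

lemma integrable_indicator_of_locallyIntegrableOn {E : Type*} [NormedAddCommGroup E]
    {l : Euc N → E} {K : Set (Euc N)}
    (hl : LocallyIntegrableOn l Ω) (hK : IsCompact K) (hKΩ : K ⊆ Ω) :
    Integrable (K.indicator l) (volume.restrict Ω) := by
  rw [integrable_indicator_iff hK.measurableSet]
  exact (hl.integrableOn_compact_subset hKΩ hK).mono_measure
    Measure.restrict_le_self

namespace DominatedApprox

variable {f : Euc N → ℝ} {g : Euc N → Euc N} {η : ℕ → 𝓓(Ω, ℝ)} {G : Euc N → ℝ}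

/-- This tests the weak Laplacian with `Θ(f) ζ`, the limit of the test functions `Θ(η n) ζ`. The
fixed compact support of `ζ` is what makes the merely local integrability of `gu` and `l`
sufficient. -/
lemma integral_inner_of_testFunction [IsFiniteMeasure (volume.restrict (Ω : Set (Euc N)))]
    (h : DominatedApprox Ω f g η G) {Θ : ℝ → ℝ} (hΘ : ContDiff ℝ (⊤ : ℕ∞) Θ) {C : ℝ}
    (hΘC : ∀ r, |Θ r| ≤ C) (hΘC' : ∀ r, |deriv Θ r| ≤ C) {gu : Euc N → Euc N} {l : Euc N → ℝ}
    (hdiv : HasWeakDivergence Ω gu l) (hgu2 : LocallyIntegrableOn (fun x ↦ ‖gu x‖ ^ 2) Ω)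
    (ζ : 𝓓(Ω, ℝ)) :
    ∫ x in Ω, inner ℝ (gu x) (Θ (f x) • gradient (⇑ζ) x + ζ x • deriv Θ (f x) • g x) =
      -∫ x in Ω, Θ (f x) * ζ x * l x := by
  have hC : 0 ≤ C := (abs_nonneg _).trans (hΘC 0)
  obtain ⟨B, hB, hζ, hζ'⟩ := ζ.exists_bound
  have hΘ'c : Continuous (deriv Θ) := hΘ.continuous_deriv (by simp)
  have hgum : AEStronglyMeasurable gu (volume.restrict Ω) := hdiv.1.aestronglyMeasurable
  have hlm : AEStronglyMeasurable l (volume.restrict Ω) := hdiv.2.1.aestronglyMeasurable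
  have hK : IsCompact (tsupport ζ) := ζ.hasCompactSupport
  have hguK := (memLp_indicator_of_locallyIntegrableOn_sq hdiv.1 hgu2 hK ζ.tsupport_subset).norm
  have hlK := (integrable_indicator_of_locallyIntegrableOn hdiv.2.1 hK ζ.tsupport_subset).norm
  have hbG : MemLp (fun x ↦ C * B + B * (C * G x)) 2 (volume.restrict Ω) := by
    have h1 : MemLp (fun _ : Euc N ↦ C * B) 2 (volume.restrict Ω) := memLp_const _
    exact h1.add ((h.memLp.const_mul C).const_mul B)
  have hb : Integrable (fun x ↦ ‖(tsupport ζ).indicator gu x‖ * (C * B + B * (C * G x)))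
      (volume.restrict Ω) :=
    hguK.integrable_mul hbG
  have hb' : Integrable (fun x ↦ C * B * ‖(tsupport ζ).indicator l x‖) (volume.restrict Ω) :=
    hlK.const_mul _
  have hn : ∀ n, ∫ x in Ω, inner ℝ (gu x)
      (Θ (η n x) • gradient (⇑ζ) x + ζ x • deriv Θ (η n x) • gradient (⇑(η n)) x) =
      -∫ x in Ω, Θ (η n x) * ζ x * l x := by
    intro n
    have hΘη : ContDiff ℝ (⊤ : ℕ∞) fun x ↦ Θ (η n x) := hΘ.comp (η n).contDiff
    have := hdiv.2.2 (TestFunction.smoothMul (fun x ↦ Θ (η n x)) hΘη ζ)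
    have hgr : ∀ x, gradient (⇑(TestFunction.smoothMul (fun x ↦ Θ (η n x)) hΘη ζ)) x =
        Θ (η n x) • gradient (⇑ζ) x + ζ x • deriv Θ (η n x) • gradient (⇑(η n)) x := by
      intro x
      rw [← gradient_comp (hΘ.differentiable (by simp) _) ((η n).differentiable x)]
      exact gradient_mul (hΘη.differentiable (by simp) x) (ζ.differentiable x)
    simp only [hgr] at this
    exact this
  have T1 : Tendsto (fun n ↦ ∫ x in Ω, inner ℝ (gu x)
      (Θ (η n x) • gradient (⇑ζ) x + ζ x • deriv Θ (η n x) • gradient (⇑(η n)) x)) atTop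
      (𝓝 (∫ x in Ω, inner ℝ (gu x) (Θ (f x) • gradient (⇑ζ) x + ζ x • deriv Θ (f x) • g x))) := by
    refine tendsto_integral_of_dominated_convergence _ (fun n ↦ ?_) hb (fun n ↦ ?_) ?_
    · have h1 : Continuous fun x ↦
          Θ (η n x) • gradient (⇑ζ) x + ζ x • deriv Θ (η n x) • gradient (⇑(η n)) x :=
        ((hΘ.continuous.comp (η n).continuous).smul ζ.continuous_gradient).add
          (ζ.continuous.smul ((hΘ'c.comp (η n).continuous).smul (η n).continuous_gradient))
      exact hgum.inner h1.aestronglyMeasurable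
    · filter_upwards [h.gradient_le] with x hx
      by_cases hxK : x ∈ tsupport ζ
      · have hζ := hζ x
        have hζ' := hζ' x
        rw [indicator_of_mem hxK] at hζ hζ' ⊢
        refine (norm_inner_le_norm _ _).trans (mul_le_mul_of_nonneg_left ?_ (norm_nonneg _))
        refine (norm_add_le _ _).trans ?_
        simp only [norm_smul, Real.norm_eq_abs]
        have := hx n
        have h1 := hΘC (η n x)
        have h2 := hΘC' (η n x)
        gcongr
      · rw [ζ.gradient_eq_zero_of_notMem hxK, ζ.eq_zero_of_notMem hxK, indicator_of_notMem hxK]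
        simp
    · filter_upwards [h.tendsto, h.tendsto_gradient] with x hx hx'
      exact tendsto_const_nhds.inner ((((hΘ.continuous.tendsto _).comp hx).smul_const _).add
        (((((hΘ'c).tendsto _).comp hx).smul hx').const_smul _))
  have T2 : Tendsto (fun n ↦ ∫ x in Ω, Θ (η n x) * ζ x * l x) atTop
      (𝓝 (∫ x in Ω, Θ (f x) * ζ x * l x)) := by
    refine tendsto_integral_of_dominated_convergence _ (fun n ↦ ?_) hb' (fun n ↦ ?_) ?_
    · exact ((hΘ.continuous.comp (η n).continuous).mul ζ.continuous).aestronglyMeasurable.mul hlm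
    · refine Eventually.of_forall fun x ↦ ?_
      by_cases hxK : x ∈ tsupport ζ
      · have hζ := hζ x
        rw [indicator_of_mem hxK] at hζ ⊢
        simp only [norm_mul, Real.norm_eq_abs]
        have h1 := hΘC (η n x)
        gcongr
      · simp [ζ.eq_zero_of_notMem hxK, indicator_of_notMem hxK]
    · filter_upwards [h.tendsto] with x hx
      exact (((hΘ.continuous.tendsto _).comp hx).mul_const _).mul_const _
  exact tendsto_nhds_unique T1 (T2.neg.congr fun n ↦ (hn n).symm)

/-- Green's formula tested with a smooth function, vanishing near zero, of an element of
`W₀^{1,2}(Ω)`. -/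
lemma integral_comp_mul [IsFiniteMeasure (volume.restrict (Ω : Set (Euc N)))]
    (h : DominatedApprox Ω f g η G) {ε : ℝ} (hε : 0 < ε) {Θ : ℝ → ℝ}
    (hΘ : ContDiff ℝ (⊤ : ℕ∞) Θ) (hΘ0 : ∀ r ≤ ε, Θ r = 0) {C : ℝ}
    (hΘC : ∀ r, |Θ r| ≤ C) (hΘC' : ∀ r, |deriv Θ r| ≤ C) {gu : Euc N → Euc N} {l : Euc N → ℝ}
    (hdiv : HasWeakDivergence Ω gu l) (hgu2 : LocallyIntegrableOn (fun x ↦ ‖gu x‖ ^ 2) Ω)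
    (hgu : MemLp ({x | ε ≤ f x}.indicator gu) 2 (volume.restrict Ω))
    (hl : Integrable ({x | ε ≤ f x}.indicator l) (volume.restrict Ω)) :
    ∫ x in Ω, Θ (f x) * l x = -∫ x in Ω, deriv Θ (f x) * inner ℝ (gu x) (g x) := by
  have hC : 0 ≤ C := (abs_nonneg _).trans (hΘC 0)
  -- The compactly supported factor is now `χ(η n)`. It tends to `χ(f)`, which is `1` wherever
  -- `Θ(f)` is nonzero, and the assumed integrability on `{ε ≤ f}` provides the domination as the
  -- supports grow.
  obtain ⟨χ, hχ, hχ0, hχ1, hχb, hχd, B, hB, hχB⟩ := exists_smooth_cutoff hε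
  have hχ'c : Continuous (deriv χ) := hχ.continuous_deriv (by simp)
  have hΘ'c : Continuous (deriv Θ) := hΘ.continuous_deriv (by simp)
  have hgum : AEStronglyMeasurable gu (volume.restrict Ω) := hdiv.1.aestronglyMeasurable
  have hlm : AEStronglyMeasurable l (volume.restrict Ω) := hdiv.2.1.aestronglyMeasurable
  have hΘ0' : ∀ r < ε, deriv Θ r = 0 := fun r hr ↦ by
    have : Θ =ᶠ[𝓝 r] fun _ ↦ (0 : ℝ) := by
      filter_upwards [gt_mem_nhds hr] with s hs using hΘ0 s (le_of_lt hs)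
    rw [this.deriv_eq, deriv_const]
  have hb : Integrable (fun x ↦ ‖({x | ε ≤ f x}.indicator gu) x‖ * (C * (B * G x) + C * G x))
      (volume.restrict Ω) :=
    hgu.norm.integrable_mul (((h.memLp.const_mul B).const_mul C).add (h.memLp.const_mul C))
  have hb' : Integrable (fun x ↦ C * ‖({x | ε ≤ f x}.indicator l) x‖) (volume.restrict Ω) :=
    hl.norm.const_mul _
  have hn : ∀ n, ∫ x in Ω, inner ℝ (gu x) (Θ (f x) • deriv χ (η n x) • gradient (⇑(η n)) x +
      χ (η n x) • deriv Θ (f x) • g x) = -∫ x in Ω, Θ (f x) * χ (η n x) * l x := by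
    intro n
    have := h.integral_inner_of_testFunction hΘ hΘC hΘC' hdiv hgu2
      (TestFunction.smoothComp χ hχ hχ0 (η n))
    have hgr : ∀ x, gradient (⇑(TestFunction.smoothComp χ hχ hχ0 (η n))) x =
        deriv χ (η n x) • gradient (⇑(η n)) x := fun x ↦
      gradient_comp (hχ.differentiable (by simp) _) ((η n).differentiable x)
    simp only [hgr] at this
    exact this
  have e1 : ∫ x in Ω, Θ (f x) * l x = ∫ x in Ω, Θ (f x) * χ (f x) * l x := by
    congr 1 with x
    rcases le_total (f x) ε with hx | hx
    · simp [hΘ0 _ hx]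
    · simp [hχ1 _ hx]
  have e2 : ∫ x in Ω, deriv Θ (f x) * inner ℝ (gu x) (g x) =
      ∫ x in Ω, inner ℝ (gu x) (Θ (f x) • deriv χ (f x) • g x +
        χ (f x) • deriv Θ (f x) • g x) := by
    congr 1 with x
    -- On the level `f = ε` nothing is recorded about the derivative of `χ`, but its factor `Θ(ε)`
    -- is zero.
    rcases lt_trichotomy (f x) ε with hx | hx | hx
    · simp [hΘ0 _ hx.le, hΘ0' _ hx]
    · simp [hΘ0 _ hx.le, hχ1 _ hx.ge, inner_smul_right]
    · simp [hχd _ hx, hχ1 _ hx.le, inner_smul_right]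
  have T1 : Tendsto (fun n ↦ ∫ x in Ω, inner ℝ (gu x)
      (Θ (f x) • deriv χ (η n x) • gradient (⇑(η n)) x + χ (η n x) • deriv Θ (f x) • g x)) atTop
      (𝓝 (∫ x in Ω, inner ℝ (gu x)
        (Θ (f x) • deriv χ (f x) • g x + χ (f x) • deriv Θ (f x) • g x))) := by
    refine tendsto_integral_of_dominated_convergence _ (fun n ↦ ?_) hb (fun n ↦ ?_) ?_
    · refine hgum.inner (((hΘ.continuous.comp_aestronglyMeasurable h.aestronglyMeasurable).smul
        (((hχ'c.comp (η n).continuous).smul (η n).continuous_gradient).aestronglyMeasurable)).add ?_)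
      exact (hχ.continuous.comp (η n).continuous).aestronglyMeasurable.smul
        ((hΘ'c.comp_aestronglyMeasurable h.aestronglyMeasurable).smul
          h.aestronglyMeasurable_gradient)
    · filter_upwards [h.gradient_le, h.norm_gradient_le] with x hx hx'
      rcases lt_or_ge (f x) ε with hxε | hxε
      · simp [hΘ0 _ hxε.le, hΘ0' _ hxε, indicator_of_notMem (s := {x | ε ≤ f x}) (a := x)
          (by simpa using hxε)]
      · rw [indicator_of_mem (s := {x | ε ≤ f x}) (a := x) (by simpa using hxε)]
        refine (norm_inner_le_norm _ _).trans (mul_le_mul_of_nonneg_left ?_ (norm_nonneg _))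
        refine (norm_add_le _ _).trans ?_
        simp only [norm_smul, Real.norm_eq_abs]
        have h0 := hx n
        have h1 := hΘC (f x)
        have h2 := hΘC' (f x)
        have h3 := hχB (η n x)
        have h4 := hχb (η n x)
        have h5 : |χ (η n x)| * (|deriv Θ (f x)| * ‖g x‖) ≤ 1 * (C * G x) := by gcongr
        rw [one_mul] at h5
        refine add_le_add ?_ h5
        gcongr
    · filter_upwards [h.tendsto, h.tendsto_gradient] with x hx hx'
      exact tendsto_const_nhds.inner
        ((((hχ'c.tendsto _).comp hx).smul hx').const_smul _ |>.add
        (((hχ.continuous.tendsto _).comp hx).smul_const _))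
  have T2 : Tendsto (fun n ↦ ∫ x in Ω, Θ (f x) * χ (η n x) * l x) atTop
      (𝓝 (∫ x in Ω, Θ (f x) * χ (f x) * l x)) := by
    refine tendsto_integral_of_dominated_convergence _ (fun n ↦ ?_) hb' (fun n ↦ ?_) ?_
    · exact ((hΘ.continuous.comp_aestronglyMeasurable h.aestronglyMeasurable).mul
        (hχ.continuous.comp (η n).continuous).aestronglyMeasurable).mul hlm
    · refine Eventually.of_forall fun x ↦ ?_
      rcases lt_or_ge (f x) ε with hxε | hxε
      · simp only [hΘ0 _ hxε.le, zero_mul, norm_zero]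
        positivity
      · rw [indicator_of_mem (s := {x | ε ≤ f x}) (a := x) (by simpa using hxε)]
        simp only [norm_mul, Real.norm_eq_abs]
        have h1 := hΘC (f x)
        have h4 := hχb (η n x)
        have : |Θ (f x)| * |χ (η n x)| ≤ C * 1 := by gcongr
        rw [mul_one] at this
        gcongr
    · filter_upwards [h.tendsto] with x hx
      exact ((((hχ.continuous.tendsto _).comp hx).const_mul _).mul_const _)
  rw [e1, e2, tendsto_nhds_unique T1 (T2.neg.congr fun n ↦ (hn n).symm), neg_neg]

/-- If `u = U ∘ f` has a weak gradient, it is given by the chain rule where `f` is positive. -/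
lemma smul_weakGradient_eq [IsFiniteMeasure (volume.restrict (Ω : Set (Euc N)))]
    (h : DominatedApprox Ω f g η G) {ε : ℝ} (hε : 0 < ε) {θ U : ℝ → ℝ}
    (hθ : ContDiff ℝ (⊤ : ℕ∞) θ) (hθ0 : ∀ r ≤ ε, θ r = 0) {C : ℝ}
    (hθC : ∀ r, |θ r| ≤ C) (hθC' : ∀ r, |deriv θ r| ≤ C)
    (hU : ∀ r > 0, DifferentiableAt ℝ U r) {K : ℝ≥0} (hK : LipschitzWith K fun r ↦ θ r * U r)
    (hUC : ∀ r, |θ r * deriv U r| ≤ C)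
    {u : Euc N → ℝ} {gu : Euc N → Euc N} (hu : HasWeakGradient Ω u gu)
    (hu2 : MemLp u 2 (volume.restrict Ω))
    (huU : ∀ᵐ x ∂(volume.restrict (Ω : Set (Euc N))), u x = U (f x)) :
    ∀ᵐ x ∂(volume.restrict (Ω : Set (Euc N))),
      θ (f x) • gu x = (θ (f x) * deriv U (f x)) • g x := by
  have hC : 0 ≤ C := (abs_nonneg _).trans (hθC 0)
  have hθ'c : Continuous (deriv θ) := hθ.continuous_deriv (by simp)
  have hgum : AEStronglyMeasurable gu (volume.restrict Ω) := hu.2.1.aestronglyMeasurable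
  have hθ0' : ∀ r < ε, deriv θ r = 0 := fun r hr ↦ by
    have : θ =ᶠ[𝓝 r] fun _ ↦ (0 : ℝ) := by
      filter_upwards [gt_mem_nhds hr] with s hs using hθ0 s (le_of_lt hs)
    rw [this.deriv_eq, deriv_const]
  have hθf : AEStronglyMeasurable (fun x ↦ θ (f x)) (volume.restrict Ω) :=
    hθ.continuous.comp_aestronglyMeasurable h.aestronglyMeasurable
  have hθ'f : AEStronglyMeasurable (fun x ↦ deriv θ (f x)) (volume.restrict Ω) :=
    hθ'c.comp_aestronglyMeasurable h.aestronglyMeasurable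
  have hU'f : AEStronglyMeasurable (fun x ↦ deriv U (f x)) (volume.restrict Ω) :=
    ((measurable_deriv U).comp_aemeasurable h.aestronglyMeasurable.aemeasurable).aestronglyMeasurable
  have hD : ∀ r, HasDerivWithinAt (fun r ↦ θ r * U r) (deriv θ r * U r + θ r * deriv U r)
      (Ioi r) r := by
    intro r
    refine HasDerivAt.hasDerivWithinAt ?_
    rcases le_or_gt r 0 with hr | hr
    · have hr' := hr.trans_lt hε
      have : (fun r ↦ θ r * U r) =ᶠ[𝓝 r] fun _ ↦ (0 : ℝ) := by
        filter_upwards [gt_mem_nhds hr'] with s hs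
        rw [hθ0 s (le_of_lt hs), zero_mul]
      rw [hθ0 r hr'.le, hθ0' r hr']
      simpa using (hasDerivAt_const r (0 : ℝ)).congr_of_eventuallyEq this
    · exact (hθ.differentiable (by simp) r).hasDerivAt.mul (hU r hr).hasDerivAt
  have hintθU : Integrable (fun x ↦ (θ (f x) * deriv U (f x)) • g x) (volume.restrict Ω) := by
    refine ((h.memLp.integrable (by norm_num)).const_mul C).mono'
      ((hθf.mul hU'f).smul h.aestronglyMeasurable_gradient) ?_
    filter_upwards [h.norm_gradient_le] with x hx
    rw [norm_smul]
    exact mul_le_mul (hUC _) hx (norm_nonneg _) hC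
  have hloc : LocallyIntegrableOn (fun x ↦ θ (f x) • gu x - (θ (f x) * deriv U (f x)) • g x)
      Ω := by
    refine LocallyIntegrableOn.sub ?_ (IntegrableOn.locallyIntegrableOn hintθU)
    rw [locallyIntegrableOn_iff Ω.isOpen.isLocallyClosed]
    intro k hk hkc
    exact Integrable.bdd_smul (hu.2.1.integrableOn_compact_subset hk hkc) C
      (hθf.mono_set hk) (Eventually.of_forall fun x ↦ hθC _)
  -- By the fundamental lemma of the calculus of variations, it suffices to test with `ξ`. Two
  -- integrations by parts are compared: the weak gradient of `u` against `θ(f) ξ`, and the chain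
  -- rule for `θ U` against `ξ`. The terms with `θ'` cancel because `u = U(f)`.
  have key := Ω.isOpen.ae_eq_zero_of_integral_contDiff_smul_eq_zero hloc ?_
  · rw [ae_restrict_iff' Ω.isOpen.measurableSet]
    filter_upwards [key] with x hx hxΩ
    exact sub_eq_zero.1 (hx hxΩ)
  intro ξ₀ hξ₀ hξ₀c hξ₀Ω
  set ξ : 𝓓(Ω, ℝ) := ⟨ξ₀, hξ₀, hξ₀c, hξ₀Ω⟩ with hξdef
  change ∫ x, ξ x • _ = 0
  obtain ⟨B, hB, hξ, hξ'⟩ := ξ.exists_bound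
  have hξB : ∀ x, |ξ x| ≤ B := fun x ↦ (hξ x).trans (indicator_le_self' (fun _ _ ↦ hB) x)
  have hξB' : ∀ x, ‖gradient (⇑ξ) x‖ ≤ B :=
    fun x ↦ (hξ' x).trans (indicator_le_self' (fun _ _ ↦ hB) x)
  rw [← setIntegral_eq_integral_of_forall_compl_eq_zero (s := (Ω : Set (Euc N)))
      fun x hx ↦ by rw [ξ.eq_zero_of_notMem fun h ↦ hx (ξ.tsupport_subset h), zero_smul]]
  have hguK := (integrable_indicator_of_locallyIntegrableOn hu.2.1 ξ.hasCompactSupport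
    ξ.tsupport_subset).norm
  have hbG : MemLp (fun x ↦ C * B + B * (C * G x)) 2 (volume.restrict Ω) := by
    have h1 : MemLp (fun _ : Euc N ↦ C * B) 2 (volume.restrict Ω) := memLp_const _
    exact h1.add ((h.memLp.const_mul C).const_mul B)
  have hb : Integrable (fun x ↦ |u x| * (C * B + B * (C * G x))) (volume.restrict Ω) :=
    hu2.abs.integrable_mul hbG
  have hb' : Integrable (fun x ↦ C * B * ‖(tsupport ξ).indicator gu x‖) (volume.restrict Ω) :=
    hguK.const_mul _
  have hbd : ∀ (r s : ℝ) (v : Euc N) (x : Euc N), ‖v‖ ≤ G x →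
      ‖u x • (θ r • gradient (⇑ξ) x + ξ x • deriv θ s • v)‖ ≤ |u x| * (C * B + B * (C * G x)) := by
    intro r s v x hv
    rw [norm_smul, Real.norm_eq_abs]
    refine mul_le_mul_of_nonneg_left ?_ (abs_nonneg _)
    refine (norm_add_le _ _).trans ?_
    simp only [norm_smul, Real.norm_eq_abs]
    have h1 := hθC r
    have h2 := hθC' s
    have h3 := hξB x
    have h4 := hξB' x
    gcongr
  have hbd' : ∀ (r : ℝ) (x : Euc N), ‖(θ r * ξ x) • gu x‖ ≤
      C * B * ‖(tsupport ξ).indicator gu x‖ := by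
    intro r x
    by_cases hxK : x ∈ tsupport ξ
    · rw [indicator_of_mem hxK]
      rw [norm_smul, norm_mul, Real.norm_eq_abs, Real.norm_eq_abs]
      have h1 := hθC r
      have h3 := hξB x
      gcongr
    · simp [ξ.eq_zero_of_notMem hxK, indicator_of_notMem hxK]
  have hlim : ∫ x in Ω, u x • (θ (f x) • gradient (⇑ξ) x + ξ x • deriv θ (f x) • g x) =
      -∫ x in Ω, (θ (f x) * ξ x) • gu x := by
    have hn : ∀ n, ∫ x in Ω, u x •
        (θ (η n x) • gradient (⇑ξ) x + ξ x • deriv θ (η n x) • gradient (⇑(η n)) x) =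
        -∫ x in Ω, (θ (η n x) * ξ x) • gu x := by
      intro n
      have hθη : ContDiff ℝ (⊤ : ℕ∞) fun x ↦ θ (η n x) := hθ.comp (η n).contDiff
      have := hu.2.2 (TestFunction.smoothMul (fun x ↦ θ (η n x)) hθη ξ)
      have hgr : ∀ x, gradient (⇑(TestFunction.smoothMul (fun x ↦ θ (η n x)) hθη ξ)) x =
          θ (η n x) • gradient (⇑ξ) x + ξ x • deriv θ (η n x) • gradient (⇑(η n)) x := by
        intro x
        rw [← gradient_comp (hθ.differentiable (by simp) _) ((η n).differentiable x)]
        exact gradient_mul (hθη.differentiable (by simp) x) (ξ.differentiable x)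
      simp only [hgr] at this
      exact this
    have T1 : Tendsto (fun n ↦ ∫ x in Ω, u x •
        (θ (η n x) • gradient (⇑ξ) x + ξ x • deriv θ (η n x) • gradient (⇑(η n)) x)) atTop
        (𝓝 (∫ x in Ω, u x • (θ (f x) • gradient (⇑ξ) x + ξ x • deriv θ (f x) • g x))) := by
      refine tendsto_integral_of_dominated_convergence _ (fun n ↦ ?_) hb (fun n ↦ ?_) ?_
      · have h1 : Continuous fun x ↦
            θ (η n x) • gradient (⇑ξ) x + ξ x • deriv θ (η n x) • gradient (⇑(η n)) x :=
          ((hθ.continuous.comp (η n).continuous).smul ξ.continuous_gradient).add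
            (ξ.continuous.smul ((hθ'c.comp (η n).continuous).smul (η n).continuous_gradient))
        exact hu2.1.smul h1.aestronglyMeasurable
      · filter_upwards [h.gradient_le] with x hx
        exact hbd _ _ _ _ (hx n)
      · filter_upwards [h.tendsto, h.tendsto_gradient] with x hx hx'
        exact ((((hθ.continuous.tendsto _).comp hx).smul_const _).add
          ((((hθ'c.tendsto _).comp hx).smul hx').const_smul _)).const_smul _
    have T2 : Tendsto (fun n ↦ ∫ x in Ω, (θ (η n x) * ξ x) • gu x) atTop
        (𝓝 (∫ x in Ω, (θ (f x) * ξ x) • gu x)) := by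
      refine tendsto_integral_of_dominated_convergence _ (fun n ↦ ?_) hb' (fun n ↦ ?_) ?_
      · exact ((hθ.continuous.comp (η n).continuous).mul
          ξ.continuous).aestronglyMeasurable.smul hgum
      · exact Eventually.of_forall fun x ↦ hbd' _ _
      · filter_upwards [h.tendsto] with x hx
        exact (((hθ.continuous.tendsto _).comp hx).mul_const _).smul_const _
    exact tendsto_nhds_unique T1 (T2.neg.congr fun n ↦ (hn n).symm)
  have hchain := h.integral_comp_smul_gradient hε hK
    (fun r hr ↦ by rw [hθ0 r hr, zero_mul]) hD ξ
  have i1 : Integrable (fun x ↦ (θ (f x) * ξ x) • gu x) (volume.restrict Ω) :=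
    hb'.mono' ((hθf.mul ξ.continuous.aestronglyMeasurable).smul hgum)
      (Eventually.of_forall fun x ↦ hbd' _ _)
  have i2 : Integrable (fun x ↦ (θ (f x) * U (f x)) • gradient (⇑ξ) x) (volume.restrict Ω) := by
    have hb2 : Integrable (fun x ↦ |u x| * (C * B)) (volume.restrict Ω) :=
      (hu2.integrable (by norm_num)).abs.mul_const _
    refine hb2.mono' ((hK.continuous.comp_aestronglyMeasurable h.aestronglyMeasurable).smul
      ξ.continuous_gradient.aestronglyMeasurable) ?_
    filter_upwards [huU] with x hx
    rw [norm_smul, norm_mul, ← hx, mul_comm ‖θ (f x)‖, mul_assoc]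
    exact mul_le_mul_of_nonneg_left (mul_le_mul (hθC _) (hξB' x) (norm_nonneg _) hC)
      (norm_nonneg _)
  have i3 : Integrable (fun x ↦ ξ x • (θ (f x) * deriv U (f x)) • g x) (volume.restrict Ω) :=
    hintθU.bdd_smul B ξ.continuous.aestronglyMeasurable (Eventually.of_forall hξB)
  have i4 : Integrable (fun x ↦ u x • (θ (f x) • gradient (⇑ξ) x + ξ x • deriv θ (f x) • g x))
      (volume.restrict Ω) := by
    refine hb.mono' (hu2.1.smul ((hθf.smul ξ.continuous_gradient.aestronglyMeasurable).add
      (ξ.continuous.aestronglyMeasurable.smul (hθ'f.smul h.aestronglyMeasurable_gradient)))) ?_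
    filter_upwards [h.norm_gradient_le] with x hx
    exact hbd _ _ _ _ hx
  have i5 : Integrable (fun x ↦ u x • (θ (f x) • gradient (⇑ξ) x + ξ x • deriv θ (f x) • g x) -
      (θ (f x) * U (f x)) • gradient (⇑ξ) x) (volume.restrict Ω) := i4.sub i2
  have e1 : ∫ x in Ω, ξ x • (deriv θ (f x) * U (f x) + θ (f x) * deriv U (f x)) • g x =
      ∫ x in Ω, ((u x • (θ (f x) • gradient (⇑ξ) x + ξ x • deriv θ (f x) • g x) -
      (θ (f x) * U (f x)) • gradient (⇑ξ) x) + ξ x • (θ (f x) * deriv U (f x)) • g x) := by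
    refine integral_congr_ae ?_
    filter_upwards [huU] with x hx
    rw [hx]
    module
  rw [e1, integral_add i5 i3, integral_sub i4 i2, hlim] at hchain
  have e2 : ∫ x in Ω, ξ x • (θ (f x) • gu x - (θ (f x) * deriv U (f x)) • g x) =
      (∫ x in Ω, (θ (f x) * ξ x) • gu x) - ∫ x in Ω, ξ x • (θ (f x) * deriv U (f x)) • g x := by
    rw [← integral_sub i1 i3]
    congr 1 with x
    rw [smul_sub, smul_smul, mul_comm]
  rw [e2]
  set a := ∫ x in Ω, (θ (f x) * ξ x) • gu x
  set b := ∫ x in Ω, ξ x • (θ (f x) * deriv U (f x)) • g x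
  set c := ∫ x in Ω, (θ (f x) * U (f x)) • gradient (⇑ξ) x
  have : a - b = -(c - -(-a - c + b)) := by abel
  rw [this, ← hchain, sub_self, neg_zero]

end DominatedApprox

end Einstein

end

/-! ### The flux and its inverse -/

section

namespace Einstein

namespace IsAdmissible

variable {h a : ℝ → ℝ}

lemma intervalIntegrable (hh : IsAdmissible h a) {s t : ℝ} (hs : 0 ≤ s) (ht : 0 ≤ t) :
    IntervalIntegrable h volume s t := by
  rw [intervalIntegrable_iff']
  refine hh.h_int.integrableOn_compact_subset (fun x hx ↦ ?_) isCompact_uIcc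
  exact (le_inf hs ht).trans hx.1

lemma H_zero : H h 0 = 0 := intervalIntegral.integral_same

lemma H_sub (hh : IsAdmissible h a) {s t : ℝ} (hs : 0 ≤ s) (ht : 0 ≤ t) :
    H h t - H h s = ∫ r in s..t, h r :=
  intervalIntegral.integral_interval_sub_left (hh.intervalIntegrable le_rfl ht)
    (hh.intervalIntegrable le_rfl hs)

lemma hasStrictDerivAt_H (hh : IsAdmissible h a) {s : ℝ} (hs : 0 < s) :
    HasStrictDerivAt (H h) (h s) s :=
  intervalIntegral.integral_hasStrictDerivAt_right (hh.intervalIntegrable le_rfl hs.le)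
    (hh.h_cont.stronglyMeasurableAtFilter isOpen_Ioi s hs) (hh.h_cont.continuousAt (Ioi_mem_nhds hs))

lemma hasDerivAt_H (hh : IsAdmissible h a) {s : ℝ} (hs : 0 < s) : HasDerivAt (H h) (h s) s :=
  (hh.hasStrictDerivAt_H hs).hasDerivAt

lemma continuousOn_H (hh : IsAdmissible h a) : ContinuousOn (H h) (Ici 0) := by
  intro s hs
  have h1 : ContinuousOn (H h) (uIcc 0 (s + 1)) :=
    intervalIntegral.continuousOn_primitive_interval'
      (hh.intervalIntegrable le_rfl (by linarith [mem_Ici.1 hs])) left_mem_uIcc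
  rw [uIcc_of_le (by linarith [mem_Ici.1 hs])] at h1
  refine (h1 s ⟨hs, by linarith⟩).mono_of_mem_nhdsWithin ?_
  filter_upwards [self_mem_nhdsWithin, mem_nhdsWithin_of_mem_nhds (gt_mem_nhds (lt_add_one s))]
    with x hx hx' using ⟨hx, le_of_lt hx'⟩

lemma strictMonoOn_H (hh : IsAdmissible h a) : StrictMonoOn (H h) (Ici 0) := by
  refine strictMonoOn_of_deriv_pos (convex_Ici 0) hh.continuousOn_H fun x hx ↦ ?_
  rw [interior_Ici] at hx
  rw [(hh.hasDerivAt_H hx).deriv]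
  exact hh.h_pos x hx

lemma H_pos (hh : IsAdmissible h a) {s : ℝ} (hs : 0 < s) : 0 < H h s := by
  simpa [H_zero] using hh.strictMonoOn_H self_mem_Ici hs.le hs

lemma H_nonneg (hh : IsAdmissible h a) {s : ℝ} (hs : 0 ≤ s) : 0 ≤ H h s := by
  simpa [H_zero] using hh.strictMonoOn_H.monotoneOn self_mem_Ici hs hs

lemma continuousOn_F (hh : IsAdmissible h a) : ContinuousOn (F h a) (Ici 0) :=
  hh.F_lip.continuousOn

lemma F_zero (hh : IsAdmissible h a) : F h a 0 = 0 := by simp [F, hh.a_zero]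

lemma F_pos (hh : IsAdmissible h a) {s : ℝ} (hs : 0 < s) : 0 < F h a s :=
  mul_pos (hh.h_pos s hs) (hh.a_pos s hs)

end IsAdmissible

/-- The flux `H(s) ^ p * F(s)`. -/
def flux (h a : ℝ → ℝ) (p s : ℝ) : ℝ := H h s ^ p * F h a s

/-- The derivative of `H ^ p * F` is bounded below by `c * H ^ q`. -/
structure FluxGrowth (h a : ℝ → ℝ) (p q c : ℝ) : Prop where
  adm : IsAdmissible h a
  p_pos : 0 < p
  q_pos : 0 < q
  c_pos : 0 < c
  growth : ∀ s ∈ Ici (0 : ℝ), DifferentiableWithinAt ℝ (flux h a p) (Ici 0) s ∧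
    c * H h s ^ q ≤ derivWithin (flux h a p) (Ici 0) s

/-- A strictly increasing function of `[0, ∞)` onto itself has a continuous monotone inverse,
extended to the whole line. -/
lemma exists_monotone_inverse {P : ℝ → ℝ} (hc : ContinuousOn P (Ici 0))
    (hm : StrictMonoOn P (Ici 0)) (h0 : P 0 = 0) (ht : Tendsto P atTop atTop) :
    ∃ U : ℝ → ℝ, Continuous U ∧ StrictMono U ∧ (∀ s ≥ 0, U (P s) = s) ∧
      (∀ r ≥ 0, 0 ≤ U r) ∧ (∀ r ≥ 0, P (U r) = r) := by
  -- Extending `P` by the identity on the negative axis gives an increasing bijection of the whole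
  -- line, whose inverse is continuous as an order isomorphism.
  set Q : ℝ → ℝ := fun s ↦ min s 0 + P (max s 0) with hQ
  have hQ0 : ∀ s ≥ 0, Q s = P s := fun s hs ↦ by simp [hQ, hs]
  have hQc : Continuous Q := by
    refine (continuous_id.min continuous_const).add ?_
    exact hc.comp_continuous (continuous_id.max continuous_const) fun x ↦ mem_Ici.2 (le_max_right x 0)
  have hQm : StrictMono Q := by
    intro s t hst
    simp only [hQ]
    rcases lt_or_ge s 0 with hs | hs
    · refine add_lt_add_of_lt_of_le ?_ (hm.monotoneOn (mem_Ici.2 (le_max_right _ _))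
        (mem_Ici.2 (le_max_right _ _))
        (max_le_max_right 0 hst.le))
      rw [min_eq_left hs.le]
      exact lt_min hst hs
    · have ht0 : 0 ≤ t := hs.trans hst.le
      simpa [hs, ht0] using hm hs ht0 hst
  have hQtop : Tendsto Q atTop atTop := by
    refine ht.congr' ?_
    filter_upwards [eventually_ge_atTop 0] with s hs using (hQ0 s hs).symm
  have hQbot : Tendsto Q atBot atBot := by
    refine tendsto_id.congr' ?_
    filter_upwards [eventually_le_atBot 0] with s hs
    simp [hQ, hs, h0]
  set e : ℝ ≃o ℝ := hQm.orderIsoOfSurjective Q (hQc.surjective hQtop hQbot) with he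
  have heQ : ∀ s, e s = Q s := fun s ↦ rfl
  have hnn : ∀ r ≥ 0, 0 ≤ e.symm r := fun r hr ↦ by
    rw [OrderIso.le_symm_apply, heQ, hQ0 0 le_rfl, h0]
    exact hr
  refine ⟨e.symm, e.symm.continuous, e.symm.strictMono, fun s hs ↦ ?_, hnn, fun r hr ↦ ?_⟩
  · rw [← hQ0 s hs, ← heQ, e.symm_apply_apply]
  · rw [← hQ0 _ (hnn r hr), ← heQ, e.apply_symm_apply]

namespace FluxGrowth

variable {h a : ℝ → ℝ} {p q c : ℝ}

lemma flux_zero (A : FluxGrowth h a p q c) : flux h a p 0 = 0 := by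
  simp [flux, A.adm.F_zero]

lemma continuousOn_flux (A : FluxGrowth h a p q c) : ContinuousOn (flux h a p) (Ici 0) :=
  fun s hs ↦ (A.growth s hs).1.continuousWithinAt

lemma differentiableAt_flux (A : FluxGrowth h a p q c) {s : ℝ} (hs : 0 < s) :
    DifferentiableAt ℝ (flux h a p) s :=
  (A.growth s hs.le).1.differentiableAt (Ici_mem_nhds hs)

lemma le_deriv_flux (A : FluxGrowth h a p q c) {s : ℝ} (hs : 0 < s) :
    c * H h s ^ q ≤ deriv (flux h a p) s := by
  rw [← derivWithin_of_mem_nhds (Ici_mem_nhds hs)]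
  exact (A.growth s hs.le).2

lemma deriv_flux_pos (A : FluxGrowth h a p q c) {s : ℝ} (hs : 0 < s) :
    0 < deriv (flux h a p) s :=
  (mul_pos A.c_pos (Real.rpow_pos_of_pos (A.adm.H_pos hs) _)).trans_le (A.le_deriv_flux hs)

lemma strictMonoOn_flux (A : FluxGrowth h a p q c) : StrictMonoOn (flux h a p) (Ici 0) := by
  refine strictMonoOn_of_deriv_pos (convex_Ici 0) A.continuousOn_flux fun x hx ↦ ?_
  rw [interior_Ici] at hx
  exact A.deriv_flux_pos hx

lemma flux_nonneg (A : FluxGrowth h a p q c) {s : ℝ} (hs : 0 ≤ s) : 0 ≤ flux h a p s := by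
  simpa [A.flux_zero] using A.strictMonoOn_flux.monotoneOn self_mem_Ici hs hs

/-- On `[1, ∞)` the derivative is at least `c * H(1) ^ q > 0`, so the growth is at least linear. -/
lemma tendsto_flux (A : FluxGrowth h a p q c) : Tendsto (flux h a p) atTop atTop := by
  set K := c * H h 1 ^ q
  have hK : 0 < K := mul_pos A.c_pos (Real.rpow_pos_of_pos (A.adm.H_pos one_pos) _)
  have hle : ∀ s ≥ 1, K * (s - 1) + flux h a p 1 ≤ flux h a p s := by
    intro s hs
    have := Convex.mul_sub_le_image_sub_of_le_deriv (f := flux h a p) (convex_Ici 1)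
      (A.continuousOn_flux.mono (Ici_subset_Ici.2 zero_le_one))
      (fun x hx ↦ by
        rw [interior_Ici] at hx
        exact (A.differentiableAt_flux (one_pos.trans hx)).differentiableWithinAt)
      (C := K) (fun x hx ↦ by
        rw [interior_Ici] at hx
        refine le_trans ?_ (A.le_deriv_flux (one_pos.trans hx))
        refine mul_le_mul_of_nonneg_left (Real.rpow_le_rpow (A.adm.H_nonneg zero_le_one) ?_
          A.q_pos.le) A.c_pos.le
        exact A.adm.strictMonoOn_H.monotoneOn (mem_Ici.2 zero_le_one)
          (mem_Ici.2 (zero_le_one.trans (le_of_lt hx))) (le_of_lt hx)) 1 self_mem_Ici s hs hs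
    linarith
  refine tendsto_atTop_mono' _ (f₁ := fun s ↦ K * (s - 1) + flux h a p 1) ?_ ?_
  · filter_upwards [eventually_ge_atTop 1] with s hs using hle s hs
  · exact tendsto_atTop_add_const_right _ _
      ((tendsto_atTop_add_const_right _ (-1) tendsto_id).const_mul_atTop hK)

lemma exists_inverse (A : FluxGrowth h a p q c) :
    ∃ U : ℝ → ℝ, Continuous U ∧ StrictMono U ∧ (∀ s ≥ 0, U (flux h a p s) = s) ∧
      (∀ r ≥ 0, 0 ≤ U r) ∧ (∀ r ≥ 0, flux h a p (U r) = r) :=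
  exists_monotone_inverse A.continuousOn_flux A.strictMonoOn_flux A.flux_zero A.tendsto_flux

end FluxGrowth

/-- The inverse of the flux. -/
def fluxInv {h a : ℝ → ℝ} {p q c : ℝ} (A : FluxGrowth h a p q c) : ℝ → ℝ := A.exists_inverse.choose

namespace FluxGrowth

variable {h a : ℝ → ℝ} {p q c : ℝ}

lemma continuous_fluxInv (A : FluxGrowth h a p q c) : Continuous (fluxInv A) :=
  A.exists_inverse.choose_spec.1

lemma strictMono_fluxInv (A : FluxGrowth h a p q c) : StrictMono (fluxInv A) :=
  A.exists_inverse.choose_spec.2.1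

lemma fluxInv_flux (A : FluxGrowth h a p q c) {s : ℝ} (hs : 0 ≤ s) :
    fluxInv A (flux h a p s) = s :=
  A.exists_inverse.choose_spec.2.2.1 s hs

lemma fluxInv_nonneg (A : FluxGrowth h a p q c) {r : ℝ} (hr : 0 ≤ r) : 0 ≤ fluxInv A r :=
  A.exists_inverse.choose_spec.2.2.2.1 r hr

lemma flux_fluxInv (A : FluxGrowth h a p q c) {r : ℝ} (hr : 0 ≤ r) :
    flux h a p (fluxInv A r) = r :=
  A.exists_inverse.choose_spec.2.2.2.2 r hr

lemma fluxInv_zero (A : FluxGrowth h a p q c) : fluxInv A 0 = 0 := by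
  simpa [A.flux_zero] using A.fluxInv_flux le_rfl

lemma fluxInv_pos (A : FluxGrowth h a p q c) {r : ℝ} (hr : 0 < r) : 0 < fluxInv A r := by
  simpa [A.fluxInv_zero] using A.strictMono_fluxInv hr

lemma hasDerivAt_fluxInv (A : FluxGrowth h a p q c) {r : ℝ} (hr : 0 < r) :
    HasDerivAt (fluxInv A) (deriv (flux h a p) (fluxInv A r))⁻¹ r := by
  refine HasDerivAt.of_local_left_inverse A.continuous_fluxInv.continuousAt
    (A.differentiableAt_flux (A.fluxInv_pos hr)).hasDerivAt (A.deriv_flux_pos (A.fluxInv_pos hr)).ne'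
    ?_
  filter_upwards [lt_mem_nhds hr] with s hs using A.flux_fluxInv (le_of_lt hs)

lemma deriv_fluxInv_pos (A : FluxGrowth h a p q c) {r : ℝ} (hr : 0 < r) :
    0 < deriv (fluxInv A) r := by
  rw [(A.hasDerivAt_fluxInv hr).deriv]
  exact inv_pos.2 (A.deriv_flux_pos (A.fluxInv_pos hr))

lemma deriv_fluxInv_le (A : FluxGrowth h a p q c) {r : ℝ} (hr : 0 < r) :
    deriv (fluxInv A) r ≤ (c * H h (fluxInv A r) ^ q)⁻¹ := by
  rw [(A.hasDerivAt_fluxInv hr).deriv]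
  have hs := A.fluxInv_pos hr
  exact inv_anti₀ (mul_pos A.c_pos (Real.rpow_pos_of_pos (A.adm.H_pos hs) _)) (A.le_deriv_flux hs)

lemma H_fluxInv_mono (A : FluxGrowth h a p q c) {r s : ℝ} (hr : 0 ≤ r) (hrs : r ≤ s) :
    H h (fluxInv A r) ≤ H h (fluxInv A s) :=
  A.adm.strictMonoOn_H.monotoneOn (A.fluxInv_nonneg hr) (A.fluxInv_nonneg (hr.trans hrs))
    (A.strictMono_fluxInv.monotone hrs)

/-- The bound `1 / (c H ^ q)` decreases along the flux, so only values near `0` can make the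
derivative of the inverse large. This is why all truncations stay away from `0`. -/
lemma exists_deriv_fluxInv_le (A : FluxGrowth h a p q c) {ε : ℝ} (hε : 0 < ε) :
    ∃ K : ℝ, 0 ≤ K ∧ ∀ r ≥ ε, deriv (fluxInv A) r ≤ K := by
  have hpos : 0 < c * H h (fluxInv A ε) ^ q :=
    mul_pos A.c_pos (Real.rpow_pos_of_pos (A.adm.H_pos (A.fluxInv_pos hε)) _)
  refine ⟨(c * H h (fluxInv A ε) ^ q)⁻¹, (inv_pos.2 hpos).le, fun r hr ↦ ?_⟩
  refine (A.deriv_fluxInv_le (hε.trans_le hr)).trans (inv_anti₀ hpos ?_)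
  exact mul_le_mul_of_nonneg_left (Real.rpow_le_rpow (A.adm.H_nonneg (A.fluxInv_pos hε).le)
    (A.H_fluxInv_mono hε.le hr) A.q_pos.le) A.c_pos.le

/-- Linear growth follows from the derivative bound beyond `1`; it transfers square integrability
from the flux to `u`. -/
lemma exists_fluxInv_le (A : FluxGrowth h a p q c) :
    ∃ K : ℝ, 0 ≤ K ∧ ∀ r ≥ 0, fluxInv A r ≤ K + K * r := by
  obtain ⟨K, hK, hle⟩ := A.exists_deriv_fluxInv_le one_pos
  have hU1 := A.fluxInv_pos one_pos
  refine ⟨fluxInv A 1 + K, by positivity, fun r hr ↦ ?_⟩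
  rcases le_total r 1 with h1 | h1
  · have := A.strictMono_fluxInv.monotone h1
    have : 0 ≤ (fluxInv A 1 + K) * r := by positivity
    linarith
  · have := Convex.image_sub_le_mul_sub_of_deriv_le (f := fluxInv A) (convex_Ici 1)
      A.continuous_fluxInv.continuousOn
      (fun x hx ↦ by
        rw [interior_Ici] at hx
        exact (A.hasDerivAt_fluxInv (one_pos.trans hx)).differentiableAt.differentiableWithinAt)
      (C := K) (fun x hx ↦ by
        rw [interior_Ici] at hx
        exact hle x (le_of_lt hx)) 1 self_mem_Ici r h1 h1
    nlinarith [mul_nonneg hU1.le hr]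

end FluxGrowth

/-! ### Smooth truncations -/

/-- A smooth function with values in `[0, 1]` and support in `[1 / (j + 1), j + 2]`. -/
def bump (j : ℕ) (r : ℝ) : ℝ :=
  Real.smoothTransition ((j + 1) * r - 1) * Real.smoothTransition (j + 2 - r)

lemma contDiff_bump (j : ℕ) : ContDiff ℝ (⊤ : ℕ∞) (bump j) :=
  (Real.smoothTransition.contDiff.comp (by fun_prop)).mul
    (Real.smoothTransition.contDiff.comp (by fun_prop))

lemma bump_nonneg (j : ℕ) (r : ℝ) : 0 ≤ bump j r :=
  mul_nonneg (Real.smoothTransition.nonneg _) (Real.smoothTransition.nonneg _)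

lemma bump_le_one (j : ℕ) (r : ℝ) : bump j r ≤ 1 :=
  mul_le_one₀ (Real.smoothTransition.le_one _) (Real.smoothTransition.nonneg _)
    (Real.smoothTransition.le_one _)

lemma bump_of_le (j : ℕ) {r : ℝ} (hr : r ≤ 1 / (j + 1)) : bump j r = 0 := by
  have : ((j : ℝ) + 1) * r - 1 ≤ 0 := by
    rw [le_div_iff₀ (by positivity)] at hr
    linarith
  simp [bump, Real.smoothTransition.zero_of_nonpos this]

lemma bump_of_ge (j : ℕ) {r : ℝ} (hr : (j : ℝ) + 2 ≤ r) : bump j r = 0 := by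
  have : (j : ℝ) + 2 - r ≤ 0 := by linarith
  simp [bump, Real.smoothTransition.zero_of_nonpos this]

lemma bump_mono {r : ℝ} : Monotone fun j ↦ bump j r := by
  intro i j hij
  have hij' : (i : ℝ) ≤ j := by exact_mod_cast hij
  rcases le_total r 0 with hr | hr
  · simp only
    rw [bump_of_le i (hr.trans (by positivity)), bump_of_le j (hr.trans (by positivity))]
  · refine mul_le_mul ?_ ?_ (Real.smoothTransition.nonneg _) (Real.smoothTransition.nonneg _)
    · apply Real.smoothTransition.monotone
      have := mul_le_mul_of_nonneg_right hij' hr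
      linarith
    · apply Real.smoothTransition.monotone
      linarith

lemma tendsto_bump {r : ℝ} (hr : 0 < r) : Tendsto (fun j ↦ bump j r) atTop (𝓝 1) := by
  refine tendsto_const_nhds.congr' ?_
  filter_upwards [eventually_ge_atTop ⌈2 / r⌉₊, eventually_ge_atTop ⌈r⌉₊] with j h1 h2
  have h1 := Nat.ceil_le.1 h1
  have h2 := Nat.ceil_le.1 h2
  rw [div_le_iff₀ hr] at h1
  rw [bump, Real.smoothTransition.one_of_one_le (by linarith),
    Real.smoothTransition.one_of_one_le (by linarith), mul_one]

lemma hasCompactSupport_bump (j : ℕ) : HasCompactSupport (bump j) := by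
  refine HasCompactSupport.intro (isCompact_Icc (a := 0) (b := (j : ℝ) + 2)) fun r hr ↦ ?_
  rcases le_or_gt r 0 with h | h
  · exact bump_of_le j (h.trans (by positivity))
  · exact bump_of_ge j (not_lt.1 fun h' ↦ hr ⟨h.le, h'.le⟩)

lemma exists_deriv_bump_le (j : ℕ) : ∃ C : ℝ, ∀ r, |deriv (bump j) r| ≤ C :=
  ((contDiff_bump j).continuous_deriv (by simp)).bounded_above_of_compact_support
    (hasCompactSupport_bump j).deriv

/-- The primitive of `bump j`. -/
def ramp (j : ℕ) (r : ℝ) : ℝ := ∫ s in (0 : ℝ)..r, bump j s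

lemma hasDerivAt_ramp (j : ℕ) (r : ℝ) : HasDerivAt (ramp j) (bump j r) r :=
  intervalIntegral.integral_hasDerivAt_right ((contDiff_bump j).continuous.intervalIntegrable _ _)
    ((contDiff_bump j).continuous.stronglyMeasurableAtFilter _ _)
    (contDiff_bump j).continuous.continuousAt

lemma deriv_ramp (j : ℕ) : deriv (ramp j) = bump j := funext fun r ↦ (hasDerivAt_ramp j r).deriv

lemma contDiff_ramp (j : ℕ) : ContDiff ℝ (⊤ : ℕ∞) (ramp j) := by
  rw [contDiff_infty_iff_deriv, deriv_ramp]
  exact ⟨fun r ↦ (hasDerivAt_ramp j r).differentiableAt, contDiff_bump j⟩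

lemma ramp_of_le (j : ℕ) {r : ℝ} (hr : r ≤ 1 / (j + 1)) : ramp j r = 0 := by
  rw [ramp, intervalIntegral.integral_congr (g := fun _ ↦ (0 : ℝ)), intervalIntegral.integral_zero]
  intro s hs
  refine bump_of_le j (hs.2.trans (max_le ?_ hr))
  positivity

lemma ramp_nonneg (j : ℕ) (r : ℝ) : 0 ≤ ramp j r := by
  rcases le_total r 0 with hr | hr
  · rw [ramp_of_le j (hr.trans (by positivity))]
  · exact intervalIntegral.integral_nonneg hr fun s _ ↦ bump_nonneg j s

lemma intervalIntegrable_bump (j : ℕ) (r s : ℝ) : IntervalIntegrable (bump j) volume r s :=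
  (contDiff_bump j).continuous.intervalIntegrable _ _

lemma ramp_le_self (j : ℕ) {r : ℝ} (hr : 0 ≤ r) : ramp j r ≤ r := by
  have := intervalIntegral.integral_mono_on hr (intervalIntegrable_bump j 0 r)
    (intervalIntegrable_const (c := (1 : ℝ))) fun s _ ↦ bump_le_one j s
  simpa [ramp] using this

lemma ramp_mono_left {r : ℝ} (hr : 0 ≤ r) : Monotone fun j ↦ ramp j r := fun i j hij ↦
  intervalIntegral.integral_mono_on hr (intervalIntegrable_bump i 0 r)
    (intervalIntegrable_bump j 0 r) fun _ _ ↦ bump_mono hij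

lemma ramp_monotone (j : ℕ) : Monotone (ramp j) :=
  monotone_of_deriv_nonneg (fun r ↦ (hasDerivAt_ramp j r).differentiableAt) fun r ↦ by
    rw [deriv_ramp]; exact bump_nonneg j r

lemma ramp_le (j : ℕ) (r : ℝ) : ramp j r ≤ j + 2 := by
  rcases le_total r (j + 2) with hr | hr
  · exact (ramp_monotone j hr).trans (ramp_le_self j (by positivity))
  · have h1 : ramp j r = ramp j (j + 2) + ∫ s in ((j : ℝ) + 2)..r, bump j s :=
      (intervalIntegral.integral_add_adjacent_intervals (intervalIntegrable_bump j _ _)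
        (intervalIntegrable_bump j _ _)).symm
    rw [h1, intervalIntegral.integral_congr (g := fun _ ↦ (0 : ℝ)),
      intervalIntegral.integral_zero, add_zero]
    · exact ramp_le_self j (by positivity)
    · intro s hs
      rw [uIcc_of_le hr] at hs
      exact bump_of_ge j hs.1

lemma tendsto_ramp {r : ℝ} (hr : 0 ≤ r) : Tendsto (fun j ↦ ramp j r) atTop (𝓝 r) := by
  have := intervalIntegral.tendsto_integral_filter_of_dominated_convergence
    (F := bump) (f := fun _ ↦ (1 : ℝ)) (μ := volume) (a := 0) (b := r) (l := atTop)
    (fun _ ↦ (1 : ℝ))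
    (Eventually.of_forall fun j ↦ (contDiff_bump j).continuous.aestronglyMeasurable)
    (Eventually.of_forall fun j ↦ Eventually.of_forall fun s _ ↦ by
      rw [Real.norm_eq_abs, abs_of_nonneg (bump_nonneg j s)]; exact bump_le_one j s)
    intervalIntegrable_const
    (Eventually.of_forall fun s hs ↦ by
      rw [uIoc_of_le hr] at hs
      exact tendsto_bump hs.1)
  simpa [ramp] using this

end Einstein

end

/-! ### The energy identity in space -/

section

namespace Einstein

variable {N : ℕ} {Ω : Opens (Euc N)} {h a : ℝ → ℝ} {p q c : ℝ}

namespace FluxGrowth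

variable {u : Euc N → ℝ} {gu : Euc N → Euc N} {l : Euc N → ℝ}
  {g : Euc N → Euc N} {η : ℕ → 𝓓(Ω, ℝ)} {G : Euc N → ℝ}

/-- A strong solution is only assumed locally integrable in space; global square integrability comes
from the boundary condition, since `u` grows at most linearly in its flux. -/
lemma memLp_two_of_dominatedApprox [IsFiniteMeasure (volume.restrict (Ω : Set (Euc N)))]
    (A : FluxGrowth h a p q c)
    (hf : DominatedApprox Ω (fun x ↦ flux h a p (u x)) g η G)
    (hu0 : ∀ᵐ x ∂(volume.restrict (Ω : Set (Euc N))), 0 ≤ u x) :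
    MemLp u 2 (volume.restrict Ω) := by
  obtain ⟨K, hK, hle⟩ := A.exists_fluxInv_le
  have huU : ∀ᵐ x ∂(volume.restrict (Ω : Set (Euc N))), fluxInv A (flux h a p (u x)) = u x := by
    filter_upwards [hu0] with x hx using A.fluxInv_flux hx
  have hm : AEStronglyMeasurable u (volume.restrict Ω) :=
    (A.continuous_fluxInv.comp_aestronglyMeasurable hf.aestronglyMeasurable).congr huU
  have hb : MemLp (fun x ↦ K + K * G x) 2 (volume.restrict Ω) := by
    have h1 : MemLp (fun _ : Euc N ↦ K) 2 (volume.restrict Ω) := memLp_const _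
    exact h1.add (hf.memLp.const_mul K)
  refine hb.mono' hm ?_
  filter_upwards [hu0, huU, hf.abs_le] with x hx hxU hxG
  rw [Real.norm_eq_abs, abs_of_nonneg hx]
  have h1 := hle _ (A.flux_nonneg hx)
  rw [hxU] at h1
  have h2 := mul_le_mul_of_nonneg_left ((le_abs_self _).trans hxG) hK
  linarith

/-- The chain rule is applied to `bump j * fluxInv`, which is Lipschitz: the support of `bump j`
avoids `0`, where the derivative of the inverse may blow up, and infinity, where the inverse is
unbounded. -/
lemma weakGradient_eq [IsFiniteMeasure (volume.restrict (Ω : Set (Euc N)))]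
    (A : FluxGrowth h a p q c)
    (hf : DominatedApprox Ω (fun x ↦ flux h a p (u x)) g η G)
    (hu0 : ∀ᵐ x ∂(volume.restrict (Ω : Set (Euc N))), 0 ≤ u x)
    (hu : HasWeakGradient Ω u gu) :
    ∀ᵐ x ∂(volume.restrict (Ω : Set (Euc N))), 0 < flux h a p (u x) →
      gu x = deriv (fluxInv A) (flux h a p (u x)) • g x := by
  have huU : ∀ᵐ x ∂(volume.restrict (Ω : Set (Euc N))), u x = fluxInv A (flux h a p (u x)) := by
    filter_upwards [hu0] with x hx using (A.fluxInv_flux hx).symm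
  have hj : ∀ j : ℕ, ∀ᵐ x ∂(volume.restrict (Ω : Set (Euc N))),
      bump j (flux h a p (u x)) • gu x =
        (bump j (flux h a p (u x)) * deriv (fluxInv A) (flux h a p (u x))) • g x := by
    intro j
    have hε : (0 : ℝ) < 1 / (j + 1) := by positivity
    obtain ⟨K, hK, hKle⟩ := A.exists_deriv_fluxInv_le hε
    obtain ⟨B, hB⟩ := exists_deriv_bump_le j
    have hB0 : 0 ≤ B := (abs_nonneg _).trans (hB 0)
    have hbd : ∀ r, |bump j r * deriv (fluxInv A) r| ≤ K := by
      intro r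
      rcases le_total r (1 / (j + 1)) with hr | hr
      · rw [bump_of_le j hr, zero_mul, abs_zero]; exact hK
      · have hr0 := hε.trans_le hr
        rw [abs_of_nonneg (mul_nonneg (bump_nonneg j r) (A.deriv_fluxInv_pos hr0).le)]
        calc bump j r * deriv (fluxInv A) r ≤ 1 * K :=
              mul_le_mul (bump_le_one j r) (hKle r hr) (A.deriv_fluxInv_pos hr0).le zero_le_one
          _ = K := one_mul K
    have hder : ∀ r, HasDerivAt (fun r ↦ bump j r * fluxInv A r)
        (deriv (bump j) r * fluxInv A r + bump j r * deriv (fluxInv A) r) r := by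
      intro r
      rcases le_or_gt r 0 with hr | hr
      · have hr' := hr.trans_lt hε
        have hev : bump j =ᶠ[𝓝 r] fun _ ↦ (0 : ℝ) := by
          filter_upwards [gt_mem_nhds hr'] with s hs using bump_of_le j (le_of_lt hs)
        have hev' : (fun r ↦ bump j r * fluxInv A r) =ᶠ[𝓝 r] fun _ ↦ (0 : ℝ) := by
          filter_upwards [hev] with s hs
          rw [hs, zero_mul]
        rw [bump_of_le j hr'.le, hev.deriv_eq, deriv_const]
        simpa using (hasDerivAt_const r (0 : ℝ)).congr_of_eventuallyEq hev'
      · exact ((contDiff_bump j).differentiable (by simp) r).hasDerivAt.mul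
          (A.hasDerivAt_fluxInv hr).differentiableAt.hasDerivAt
    have hdbd : ∀ r, |deriv (bump j) r * fluxInv A r| ≤ B * fluxInv A (j + 2) := by
      intro r
      have hU2 : 0 ≤ fluxInv A (j + 2) := A.fluxInv_nonneg (by positivity)
      rcases lt_or_ge r 0 with hr | hr
      · have hev : bump j =ᶠ[𝓝 r] fun _ ↦ (0 : ℝ) := by
          filter_upwards [gt_mem_nhds (hr.trans hε)] with s hs using bump_of_le j (le_of_lt hs)
        rw [hev.deriv_eq, deriv_const, zero_mul, abs_zero]
        positivity
      rcases le_or_gt r (j + 2) with hr2 | hr2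
      · rw [abs_mul, abs_of_nonneg (A.fluxInv_nonneg hr)]
        exact mul_le_mul (hB r) (A.strictMono_fluxInv.monotone hr2) (A.fluxInv_nonneg hr) hB0
      · have hev : bump j =ᶠ[𝓝 r] fun _ ↦ (0 : ℝ) := by
          filter_upwards [lt_mem_nhds hr2] with s hs using bump_of_ge j (le_of_lt hs)
        rw [hev.deriv_eq, deriv_const, zero_mul, abs_zero]
        positivity
    have hlip : LipschitzWith (Real.toNNReal (B * fluxInv A (j + 2) + K))
        (fun r ↦ bump j r * fluxInv A r) := by
      refine lipschitzWith_of_nnnorm_deriv_le (fun r ↦ (hder r).differentiableAt) fun r ↦ ?_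
      rw [(hder r).deriv, ← NNReal.coe_le_coe, coe_nnnorm]
      refine le_trans ?_ (Real.le_coe_toNNReal _)
      exact (norm_add_le _ _).trans (add_le_add (hdbd r) (hbd r))
    refine hf.smul_weakGradient_eq (C := max 1 (max B K)) (u := u) hε (contDiff_bump j)
      (fun r hr ↦ bump_of_le j hr)
      (fun r ↦ ?_) (fun r ↦ (hB r).trans ((le_max_left _ _).trans (le_max_right _ _)))
      (fun r hr ↦ (A.hasDerivAt_fluxInv hr).differentiableAt) hlip
      (fun r ↦ (hbd r).trans ((le_max_right _ _).trans (le_max_right _ _))) hu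
      (A.memLp_two_of_dominatedApprox hf hu0) huU
    rw [abs_of_nonneg (bump_nonneg j r)]
    exact (bump_le_one j r).trans (le_max_left _ _)
  filter_upwards [ae_all_iff.2 hj] with x hx hpos
  -- Where the flux is positive some `bump j` is nonzero and can be divided out; countably many `j`
  -- cost only one null set.
  obtain ⟨j, hj⟩ := ((tendsto_bump hpos).eventually (lt_mem_nhds one_half_lt_one)).exists
  have hj0 : bump j (flux h a p (u x)) ≠ 0 := ne_of_gt (by linarith)
  have := hx j
  rw [mul_smul] at this
  exact smul_right_injective _ hj0 this

/-- The energy identity for a truncation of the flux. -/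
lemma integral_ramp_mul [IsFiniteMeasure (volume.restrict (Ω : Set (Euc N)))]
    (A : FluxGrowth h a p q c)
    (hf : DominatedApprox Ω (fun x ↦ flux h a p (u x)) g η G)
    (hu0 : ∀ᵐ x ∂(volume.restrict (Ω : Set (Euc N))), 0 ≤ u x)
    (hu : HasWeakGradient Ω u gu) (hgu2 : LocallyIntegrableOn (fun x ↦ ‖gu x‖ ^ 2) Ω)
    (hdiv : HasWeakDivergence Ω gu l)
    (hFl : MemLp (fun x ↦ F h a (u x) * l x) 2 (volume.restrict Ω)) (j : ℕ) :
    Integrable (fun x ↦ bump j (flux h a p (u x)) *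
      (deriv (fluxInv A) (flux h a p (u x)) * ‖g x‖ ^ 2)) (volume.restrict Ω) ∧
    ∫ x in Ω, ramp j (flux h a p (u x)) * l x =
      -∫ x in Ω, bump j (flux h a p (u x)) *
        (deriv (fluxInv A) (flux h a p (u x)) * ‖g x‖ ^ 2) := by
  have hε : (0 : ℝ) < 1 / (j + 1) := by positivity
  obtain ⟨K, hK, hKle⟩ := A.exists_deriv_fluxInv_le hε
  have hgr := A.weakGradient_eq hf hu0 hu
  have hset : NullMeasurableSet {x | 1 / ((j : ℝ) + 1) ≤ flux h a p (u x)} (volume.restrict Ω) :=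
    nullMeasurableSet_le aemeasurable_const hf.aestronglyMeasurable.aemeasurable
  have hguL : MemLp ({x | 1 / ((j : ℝ) + 1) ≤ flux h a p (u x)}.indicator gu) 2
      (volume.restrict Ω) := by
    refine (hf.memLp.const_mul K).mono' (hu.2.1.aestronglyMeasurable.indicator₀ hset) ?_
    filter_upwards [hgr, hf.norm_gradient_le] with x hx hxG
    by_cases hxs : 1 / ((j : ℝ) + 1) ≤ flux h a p (u x)
    · have hpos := hε.trans_le hxs
      rw [indicator_of_mem (by exact hxs), hx hpos, norm_smul, Real.norm_eq_abs,
        abs_of_pos (A.deriv_fluxInv_pos hpos)]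
      exact mul_le_mul (hKle _ hxs) hxG (norm_nonneg _) hK
    · rw [indicator_of_notMem (by exact hxs), norm_zero]
      exact mul_nonneg hK ((norm_nonneg _).trans hxG)
  -- Where the flux is at least `1 / (j + 1)`, the monotone `F(u)` is at least a positive constant,
  -- so the square integrability of `F(u) Δu` bounds `Δu` itself.
  have hlL : Integrable ({x | 1 / ((j : ℝ) + 1) ≤ flux h a p (u x)}.indicator l)
      (volume.restrict Ω) := by
    have hs := A.fluxInv_pos hε
    have hF := A.adm.F_pos hs
    refine ((hFl.integrable (by norm_num)).norm.const_mul (F h a (fluxInv A (1 / (j + 1))))⁻¹).mono'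
      (hdiv.2.1.aestronglyMeasurable.indicator₀ hset) ?_
    filter_upwards [hu0] with x hx
    by_cases hxs : 1 / ((j : ℝ) + 1) ≤ flux h a p (u x)
    · rw [indicator_of_mem (by exact hxs), inv_mul_eq_div, le_div_iff₀ hF, norm_mul, mul_comm]
      refine mul_le_mul_of_nonneg_right ?_ (norm_nonneg _)
      refine (A.adm.F_mono hs.le hx ?_).trans (le_abs_self _)
      rw [← A.fluxInv_flux hx]
      exact A.strictMono_fluxInv.monotone hxs
    · rw [indicator_of_notMem (by exact hxs), norm_zero]
      positivity
  constructor
  · have hb : Integrable (fun x ↦ K * G x ^ 2) (volume.restrict Ω) :=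
      hf.memLp.integrable_sq.const_mul K
    have hfm := hf.aestronglyMeasurable
    refine hb.mono' (((contDiff_bump j).continuous.comp_aestronglyMeasurable hfm).mul
      ((((measurable_deriv (fluxInv A)).comp_aemeasurable
        hfm.aemeasurable).aestronglyMeasurable).mul
          (hf.aestronglyMeasurable_gradient.norm.pow 2))) ?_
    filter_upwards [hf.norm_gradient_le] with x hxG
    rcases le_total (flux h a p (u x)) (1 / (j + 1)) with hr | hr
    · rw [bump_of_le j hr, zero_mul, norm_zero]
      positivity
    · have hd := A.deriv_fluxInv_pos (hε.trans_le hr)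
      rw [Real.norm_eq_abs, abs_of_nonneg (mul_nonneg (bump_nonneg j _) (by positivity))]
      have h1 := bump_le_one j (flux h a p (u x))
      have h2 := hKle _ hr
      calc _ ≤ 1 * (K * G x ^ 2) := by
            gcongr
        _ = _ := one_mul _
  · have hj2 : (1 : ℝ) ≤ j + 2 := by have : (0 : ℝ) ≤ j := j.cast_nonneg; linarith
    rw [hf.integral_comp_mul (C := j + 2) hε (contDiff_ramp j) (fun r hr ↦ ramp_of_le j hr)
      (fun r ↦ by rw [abs_of_nonneg (ramp_nonneg j r)]; exact ramp_le j r)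
      (fun r ↦ by
        rw [deriv_ramp, abs_of_nonneg (bump_nonneg j r)]
        exact (bump_le_one j r).trans hj2) hdiv hgu2 hguL hlL, deriv_ramp]
    congr 1
    refine integral_congr_ae ?_
    filter_upwards [hgr] with x hx
    rcases le_or_gt (flux h a p (u x)) 0 with hr | hr
    · rw [bump_of_le j (hr.trans hε.le), zero_mul, zero_mul]
    · rw [hx hr, real_inner_smul_left, real_inner_self_eq_norm_sq]

/-- The square root of the energy density. -/
def energyRoot (A : FluxGrowth h a p q c) (u : Euc N → ℝ) (g : Euc N → Euc N) (x : Euc N) : ℝ :=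
  if 0 < flux h a p (u x) then √(deriv (fluxInv A) (flux h a p (u x))) * ‖g x‖ else 0

lemma aestronglyMeasurable_energyRoot (A : FluxGrowth h a p q c)
    (hf : DominatedApprox Ω (fun x ↦ flux h a p (u x)) g η G) :
    AEStronglyMeasurable (A.energyRoot u g) (volume.restrict Ω) := by
  have hfm := hf.aestronglyMeasurable
  have hset : NullMeasurableSet {x | 0 < flux h a p (u x)} (volume.restrict Ω) :=
    nullMeasurableSet_lt aemeasurable_const hfm.aemeasurable
  have h1 : AEStronglyMeasurable
      (fun x ↦ √(deriv (fluxInv A) (flux h a p (u x))) * ‖g x‖) (volume.restrict Ω) :=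
    ((((measurable_deriv (fluxInv A)).comp_aemeasurable
      hfm.aemeasurable).sqrt).aestronglyMeasurable).mul hf.aestronglyMeasurable_gradient.norm
  refine (h1.indicator₀ hset).congr (Eventually.of_forall fun x ↦ ?_)
  simp [energyRoot, indicator]

/-- The energy is bounded by any common bound of the truncated energies. -/
lemma lintegral_energyRoot_sq_le [IsFiniteMeasure (volume.restrict (Ω : Set (Euc N)))]
    (A : FluxGrowth h a p q c)
    (hf : DominatedApprox Ω (fun x ↦ flux h a p (u x)) g η G)
    (hu0 : ∀ᵐ x ∂(volume.restrict (Ω : Set (Euc N))), 0 ≤ u x)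
    (hu : HasWeakGradient Ω u gu) (hgu2 : LocallyIntegrableOn (fun x ↦ ‖gu x‖ ^ 2) Ω)
    (hdiv : HasWeakDivergence Ω gu l)
    (hFl : MemLp (fun x ↦ F h a (u x) * l x) 2 (volume.restrict Ω)) {R : ℝ}
    (hR : ∀ j, -∫ x in Ω, ramp j (flux h a p (u x)) * l x ≤ R) :
    ∫⁻ x in Ω, ENNReal.ofReal (A.energyRoot u g x ^ 2) ≤ ENNReal.ofReal R := by
  have hid := A.integral_ramp_mul hf hu0 hu hgu2 hdiv hFl
  have hnn : ∀ j x, 0 ≤ bump j (flux h a p (u x)) *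
      (deriv (fluxInv A) (flux h a p (u x)) * ‖g x‖ ^ 2) := by
    intro j x
    rcases le_or_gt (flux h a p (u x)) 0 with hr | hr
    · rw [bump_of_le j (hr.trans (by positivity)), zero_mul]
    · have := A.deriv_fluxInv_pos hr
      have := bump_nonneg j (flux h a p (u x))
      positivity
  have hj : ∀ j, ∫⁻ x in Ω, ENNReal.ofReal (bump j (flux h a p (u x)) *
      (deriv (fluxInv A) (flux h a p (u x)) * ‖g x‖ ^ 2)) ≤ ENNReal.ofReal R := by
    intro j
    rw [← ofReal_integral_eq_lintegral_ofReal (hid j).1 (Eventually.of_forall (hnn j))]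
    refine ENNReal.ofReal_le_ofReal ?_
    have := hR j
    rw [(hid j).2, neg_neg] at this
    exact this
  have hlim : ∀ x, Tendsto (fun j ↦ ENNReal.ofReal (bump j (flux h a p (u x)) *
      (deriv (fluxInv A) (flux h a p (u x)) * ‖g x‖ ^ 2))) atTop
      (𝓝 (ENNReal.ofReal (A.energyRoot u g x ^ 2))) := by
    intro x
    refine (ENNReal.continuous_ofReal.tendsto _).comp ?_
    rcases le_or_gt (flux h a p (u x)) 0 with hr | hr
    · simp only [energyRoot, hr.not_gt, if_false]
      refine tendsto_const_nhds.congr fun j ↦ ?_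
      rw [bump_of_le j (hr.trans (by positivity))]
      simp
    · simp only [energyRoot, hr, if_true, mul_pow, Real.sq_sqrt (A.deriv_fluxInv_pos hr).le]
      simpa using (tendsto_bump hr).mul_const
        (deriv (fluxInv A) (flux h a p (u x)) * ‖g x‖ ^ 2)
  -- Fatou's lemma: `bump j` tends to `1` where the flux is positive, and where it is zero both
  -- sides vanish by the convention in `energyRoot`.
  calc ∫⁻ x in Ω, ENNReal.ofReal (A.energyRoot u g x ^ 2)
      = ∫⁻ x in Ω, liminf (fun j ↦ ENNReal.ofReal (bump j (flux h a p (u x)) *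
          (deriv (fluxInv A) (flux h a p (u x)) * ‖g x‖ ^ 2))) atTop := by
        congr 1 with x
        exact (hlim x).liminf_eq.symm
    _ ≤ liminf (fun j ↦ ∫⁻ x in Ω, ENNReal.ofReal (bump j (flux h a p (u x)) *
          (deriv (fluxInv A) (flux h a p (u x)) * ‖g x‖ ^ 2))) atTop :=
        lintegral_liminf_le' fun j ↦ (hid j).1.aestronglyMeasurable.aemeasurable.ennreal_ofReal
    _ ≤ ENNReal.ofReal R := by
        refine (liminf_le_liminf (Eventually.of_forall hj)).trans ?_
        simp

end FluxGrowth

end Einstein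

end

/-! ### Interpolation between `Y`, `Z` and the energy -/

section

namespace Einstein

variable {N : ℕ} {Ω : Opens (Euc N)} {h a : ℝ → ℝ} {p q c : ℝ}

lemma IsAdmissible.continuous_H_max (hh : IsAdmissible h a) :
    Continuous fun s ↦ H h (max s 0) :=
  hh.continuousOn_H.comp_continuous (continuous_id.max continuous_const)
    fun x ↦ mem_Ici.2 (le_max_right x 0)

/-- The derivative of `H ^ (γ + 1)` is bounded above by `C * H ^ β`. -/
structure PowerGrowth (h : ℝ → ℝ) (γ β C : ℝ) : Prop where
  γ_pos : 0 < γ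
  β_pos : 0 < β
  C_pos : 0 < C
  growth : ∀ s ∈ Ici (0 : ℝ), DifferentiableWithinAt ℝ (fun r ↦ H h r ^ (γ + 1)) (Ici 0) s ∧
    derivWithin (fun r ↦ H h r ^ (γ + 1)) (Ici 0) s ≤ C * H h s ^ β

namespace FluxGrowth

variable {γ β C : ℝ}

/-- The power `H ^ (γ + 1)` as a function of the flux. -/
def power (A : FluxGrowth h a p q c) (γ r : ℝ) : ℝ := H h (fluxInv A r) ^ (γ + 1)

lemma exists_hasDerivAt_power (A : FluxGrowth h a p q c) (B : PowerGrowth h γ β C) {r : ℝ}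
    (hr : 0 < r) :
    ∃ d, HasDerivAt (A.power γ) d r ∧ 0 ≤ d ∧
      d ≤ C * H h (fluxInv A r) ^ β * deriv (fluxInv A) r := by
  have hs := A.fluxInv_pos hr
  have hd := A.deriv_fluxInv_pos hr
  have h1 : HasDerivAt (fun s ↦ H h s ^ (γ + 1))
      (h (fluxInv A r) * (γ + 1) * H h (fluxInv A r) ^ (γ + 1 - 1)) (fluxInv A r) :=
    (A.adm.hasDerivAt_H hs).rpow_const (Or.inl (A.adm.H_pos hs).ne')
  have h2 := h1.comp r (A.hasDerivAt_fluxInv hr).differentiableAt.hasDerivAt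
  refine ⟨_, h2, mul_nonneg ?_ hd.le, mul_le_mul_of_nonneg_right ?_ hd.le⟩
  · have := A.adm.h_pos _ hs
    have := A.adm.H_pos hs
    have := B.γ_pos
    positivity
  · have := (B.growth _ hs.le).2
    rwa [derivWithin_of_mem_nhds (Ici_mem_nhds hs), h1.deriv] at this

/-- Of the factor `U' = √U' * √U'`, one root is spent on `U' ≤ 1 / (c H ^ q)`, lowering the exponent
of `H` from `β` to `β - q / 2`; the other is kept for the energy. -/
lemma deriv_power_le (A : FluxGrowth h a p q c) (B : PowerGrowth h γ β C) {r : ℝ} (hr : 0 < r) :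
    |deriv (A.power γ) r| ≤
      C / √c * (H h (fluxInv A r) ^ (β - q / 2) * √(deriv (fluxInv A) r)) := by
  obtain ⟨d, hd, hd0, hdle⟩ := A.exists_hasDerivAt_power B hr
  have hs := A.fluxInv_pos hr
  have hH := A.adm.H_pos hs
  have hU := A.deriv_fluxInv_pos hr
  have hC := B.C_pos
  have hc := A.c_pos
  rw [hd.deriv, abs_of_nonneg hd0]
  refine hdle.trans ?_
  have h1 : √(deriv (fluxInv A) r) ≤ (√c * H h (fluxInv A r) ^ (q / 2))⁻¹ := by
    refine Real.sqrt_le_iff.2 ⟨by positivity, (A.deriv_fluxInv_le hr).trans_eq ?_⟩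
    rw [inv_pow, mul_pow, Real.sq_sqrt hc.le, ← Real.rpow_natCast, ← Real.rpow_mul hH.le]
    congr 3
    push_cast
    ring
  calc C * H h (fluxInv A r) ^ β * deriv (fluxInv A) r
      = C * H h (fluxInv A r) ^ β * (√(deriv (fluxInv A) r) * √(deriv (fluxInv A) r)) := by
        rw [Real.mul_self_sqrt hU.le]
    _ ≤ C * H h (fluxInv A r) ^ β *
        ((√c * H h (fluxInv A r) ^ (q / 2))⁻¹ * √(deriv (fluxInv A) r)) := by gcongr
    _ = _ := by
        rw [Real.rpow_sub hH]
        field_simp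

lemma power_zero (A : FluxGrowth h a p q c) (B : PowerGrowth h γ β C) : A.power γ 0 = 0 := by
  have := B.γ_pos
  rw [power, A.fluxInv_zero, IsAdmissible.H_zero, Real.zero_rpow (by positivity)]

lemma continuousOn_power (A : FluxGrowth h a p q c) (B : PowerGrowth h γ β C) :
    ContinuousOn (A.power γ) (Ici 0) := by
  have := B.γ_pos
  refine ContinuousOn.rpow_const ?_ fun _ _ ↦ Or.inr (by positivity)
  exact A.adm.continuousOn_H.comp A.continuous_fluxInv.continuousOn fun r hr ↦ A.fluxInv_nonneg hr

/-- The truncation of `power` to `[ε, M]`, and a right derivative of it. -/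
lemma exists_truncated_power (A : FluxGrowth h a p q c) (B : PowerGrowth h γ β C) {ε M : ℝ}
    (hε : 0 < ε) (hεM : ε ≤ M) :
    ∃ (K : ℝ≥0) (D : ℝ → ℝ),
      LipschitzWith K (fun r ↦ A.power γ (max ε (min r M)) - A.power γ ε) ∧
      (∀ r, HasDerivWithinAt (fun r ↦ A.power γ (max ε (min r M)) - A.power γ ε) (D r) (Ioi r) r) ∧
      (∀ r ≤ 0, D r = 0) ∧ ∀ r, |D r| ≤ |deriv (A.power γ) r| := by
  obtain ⟨K₁, hK₁, hKle⟩ := A.exists_deriv_fluxInv_le hε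
  have hC := B.C_pos
  have hM : 0 < M := hε.trans_le hεM
  have hUM := A.adm.H_pos (A.fluxInv_pos hM)
  have hlip : LipschitzOnWith (Real.toNNReal (C * H h (fluxInv A M) ^ β * K₁)) (A.power γ)
      (Icc ε M) := by
    refine (convex_Icc ε M).lipschitzOnWith_of_nnnorm_deriv_le (fun r hr ↦ ?_) fun r hr ↦ ?_
    · obtain ⟨d, hd, -⟩ := A.exists_hasDerivAt_power B (hε.trans_le hr.1)
      exact hd.differentiableAt
    · obtain ⟨d, hd, hd0, hdle⟩ := A.exists_hasDerivAt_power B (hε.trans_le hr.1)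
      rw [hd.deriv, ← NNReal.coe_le_coe, coe_nnnorm, Real.norm_eq_abs, abs_of_nonneg hd0]
      refine le_trans ?_ (Real.le_coe_toNNReal _)
      refine hdle.trans (mul_le_mul ?_ (hKle r hr.1) (A.deriv_fluxInv_pos (hε.trans_le hr.1)).le
        (by positivity))
      refine mul_le_mul_of_nonneg_left (Real.rpow_le_rpow ?_ ?_ B.β_pos.le) hC.le
      · exact A.adm.H_nonneg (A.fluxInv_nonneg (hε.le.trans hr.1))
      · exact A.H_fluxInv_mono (hε.le.trans hr.1) hr.2
  have hcl : ∀ r, max ε (min r M) ∈ Icc ε M := fun r ↦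
    ⟨le_max_left _ _, max_le hεM (min_le_right _ _)⟩
  have hclip : LipschitzWith 1 fun r : ℝ ↦ max ε (min r M) :=
    (LipschitzWith.id.min_const M).const_max ε
  -- The intervals are half-open because this is the right derivative: at `ε` it is the inner
  -- derivative, at `M` it is already zero.
  refine ⟨_, fun r ↦ if r < ε then 0 else if r < M then deriv (A.power γ) r else 0,
    LipschitzWith.of_dist_le_mul (K := Real.toNNReal (C * H h (fluxInv A M) ^ β * K₁))
      fun r s ↦ ?_, fun r ↦ ?_, fun r hr ↦ ?_, fun r ↦ ?_⟩
  · rw [dist_sub_right]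
    refine (hlip.dist_le_mul _ (hcl r) _ (hcl s)).trans ?_
    refine mul_le_mul_of_nonneg_left ?_ (NNReal.coe_nonneg _)
    simpa using hclip.dist_le_mul r s
  · simp only
    split_ifs with h1 h2
    · refine (HasDerivAt.congr_of_eventuallyEq (hasDerivAt_const r (0 : ℝ)) ?_).hasDerivWithinAt
      filter_upwards [gt_mem_nhds h1] with s hs
      rw [max_eq_left ((min_le_left _ _).trans (le_of_lt hs)), sub_self]
    · push Not at h1
      obtain ⟨d, hd, -⟩ := A.exists_hasDerivAt_power B (hε.trans_le h1)
      have hd' : HasDerivAt (fun s ↦ A.power γ s - A.power γ ε) (deriv (A.power γ) r) r :=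
        hd.differentiableAt.hasDerivAt.sub_const _
      refine hd'.hasDerivWithinAt.congr_of_eventuallyEq ?_ ?_
      · filter_upwards [self_mem_nhdsWithin, mem_nhdsWithin_of_mem_nhds (gt_mem_nhds h2)]
          with s hs hs'
        rw [min_eq_left (le_of_lt hs'), max_eq_right (h1.trans (le_of_lt hs))]
      · rw [min_eq_left h2.le, max_eq_right h1]
    · push Not at h2
      refine (hasDerivWithinAt_const r (Ioi r) (A.power γ M - A.power γ ε)).congr ?_ ?_
      · intro s hs
        rw [min_eq_right (h2.trans (le_of_lt hs)), max_eq_right hεM]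
      · rw [min_eq_right h2, max_eq_right hεM]
  · simp [hr.trans_lt hε]
  · simp only
    split_ifs <;> simp

/-- Sobolev's inequality for `H(u) ^ (γ + 1)`. -/
lemma eLpNorm_power_le [IsFiniteMeasure (volume.restrict (Ω : Set (Euc N)))]
    (hΩ : Bornology.IsBounded (Ω : Set (Euc N)))
    (A : FluxGrowth h a p q c) (B : PowerGrowth h γ β C) {δ₁ δ₂ : ℝ≥0} (hδ₂ : 1 ≤ δ₂)
    (hδ₂' : δ₂ ≤ 2) (hδ₂N : δ₂ < (N : ℝ≥0)) (hδ : (δ₂ : ℝ)⁻¹ - (N : ℝ)⁻¹ ≤ (δ₁ : ℝ)⁻¹)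
    {u : Euc N → ℝ} {g : Euc N → Euc N} {η : ℕ → 𝓓(Ω, ℝ)} {G : Euc N → ℝ}
    (hf : DominatedApprox Ω (fun x ↦ flux h a p (u x)) g η G)
    (hu0 : ∀ᵐ x ∂(volume.restrict (Ω : Set (Euc N))), 0 ≤ u x) :
    eLpNorm (fun x ↦ H h (u x) ^ (γ + 1)) δ₁ (volume.restrict Ω) ≤
      eLpNormLESNormFDerivOfLeConst ℝ (volume : Measure (Euc N)) Ω δ₂ δ₁ *
        eLpNorm (fun x ↦ C / √c * (H h (u x) ^ (β - q / 2) * A.energyRoot u g x)) δ₂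
          (volume.restrict Ω) := by
  set f : Euc N → ℝ := fun x ↦ flux h a p (u x) with hfdef
  have hεM : ∀ j : ℕ, 1 / ((j : ℝ) + 1) ≤ j + 2 := by
    intro j
    rw [div_le_iff₀ (by positivity)]
    have : (0 : ℝ) ≤ j := j.cast_nonneg
    nlinarith
  have hε : ∀ j : ℕ, 0 < 1 / ((j : ℝ) + 1) := fun j ↦ by positivity
  -- The power need not be Lipschitz in the flux near `0` or infinity. Truncation makes it so
  -- without enlarging its derivative, hence with a right-hand side independent of `j`.
  choose K D hlip hder hD0 hDle using fun j : ℕ ↦ A.exists_truncated_power B (hε j) (hεM j)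
  have hj : ∀ j : ℕ, eLpNorm (fun x ↦ A.power γ (max (1 / ((j : ℝ) + 1)) (min (f x) (j + 2))) -
      A.power γ (1 / ((j : ℝ) + 1))) δ₁ (volume.restrict Ω) ≤
      eLpNormLESNormFDerivOfLeConst ℝ (volume : Measure (Euc N)) Ω δ₂ δ₁ *
        eLpNorm (fun x ↦ C / √c * (H h (u x) ^ (β - q / 2) * A.energyRoot u g x)) δ₂
          (volume.restrict Ω) := by
    intro j
    refine (hf.eLpNorm_comp_le hΩ (hε j) (hlip j) (fun r hr ↦ ?_) (hder j) hδ₂ hδ₂' hδ₂N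
      hδ).trans ?_
    · rw [max_eq_left ((min_le_left _ _).trans hr), sub_self]
    · gcongr
      refine eLpNorm_mono_ae ?_
      filter_upwards [hu0] with x hx
      rw [norm_smul, Real.norm_eq_abs]
      rcases le_or_gt (flux h a p (u x)) 0 with hr | hr
      · rw [hD0 j _ hr, abs_zero, zero_mul]
        exact norm_nonneg _
      · have h1 := (hDle j _).trans (A.deriv_power_le B hr)
        rw [A.fluxInv_flux hx] at h1
        refine (mul_le_mul_of_nonneg_right h1 (norm_nonneg _)).trans ?_
        refine le_trans (le_of_eq ?_) (le_abs_self _)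
        rw [energyRoot, if_pos hr]
        ring
  have hfm := hf.aestronglyMeasurable
  have hcont : ∀ j : ℕ, AEStronglyMeasurable (fun x ↦
      A.power γ (max (1 / ((j : ℝ) + 1)) (min (f x) (j + 2))) - A.power γ (1 / ((j : ℝ) + 1)))
      (volume.restrict Ω) := fun j ↦ (hlip j).continuous.comp_aestronglyMeasurable hfm
  have hlim : ∀ᵐ x ∂(volume.restrict (Ω : Set (Euc N))), Tendsto (fun j : ℕ ↦
      A.power γ (max (1 / ((j : ℝ) + 1)) (min (f x) (j + 2))) - A.power γ (1 / ((j : ℝ) + 1)))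
      atTop (𝓝 (H h (u x) ^ (γ + 1))) := by
    filter_upwards [hu0] with x hx
    have hf0 : 0 ≤ f x := A.flux_nonneg hx
    have hpow : A.power γ (f x) = H h (u x) ^ (γ + 1) := by
      rw [power, A.fluxInv_flux hx]
    have h0 : Tendsto (fun j : ℕ ↦ A.power γ (1 / ((j : ℝ) + 1))) atTop (𝓝 0) := by
      have h1 := A.continuousOn_power B 0 self_mem_Ici
      rw [ContinuousWithinAt, A.power_zero B] at h1
      refine h1.comp (tendsto_nhdsWithin_iff.2 ⟨tendsto_one_div_add_atTop_nhds_zero_nat, ?_⟩)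
      exact Eventually.of_forall fun j ↦ (hε j).le
    have h2 : Tendsto (fun j : ℕ ↦ A.power γ (max (1 / ((j : ℝ) + 1)) (min (f x) (j + 2))))
        atTop (𝓝 (A.power γ (f x))) := by
      rcases hf0.eq_or_lt with hz | hpos
      · rw [← hz, A.power_zero B]
        refine h0.congr fun j ↦ ?_
        rw [max_eq_left ((min_le_left _ _).trans (hε j).le)]
      · refine tendsto_const_nhds.congr' ?_
        have e1 := (tendsto_one_div_add_atTop_nhds_zero_nat (𝕜 := ℝ)).eventually
          (gt_mem_nhds hpos)
        filter_upwards [e1, eventually_ge_atTop ⌈f x⌉₊] with j hj1 hj2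
        have hj2 := Nat.ceil_le.1 hj2
        rw [min_eq_left (by linarith), max_eq_right (le_of_lt hj1)]
    have := h2.sub h0
    rwa [sub_zero, hpow] at this
  calc _ ≤ liminf (fun j : ℕ ↦ eLpNorm (fun x ↦ A.power γ (max (1 / ((j : ℝ) + 1))
        (min (f x) (j + 2))) - A.power γ (1 / ((j : ℝ) + 1))) δ₁ (volume.restrict Ω)) atTop :=
        Lp.eLpNorm_lim_le_liminf_eLpNorm hcont _ hlim
    _ ≤ _ := by
        refine (liminf_le_liminf (Eventually.of_forall hj)).trans ?_
        simp

lemma eLpNorm_rpow_eq {α : Type*} [MeasurableSpace α] {μ : Measure α} {f : α → ℝ}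
    (hf : ∀ᵐ x ∂μ, 0 ≤ f x) {b : ℝ} {s : ℝ≥0} (hs : s ≠ 0) :
    eLpNorm (fun x ↦ f x ^ b) s μ = (∫⁻ x, ENNReal.ofReal (f x ^ (b * s)) ∂μ) ^ (1 / (s : ℝ)) := by
  rw [eLpNorm_eq_lintegral_rpow_enorm_toReal (by simpa using hs) ENNReal.coe_ne_top,
    ENNReal.coe_toReal]
  congr 1
  refine lintegral_congr_ae ?_
  filter_upwards [hf] with x hx
  rw [Real.enorm_eq_ofReal (Real.rpow_nonneg hx _),
    ENNReal.ofReal_rpow_of_nonneg (Real.rpow_nonneg hx _) s.coe_nonneg, ← Real.rpow_mul hx]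

/-- The interpolation inequality between `∫ H(u) ^ (p + 1)`, `∫ H(u) ^ p₀` and the energy. -/
lemma exists_interpolation [IsFiniteMeasure (volume.restrict (Ω : Set (Euc N)))]
    (hΩ : Bornology.IsBounded (Ω : Set (Euc N)))
    (A : FluxGrowth h a p q c) (B : PowerGrowth h γ β C) {δ₁ δ₂ p₀ : ℝ}
    (hδ₁ : δ₁ = (p + 1) / (γ + 1)) (hδ₂ : 1 ≤ δ₂) (hδ₂' : δ₂ < 2) (hδ₂N : δ₂ < (N : ℝ))
    (hδ : δ₂⁻¹ - (N : ℝ)⁻¹ ≤ δ₁⁻¹) (hp₀ : p₀ = (β - q / 2) * (2 * δ₂ / (2 - δ₂))) :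
    ∃ k : ℝ≥0, ∀ (u : Euc N → ℝ) (g : Euc N → Euc N) (η : ℕ → 𝓓(Ω, ℝ)) (G : Euc N → ℝ),
      DominatedApprox Ω (fun x ↦ flux h a p (u x)) g η G →
      (∀ᵐ x ∂(volume.restrict (Ω : Set (Euc N))), 0 ≤ u x) →
      (∫⁻ x in Ω, ENNReal.ofReal (H h (u x) ^ (p + 1))) ^ (2 / δ₁) ≤
        k * ((∫⁻ x in Ω, ENNReal.ofReal (H h (u x) ^ p₀)) ^ ((2 - δ₂) / δ₂) *
          ∫⁻ x in Ω, ENNReal.ofReal (A.energyRoot u g x ^ 2)) := by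
  have hγ := B.γ_pos
  have hp := A.p_pos
  have hC := B.C_pos
  have hc := A.c_pos
  have hδ₁0 : 0 < δ₁ := by rw [hδ₁]; positivity
  have hδ₂0 : 0 < δ₂ := by linarith
  have h2δ : 0 < 2 - δ₂ := by linarith
  set d₁ : ℝ≥0 := ⟨δ₁, hδ₁0.le⟩ with hd₁
  set d₂ : ℝ≥0 := ⟨δ₂, hδ₂0.le⟩ with hd₂
  set r : ℝ := 2 * δ₂ / (2 - δ₂) with hr
  have hr0 : 0 < r := by positivity
  set d₃ : ℝ≥0 := ⟨r, hr0.le⟩ with hd₃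
  have hd₁0 : d₁ ≠ 0 := fun h0 ↦ hδ₁0.ne' (congrArg NNReal.toReal h0)
  have hd₂0 : d₂ ≠ 0 := fun h0 ↦ hδ₂0.ne' (congrArg NNReal.toReal h0)
  have hd₃0 : d₃ ≠ 0 := fun h0 ↦ hr0.ne' (congrArg NNReal.toReal h0)
  set S := eLpNormLESNormFDerivOfLeConst ℝ (volume : Measure (Euc N)) Ω d₂ d₁ with hS
  set M : ℝ≥0 := Real.toNNReal (C / √c) with hM
  -- Here `S` is the Sobolev constant and `M` comes from the pointwise gradient bound. The square
  -- appears because the norm inequality is squared to produce the energy.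
  refine ⟨(S * M) ^ 2, fun u g η G hf hu0 ↦ ?_⟩
  have hH0 : ∀ᵐ x ∂(volume.restrict (Ω : Set (Euc N))), 0 ≤ H h (u x) := by
    filter_upwards [hu0] with x hx using A.adm.H_nonneg hx
  have hum := (A.memLp_two_of_dominatedApprox hf hu0).1
  have hHm : AEMeasurable (fun x ↦ H h (u x)) (volume.restrict Ω) := by
    refine ((A.adm.continuous_H_max.measurable.comp_aemeasurable hum.aemeasurable)).congr ?_
    filter_upwards [hu0] with x hx
    simp [hx]
  have hsob := A.eLpNorm_power_le hΩ B (δ₁ := d₁) (δ₂ := d₂) (by exact_mod_cast hδ₂)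
    (by exact_mod_cast hδ₂'.le) (by exact_mod_cast hδ₂N) hδ hf hu0
  -- The exponent `r` solves `1 / r + 1 / 2 = 1 / δ₂`, and `p₀` is `r * (β - q / 2)`, so the first
  -- Hölder factor is a power of the integral of `H ^ p₀`.
  have : ENNReal.HolderTriple (d₃ : ℝ≥0∞) 2 d₂ := by
    refine ⟨?_⟩
    have h2 : (2 : ℝ≥0∞) = ((2 : ℝ≥0) : ℝ≥0∞) := by norm_num
    rw [h2, ← ENNReal.coe_inv hd₃0, ← ENNReal.coe_inv two_ne_zero, ← ENNReal.coe_inv hd₂0,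
      ← ENNReal.coe_add, ENNReal.coe_inj, ← NNReal.coe_inj]
    push_cast
    change r⁻¹ + 2⁻¹ = δ₂⁻¹
    rw [hr]
    field_simp
    ring
  have hhol := eLpNorm_smul_le_mul_eLpNorm (p := d₃) (q := 2) (r := d₂)
    (A.aestronglyMeasurable_energyRoot hf) (hHm.pow_const (β - q / 2)).aestronglyMeasurable
  have e1 : eLpNorm (fun x ↦ C / √c * (H h (u x) ^ (β - q / 2) * A.energyRoot u g x)) d₂
      (volume.restrict Ω) =
      M * eLpNorm ((fun x ↦ H h (u x) ^ (β - q / 2)) • A.energyRoot u g) d₂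
        (volume.restrict Ω) := by
    have := eLpNorm_const_smul (C / √c) ((fun x ↦ H h (u x) ^ (β - q / 2)) • A.energyRoot u g)
      (d₂ : ℝ≥0∞) (volume.restrict Ω)
    rw [Real.enorm_eq_ofReal (by positivity)] at this
    exact this
  rw [e1] at hsob
  rw [eLpNorm_rpow_eq hH0 hd₁0] at hsob
  rw [eLpNorm_rpow_eq hH0 hd₃0] at hhol
  have e2 : (γ + 1) * (d₁ : ℝ) = p + 1 := by
    change (γ + 1) * δ₁ = p + 1
    rw [hδ₁]
    field_simp
  have e3 : (β - q / 2) * (d₃ : ℝ) = p₀ := hp₀.symm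
  rw [e2] at hsob
  rw [e3] at hhol
  have e4 : eLpNorm (A.energyRoot u g) 2 (volume.restrict Ω) ^ 2 =
      ∫⁻ x in Ω, ENNReal.ofReal (A.energyRoot u g x ^ 2) := by
    have := eLpNorm_nnreal_pow_eq_lintegral (f := A.energyRoot u g) (μ := volume.restrict Ω)
      (p := 2) (by norm_num)
    norm_num at this
    rw [this]
    congr 1 with x
    rw [← enorm_pow, Real.enorm_eq_ofReal (sq_nonneg _)]
  have hfin := hsob.trans (mul_le_mul_right (mul_le_mul_right hhol _) _)
  have hsq := pow_le_pow_left' hfin 2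
  rw [← ENNReal.rpow_natCast, ← ENNReal.rpow_mul] at hsq
  have e5 : 1 / (d₁ : ℝ) * ((2 : ℕ) : ℝ) = 2 / δ₁ := by
    change 1 / δ₁ * ((2 : ℕ) : ℝ) = 2 / δ₁
    push_cast
    ring
  rw [e5] at hsq
  refine hsq.trans (le_of_eq ?_)
  rw [mul_pow, mul_pow, mul_pow, e4, ← ENNReal.rpow_natCast (_ ^ (1 / (d₃ : ℝ))),
    ← ENNReal.rpow_mul]
  have e6 : 1 / (d₃ : ℝ) * ((2 : ℕ) : ℝ) = (2 - δ₂) / δ₂ := by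
    change 1 / r * ((2 : ℕ) : ℝ) = (2 - δ₂) / δ₂
    rw [hr]
    push_cast
    field_simp
  rw [e6]
  push_cast
  ring

end FluxGrowth

/-- The exponent `delta₂` satisfies the conditions of Sobolev's inequality. -/
lemma delta₂_spec (hN : 2 ≤ N) {δ₁ : ℝ} (h1 : 1 ≤ δ₁) (h2 : δ₁ < 2) :
    1 ≤ delta₂ N δ₁ ∧ delta₂ N δ₁ < 2 ∧ delta₂ N δ₁ < N ∧
      (delta₂ N δ₁)⁻¹ - (N : ℝ)⁻¹ ≤ δ₁⁻¹ := by
  have hN' : (2 : ℝ) ≤ N := by exact_mod_cast hN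
  have hN1 : (0 : ℝ) < N - 1 := by linarith
  have hN0 : (0 : ℝ) < N := by linarith
  have hδ0 : 0 < δ₁ := by linarith
  unfold delta₂
  split_ifs with hle
  · refine ⟨le_rfl, one_lt_two, by linarith, ?_⟩
    -- With `δ₂ = 1` the Sobolev condition reads `1 - 1 / N ≤ 1 / δ₁`, and `1 - 1 / N` is the
    -- inverse of `N / (N - 1)`.
    have h3 := inv_anti₀ hδ0 hle
    refine le_trans (le_of_eq ?_) h3
    field_simp
  · push Not at hle
    rw [div_lt_iff₀ hN1] at hle
    -- In this range `δ₁` is exactly the Sobolev conjugate of `δ₂`, that is `1 / δ₂ = 1 / δ₁ + 1 /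
    -- N`.
    have hpos : 0 < (N : ℝ) + δ₁ := by linarith
    refine ⟨?_, ?_, ?_, le_of_eq ?_⟩
    · rw [le_div_iff₀ hpos]; linarith
    · rw [div_lt_iff₀ hpos]; nlinarith
    · rw [div_lt_iff₀ hpos]; nlinarith
    · field_simp
      ring

end Einstein

end

/-! ### Truncated multipliers and the chain rule in time -/

section

namespace Einstein

variable {h a : ℝ → ℝ} {p q c : ℝ}

/-- The weight `ramp j (flux s) / F s`, an approximation from below of `H s ^ p`. -/
def weight (h a : ℝ → ℝ) (p : ℝ) (j : ℕ) (s : ℝ) : ℝ := ramp j (flux h a p s) / F h a s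

/-- The primitive of `weight j * h`, an approximation from below of `H s ^ (p + 1) / (p + 1)`. -/
def weightPrim (h a : ℝ → ℝ) (p : ℝ) (j : ℕ) (s : ℝ) : ℝ :=
  ∫ r in (0 : ℝ)..s, weight h a p j r * h r

namespace FluxGrowth

/-- The point below which `weight j` vanishes. -/
def threshold (A : FluxGrowth h a p q c) (j : ℕ) : ℝ := fluxInv A (1 / (j + 1))

lemma threshold_pos (A : FluxGrowth h a p q c) (j : ℕ) : 0 < A.threshold j :=
  A.fluxInv_pos (by positivity)

lemma ramp_flux_of_le (A : FluxGrowth h a p q c) {j : ℕ} {s : ℝ} (hs : 0 ≤ s)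
    (hsj : s ≤ A.threshold j) : ramp j (flux h a p s) = 0 := by
  refine ramp_of_le j ?_
  have h1 : (0 : ℝ) ≤ 1 / (j + 1) := by positivity
  rw [← A.flux_fluxInv h1]
  exact A.strictMonoOn_flux.monotoneOn hs (A.threshold_pos j).le hsj

lemma weight_of_le (A : FluxGrowth h a p q c) {j : ℕ} {s : ℝ} (hs : 0 ≤ s)
    (hsj : s ≤ A.threshold j) : weight h a p j s = 0 := by
  rw [weight, A.ramp_flux_of_le hs hsj, zero_div]

lemma F_nonneg (A : FluxGrowth h a p q c) {s : ℝ} (hs : 0 ≤ s) : 0 ≤ F h a s := by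
  simpa [A.adm.F_zero] using A.adm.F_mono self_mem_Ici hs hs

lemma weight_nonneg (A : FluxGrowth h a p q c) (j : ℕ) {s : ℝ} (hs : 0 ≤ s) :
    0 ≤ weight h a p j s :=
  div_nonneg (ramp_nonneg _ _) (A.F_nonneg hs)

lemma weight_mul_F (A : FluxGrowth h a p q c) (j : ℕ) {s : ℝ} (hs : 0 ≤ s) :
    weight h a p j s * F h a s = ramp j (flux h a p s) := by
  rcases hs.eq_or_lt with rfl | hs
  · rw [A.adm.F_zero, mul_zero, A.ramp_flux_of_le le_rfl (A.threshold_pos j).le]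
  · exact div_mul_cancel₀ _ (A.adm.F_pos hs).ne'

/-- The numerator never exceeds `j + 2`, and beyond the threshold the monotone denominator is at
least its positive value there. Boundedness of the weight is what allows multiplying the inequality
by it. -/
lemma exists_weight_le (A : FluxGrowth h a p q c) (j : ℕ) :
    ∃ K : ℝ≥0, ∀ s ≥ 0, weight h a p j s ≤ K := by
  have hF := A.adm.F_pos (A.threshold_pos j)
  refine ⟨Real.toNNReal ((j + 2) / F h a (A.threshold j)), fun s hs ↦ ?_⟩
  refine le_trans ?_ (Real.le_coe_toNNReal _)
  rcases le_total s (A.threshold j) with h1 | h1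
  · rw [A.weight_of_le hs h1]
    positivity
  · exact div_le_div₀ (by positivity) (ramp_le _ _) hF (A.adm.F_mono (A.threshold_pos j).le hs h1)

lemma weight_mono (A : FluxGrowth h a p q c) {s : ℝ} (hs : 0 ≤ s) :
    Monotone fun j ↦ weight h a p j s := fun _ _ hij ↦
  div_le_div_of_nonneg_right (ramp_mono_left (A.flux_nonneg hs) hij) (A.F_nonneg hs)

lemma weight_le (A : FluxGrowth h a p q c) (j : ℕ) {s : ℝ} (hs : 0 ≤ s) :
    weight h a p j s ≤ H h s ^ p := by
  rcases hs.eq_or_lt with rfl | hs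
  · rw [A.weight_of_le le_rfl (A.threshold_pos j).le]
    exact Real.rpow_nonneg (A.adm.H_nonneg le_rfl) _
  · exact (div_le_iff₀ (A.adm.F_pos hs)).2 (ramp_le_self j (A.flux_nonneg hs.le))

lemma tendsto_weight (A : FluxGrowth h a p q c) {s : ℝ} (hs : 0 < s) :
    Tendsto (fun j ↦ weight h a p j s) atTop (𝓝 (H h s ^ p)) := by
  have := (tendsto_ramp (A.flux_nonneg hs.le)).div_const (F h a s)
  rwa [flux, mul_div_cancel_right₀ _ (A.adm.F_pos hs).ne'] at this

lemma continuousOn_weight (A : FluxGrowth h a p q c) (j : ℕ) :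
    ContinuousOn (weight h a p j) (Ici 0) := by
  intro s hs
  rcases (mem_Ici.1 hs).eq_or_lt with rfl | hs'
  · have hev : weight h a p j =ᶠ[𝓝[Ici 0] 0] fun _ ↦ (0 : ℝ) := by
      filter_upwards [self_mem_nhdsWithin,
        mem_nhdsWithin_of_mem_nhds (gt_mem_nhds (A.threshold_pos j))] with r hr hr'
      exact A.weight_of_le hr (le_of_lt hr')
    exact continuousWithinAt_const.congr_of_eventuallyEq hev
      (A.weight_of_le le_rfl (A.threshold_pos j).le)
  · exact ((contDiff_ramp j).continuous.continuousAt.comp_continuousWithinAt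
      (A.continuousOn_flux s hs)).div (A.adm.continuousOn_F s hs) (A.adm.F_pos hs').ne'

lemma continuous_weight_max (A : FluxGrowth h a p q c) (j : ℕ) :
    Continuous fun s ↦ weight h a p j (max s 0) :=
  (A.continuousOn_weight j).comp_continuous (continuous_id.max continuous_const)
    fun x ↦ mem_Ici.2 (le_max_right x 0)

lemma intervalIntegrable_weight (A : FluxGrowth h a p q c) (j : ℕ) {s t : ℝ} (hs : 0 ≤ s)
    (ht : 0 ≤ t) : IntervalIntegrable (fun r ↦ weight h a p j r * h r) volume s t :=
  (A.adm.intervalIntegrable hs ht).continuousOn_mul ((A.continuousOn_weight j).mono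
    fun _ hx ↦ (le_inf hs ht).trans hx.1)

lemma weightPrim_sub (A : FluxGrowth h a p q c) (j : ℕ) {s t : ℝ} (hs : 0 ≤ s) (ht : 0 ≤ t) :
    weightPrim h a p j t - weightPrim h a p j s = ∫ r in s..t, weight h a p j r * h r :=
  intervalIntegral.integral_interval_sub_left (A.intervalIntegrable_weight j le_rfl ht)
    (A.intervalIntegrable_weight j le_rfl hs)

/-- Both sides are integrals against the same nonnegative `h`. Comparing with `H` instead of the
variable `s` matters because `h` may be unbounded near `0`. -/
lemma abs_weightPrim_sub_le (A : FluxGrowth h a p q c) {j : ℕ} {K : ℝ≥0}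
    (hK : ∀ s ≥ 0, weight h a p j s ≤ K) {s t : ℝ} (hs : 0 ≤ s) (ht : 0 ≤ t) :
    |weightPrim h a p j t - weightPrim h a p j s| ≤ K * |H h t - H h s| := by
  wlog hst : s ≤ t generalizing s t
  · rw [abs_sub_comm, abs_sub_comm (H h t)]
    exact this ht hs (not_le.1 hst).le
  have hnn : ∀ r ∈ Ioo s t, 0 ≤ h r := fun r hr ↦ (A.adm.h_pos r (hs.trans_lt hr.1)).le
  rw [A.weightPrim_sub j hs ht, A.adm.H_sub hs ht, abs_of_nonneg, abs_of_nonneg,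
    ← intervalIntegral.integral_const_mul]
  · refine intervalIntegral.integral_mono_on_of_le_Ioo hst (A.intervalIntegrable_weight j hs ht)
      ((A.adm.intervalIntegrable hs ht).const_mul _) fun r hr ↦ ?_
    exact mul_le_mul_of_nonneg_right (hK r (hs.trans hr.1.le)) (hnn r hr)
  · rw [← A.adm.H_sub hs ht, sub_nonneg]
    exact A.adm.strictMonoOn_H.monotoneOn hs ht hst
  · rw [intervalIntegral.integral_of_le hst, integral_Ioc_eq_integral_Ioo]
    exact setIntegral_nonneg measurableSet_Ioo fun r hr ↦
      mul_nonneg (A.weight_nonneg j (hs.trans hr.1.le)) (hnn r hr)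

lemma hasDerivAt_weightPrim (A : FluxGrowth h a p q c) (j : ℕ) {s : ℝ} (hs : 0 < s) :
    HasDerivAt (weightPrim h a p j) (weight h a p j s * h s) s := by
  have hcont : ContinuousOn (fun r ↦ weight h a p j r * h r) (Ioi 0) :=
    ((A.continuousOn_weight j).mono Ioi_subset_Ici_self).mul A.adm.h_cont
  exact intervalIntegral.integral_hasDerivAt_right (A.intervalIntegrable_weight j le_rfl hs.le)
    (hcont.stronglyMeasurableAtFilter isOpen_Ioi s hs) (hcont.continuousAt (Ioi_mem_nhds hs))

lemma weightPrim_of_le (A : FluxGrowth h a p q c) {j : ℕ} {s : ℝ} (hs : 0 ≤ s)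
    (hsj : s ≤ A.threshold j) : weightPrim h a p j s = 0 := by
  rw [weightPrim, intervalIntegral.integral_congr (g := fun _ ↦ (0 : ℝ)),
    intervalIntegral.integral_zero]
  intro r hr
  rw [uIcc_of_le hs] at hr
  simp only
  rw [A.weight_of_le hr.1 (hr.2.trans hsj), zero_mul]

lemma integral_rpow_mul (A : FluxGrowth h a p q c) {s : ℝ} (hs : 0 ≤ s) :
    IntervalIntegrable (fun r ↦ H h r ^ p * h r) volume 0 s ∧
      ∫ r in (0 : ℝ)..s, H h r ^ p * h r = H h s ^ (p + 1) / (p + 1) := by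
  have hp := A.p_pos
  have hcont : ∀ b : ℝ, 0 ≤ b → ContinuousOn (fun r ↦ H h r ^ b) (Icc 0 s) := fun b hb ↦
    (A.adm.continuousOn_H.mono Icc_subset_Ici_self).rpow_const fun _ _ ↦ Or.inr hb
  have hint : IntervalIntegrable (fun r ↦ H h r ^ p * h r) volume 0 s := by
    refine (A.adm.intervalIntegrable le_rfl hs).continuousOn_mul ?_
    rw [uIcc_of_le hs]
    exact hcont p hp.le
  refine ⟨hint, ?_⟩
  rw [intervalIntegral.integral_eq_sub_of_hasDerivAt_of_le hs
    (f := fun r ↦ H h r ^ (p + 1) / (p + 1)) ((hcont (p + 1) (by positivity)).div_const _)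
    (fun r hr ↦ ?_) hint]
  · rw [IsAdmissible.H_zero, Real.zero_rpow (by positivity)]
    simp
  · have h1 := ((A.adm.hasDerivAt_H hr.1).rpow_const (p := p + 1)
      (Or.inl (A.adm.H_pos hr.1).ne')).div_const (p + 1)
    have e : h r * (p + 1) * H h r ^ (p + 1 - 1) / (p + 1) = H h r ^ p * h r := by
      rw [add_sub_cancel_right]
      field_simp
    rwa [e] at h1

lemma weightPrim_nonneg (A : FluxGrowth h a p q c) (j : ℕ) {s : ℝ} (hs : 0 ≤ s) :
    0 ≤ weightPrim h a p j s := by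
  rw [weightPrim, intervalIntegral.integral_of_le hs]
  exact setIntegral_nonneg measurableSet_Ioc fun r hr ↦
    mul_nonneg (A.weight_nonneg j hr.1.le) (A.adm.h_pos r hr.1).le

lemma weightPrim_mono (A : FluxGrowth h a p q c) {s : ℝ} (hs : 0 ≤ s) :
    Monotone fun j ↦ weightPrim h a p j s := fun i j hij ↦
  intervalIntegral.integral_mono_on_of_le_Ioo hs (A.intervalIntegrable_weight i le_rfl hs)
    (A.intervalIntegrable_weight j le_rfl hs) fun r hr ↦
      mul_le_mul_of_nonneg_right (A.weight_mono hr.1.le hij) (A.adm.h_pos r hr.1).le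

lemma weightPrim_le (A : FluxGrowth h a p q c) (j : ℕ) {s : ℝ} (hs : 0 ≤ s) :
    weightPrim h a p j s ≤ H h s ^ (p + 1) / (p + 1) := by
  rw [← (A.integral_rpow_mul hs).2]
  exact intervalIntegral.integral_mono_on_of_le_Ioo hs (A.intervalIntegrable_weight j le_rfl hs)
    (A.integral_rpow_mul hs).1 fun r hr ↦
      mul_le_mul_of_nonneg_right (A.weight_le j hr.1.le) (A.adm.h_pos r hr.1).le

lemma tendsto_weightPrim (A : FluxGrowth h a p q c) {s : ℝ} (hs : 0 ≤ s) :
    Tendsto (fun j ↦ weightPrim h a p j s) atTop (𝓝 (H h s ^ (p + 1) / (p + 1))) := by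
  rw [← (A.integral_rpow_mul hs).2]
  refine intervalIntegral.tendsto_integral_filter_of_dominated_convergence
    (fun r ↦ H h r ^ p * h r) (Eventually.of_forall fun j ↦ ?_)
    (Eventually.of_forall fun j ↦ Eventually.of_forall fun r hr ↦ ?_) (A.integral_rpow_mul hs).1
    (Eventually.of_forall fun r hr ↦ ?_)
  · have := (A.intervalIntegrable_weight j le_rfl hs).aestronglyMeasurable
    rwa [uIoc_of_le hs]
  · rw [uIoc_of_le hs] at hr
    have := A.adm.h_pos r hr.1
    rw [Real.norm_eq_abs, abs_of_nonneg (mul_nonneg (A.weight_nonneg j hr.1.le) this.le)]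
    exact mul_le_mul_of_nonneg_right (A.weight_le j hr.1.le) this.le
  · rw [uIoc_of_le hs] at hr
    exact (A.tendsto_weight hr.1).mul_const _

/-- `weightPrim j` is a Lipschitz function of `H`. -/
lemma exists_lipschitz_weightPrim (A : FluxGrowth h a p q c) (j : ℕ) :
    ∃ (K : ℝ≥0) (Γ : ℝ → ℝ), LipschitzWith K Γ ∧
      ∀ s ≥ 0, Γ (H h s) = weightPrim h a p j s ∧ HasDerivAt Γ (weight h a p j s) (H h s) := by
  obtain ⟨K, hK⟩ := A.exists_weight_le j
  have hinv : ∀ s ≥ 0, Function.invFunOn (H h) (Ici 0) (H h s) = s := fun s hs ↦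
    A.adm.strictMonoOn_H.injOn.leftInvOn_invFunOn hs
  have hlip : LipschitzOnWith K (fun y ↦ weightPrim h a p j (Function.invFunOn (H h) (Ici 0) y))
      (H h '' Ici 0) := by
    refine LipschitzOnWith.of_dist_le_mul ?_
    rintro _ ⟨s, hs, rfl⟩ _ ⟨t, ht, rfl⟩
    rw [hinv s hs, hinv t ht]
    exact A.abs_weightPrim_sub_le hK ht hs
  -- `H` is not assumed to be onto `[0, ∞)`, so the function is first defined on the range of `H`
  -- and then extended with the same Lipschitz constant.
  obtain ⟨Γ₀, hΓ₀, hEq⟩ := hlip.extend_real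
  have hmax : LipschitzWith 1 fun y : ℝ ↦ max y 0 := LipschitzWith.id.max_const 0
  have hval : ∀ s ≥ 0, Γ₀ (max (H h s) 0) = weightPrim h a p j s := fun s hs ↦ by
    rw [max_eq_left (A.adm.H_nonneg hs), ← hEq ⟨s, hs, rfl⟩]
    simp only
    rw [hinv s hs]
  refine ⟨K * 1, fun y ↦ Γ₀ (max y 0), hΓ₀.comp hmax, fun s hs ↦ ⟨hval s hs, ?_⟩⟩
  rcases hs.eq_or_lt with rfl | hs'
  · rw [A.weight_of_le le_rfl (A.threshold_pos j).le]
    refine (hasDerivAt_const _ (0 : ℝ)).congr_of_eventuallyEq ?_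
    have hpos := A.adm.H_pos (A.threshold_pos j)
    rw [IsAdmissible.H_zero]
    filter_upwards [gt_mem_nhds hpos] with y hy
    -- After clamping, every `y` near `0` is a value of `H` below the threshold, where the primitive
    -- vanishes. Thus `Γ` is zero on both sides of `0` and has the two-sided derivative `0` there.
    have hmem : max y 0 ∈ Icc (H h 0) (H h (A.threshold j)) := by
      rw [IsAdmissible.H_zero]
      exact ⟨le_max_right _ _, max_le (le_of_lt hy) hpos.le⟩
    obtain ⟨r, hr, hry⟩ := intermediate_value_Icc (A.threshold_pos j).le
      (A.adm.continuousOn_H.mono Icc_subset_Ici_self) hmem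
    have := hval r hr.1
    rw [max_eq_left (A.adm.H_nonneg hr.1), hry, A.weightPrim_of_le hr.1 hr.2] at this
    exact this
  · have hH := A.adm.hasStrictDerivAt_H hs'
    have hne := (A.adm.h_pos s hs').ne'
    -- Away from `0`, `Γ` is locally the primitive composed with the inverse of `H`; the derivative
    -- `1 / h` of that inverse cancels the factor `h`.
    set S := hH.localInverse (H h) (h s) s hne with hS
    have hS' : HasDerivAt S (h s)⁻¹ (H h s) := (hH.to_localInverse hne).hasDerivAt
    have hSs : S (H h s) = s := HasStrictFDerivAt.localInverse_apply_image ..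
    have h1 : HasDerivAt (fun y ↦ weightPrim h a p j (S y))
        (weight h a p j s * h s * (h s)⁻¹) (H h s) := by
      have h2 := A.hasDerivAt_weightPrim j hs'
      rw [← hSs] at h2
      have h3 := h2.comp (H h s) hS'
      rwa [hSs] at h3
    rw [mul_inv_cancel_right₀ hne] at h1
    refine h1.congr_of_eventuallyEq ?_
    have hSpos : ∀ᶠ y in 𝓝 (H h s), 0 < S y := by
      have := hS'.continuousAt.tendsto
      rw [hSs] at this
      exact this.eventually (lt_mem_nhds hs')
    filter_upwards [hH.eventually_right_inverse hne, hSpos] with y hy hy'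
    rw [← hval _ (le_of_lt hy'), hy]

end FluxGrowth

lemma _root_.LipschitzWith.comp_absolutelyContinuousOnInterval {Γ y : ℝ → ℝ} {K : ℝ≥0} {s t : ℝ}
    (hΓ : LipschitzWith K Γ) (hy : AbsolutelyContinuousOnInterval y s t) :
    AbsolutelyContinuousOnInterval (fun r ↦ Γ (y r)) s t := by
  have h := Filter.Tendsto.const_mul (K : ℝ) hy
  rw [mul_zero] at h
  refine squeeze_zero (fun E ↦ Finset.sum_nonneg fun i _ ↦ dist_nonneg) (fun E ↦ ?_) h
  rw [Finset.mul_sum]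
  exact Finset.sum_le_sum fun i _ ↦ hΓ.dist_le_mul _ _

/-- Chain rule for the composition of a Lipschitz function with an absolutely continuous one. -/
lemma integral_chain {Γ κ y w : ℝ → ℝ} {K : ℝ≥0} {s t : ℝ} (hΓ : LipschitzWith K Γ)
    (hst : s ≤ t) (hw : IntervalIntegrable w volume s t) {y₀ : ℝ}
    (hy : ∀ r ∈ Icc s t, y r = y₀ + ∫ v in s..r, w v)
    (hd : ∀ᵐ r ∂(volume.restrict (Ioc s t)), HasDerivAt Γ (κ r) (y r)) :
    Γ (y t) - Γ (y s) = ∫ r in s..t, κ r * w r := by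
  set z : ℝ → ℝ := fun r ↦ y₀ + ∫ v in s..r, w v with hz
  have hzac : AbsolutelyContinuousOnInterval z s t := by
    have h1 := hw.absolutelyContinuousOnInterval_intervalIntegral (c := s) left_mem_uIcc
    have h2 : AbsolutelyContinuousOnInterval (fun _ : ℝ ↦ y₀) s t :=
      (LipschitzWith.const y₀).lipschitzOnWith.absolutelyContinuousOnInterval
    exact h2.add h1
  rw [hy t ⟨hst, le_rfl⟩, hy s ⟨le_rfl, hst⟩]
  have := (hΓ.comp_absolutelyContinuousOnInterval hzac).integral_deriv_eq_sub
  rw [← this]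
  refine intervalIntegral.integral_congr_ae ?_
  rw [uIoc_of_le hst]
  rw [ae_restrict_iff' measurableSet_Ioc] at hd
  filter_upwards [hd, hw.ae_hasDerivAt_integral] with r hr1 hr2 hr
  have hrI : r ∈ Icc s t := Ioc_subset_Icc_self hr
  have h1 := hr1 hr
  rw [hy r hrI] at h1
  have h2 : HasDerivAt z (w r) r :=
    (hr2 (by rwa [uIcc_of_le hst]) s left_mem_uIcc).const_add y₀
  exact (h1.comp r h2).deriv

end Einstein

end

/-! ### The energy inequality in time -/

section

namespace Einstein

lemma ae_ae_swap_of_ae_prod {α β : Type*} [MeasurableSpace α] [MeasurableSpace β] {ν : Measure α}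
    {μ : Measure β} [SFinite ν] [SFinite μ] {P : α × β → Prop} (hP : ∀ᵐ z ∂(ν.prod μ), P z) :
    ∀ᵐ y ∂μ, ∀ᵐ x ∂ν, P (x, y) :=
  Measure.ae_ae_of_ae_prod
    ((Measure.measurePreserving_swap (μ := μ) (ν := ν)).quasiMeasurePreserving.ae hP)

/-- If `v t = b + ∫ w` almost everywhere in space for every time, then the same holds for almost
every point of space at almost every time. -/
lemma ae_ae_eq_add_integral {α : Type*} [MeasurableSpace α] {μ : Measure α} [SFinite μ] {t₀ : ℝ}
    {v w : ℝ → α → ℝ} {b : α → ℝ}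
    (hv : AEMeasurable (fun z : ℝ × α ↦ v z.1 z.2) ((volume.restrict (Ioi t₀)).prod μ))
    (hw : AEStronglyMeasurable (fun z : ℝ × α ↦ w z.1 z.2) ((volume.restrict (Ioi t₀)).prod μ))
    (hb : AEMeasurable b μ)
    (heq : ∀ t ≥ t₀, ∀ᵐ x ∂μ, v t x = b x + ∫ s in t₀..t, w s x) :
    ∀ᵐ x ∂μ, ∀ᵐ t ∂(volume.restrict (Ioi t₀)), v t x = b x + ∫ s in t₀..t, w s x := by
  -- The exceptional null set in space depends on `t`. Exchanging the quantifiers by Fubini requires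
  -- a measurable set of pairs, hence measurable representatives and joint measurability of the time
  -- integral `J`.
  set w' := hw.mk with hw'
  set v' := hv.mk with hv'
  set b' := hb.mk with hb'
  have hwm : StronglyMeasurable w' := hw.stronglyMeasurable_mk
  have hww := ae_ae_swap_of_ae_prod hw.ae_eq_mk
  have hvv := ae_ae_swap_of_ae_prod hv.ae_eq_mk
  have hint : ∀ᵐ x ∂μ, ∀ t ≥ t₀, ∫ s in t₀..t, w s x = ∫ s in Ioc t₀ t, w' (s, x) := by
    filter_upwards [hww] with x hx t ht
    rw [intervalIntegral.integral_of_le ht]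
    exact integral_congr_ae (ae_mono (Measure.restrict_mono Ioc_subset_Ioi_self le_rfl) hx)
  set J : ℝ × α → ℝ := fun z ↦ ∫ s, (Ioc t₀ z.1).indicator (fun s ↦ w' (s, z.2)) s with hJ
  have hJm : StronglyMeasurable J := by
    have hS : MeasurableSet {y : (ℝ × α) × ℝ | y.2 ∈ Ioc t₀ y.1.1} :=
      (measurableSet_lt measurable_const measurable_snd).inter
        (measurableSet_le measurable_snd measurable_fst.fst)
    have h1 : StronglyMeasurable fun y : (ℝ × α) × ℝ ↦ w' (y.2, y.1.2) :=
      hwm.comp_measurable (measurable_snd.prodMk measurable_fst.snd)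
    exact (h1.indicator hS).integral_prod_right'
  have hJeq : ∀ z : ℝ × α, J z = ∫ s in Ioc t₀ z.1, w' (s, z.2) := fun z ↦
    integral_indicator measurableSet_Ioc
  have hset : MeasurableSet {z : ℝ × α | v' (z.1, z.2) = b' z.2 + J (z.1, z.2)} :=
    measurableSet_eq_fun hv.measurable_mk ((hb.measurable_mk.comp measurable_snd).add hJm.measurable)
  have hrow : ∀ᵐ t ∂(volume.restrict (Ioi t₀)), ∀ᵐ x ∂μ, v' (t, x) = b' x + J (t, x) := by
    filter_upwards [Measure.ae_ae_of_ae_prod hv.ae_eq_mk, ae_restrict_mem measurableSet_Ioi]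
      with t ht ht0
    filter_upwards [ht, heq t (le_of_lt ht0), hb.ae_eq_mk, hint] with x h1 h2 h3 h4
    rw [hJeq, hv', ← h1, h2, h3, h4 t (le_of_lt ht0)]
  have hcol := (Measure.ae_ae_comm hset).1 hrow
  filter_upwards [hcol, hvv, hint, hb.ae_eq_mk] with x h1 h2 h3 h4
  filter_upwards [h1, h2, ae_restrict_mem measurableSet_Ioi] with t h5 h6 ht
  rw [h6, h3 t (le_of_lt ht), h4]
  have h7 := hJeq (t, x)
  simp only at h7
  rw [← h7]
  exact h5

variable {N : ℕ} {Ω : Opens (Euc N)} {h a : ℝ → ℝ} {p q c : ℝ}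
  {t₀ : ℝ} {u₀ : Euc N → ℝ} {u w : ℝ → Euc N → ℝ} {g : ℝ → Euc N → Euc N} {l : ℝ → Euc N → ℝ}

namespace IsSolutionWith

lemma prod_le {t₁ t₂ : ℝ} (ht₁ : t₀ ≤ t₁) :
    (volume.restrict (Ioc t₁ t₂)).prod (volume.restrict (Ω : Set (Euc N))) ≤
      (volume.restrict (Ioi t₀)).prod (volume.restrict Ω) :=
  Measure.prod_mono (Measure.restrict_mono
    (fun _ hx ↦ lt_of_le_of_lt ht₁ hx.1) le_rfl) le_rfl

lemma ae_nonneg (S : IsSolutionWith Ω h a t₀ u₀ u w g l) :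
    ∀ᵐ z ∂((volume.restrict (Ioi t₀)).prod (volume.restrict (Ω : Set (Euc N)))),
      0 ≤ u z.1 z.2 := by
  rw [Measure.prod_restrict]
  filter_upwards [ae_restrict_mem (measurableSet_Ioi.prod Ω.isOpen.measurableSet)] with z hz
  exact S.nonneg _ (le_of_lt hz.1) _ hz.2

lemma ae_nonneg_slice (S : IsSolutionWith Ω h a t₀ u₀ u w g l) {t : ℝ} (ht : t₀ ≤ t) :
    ∀ᵐ x ∂(volume.restrict (Ω : Set (Euc N))), 0 ≤ u t x := by
  filter_upwards [ae_restrict_mem Ω.isOpen.measurableSet] with x hx using S.nonneg t ht x hx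

lemma aemeasurable_of_continuous_max (S : IsSolutionWith Ω h a t₀ u₀ u w g l) {f : ℝ → ℝ}
    (hf : Continuous fun s ↦ f (max s 0)) :
    AEMeasurable (fun z : ℝ × Euc N ↦ f (u z.1 z.2))
      ((volume.restrict (Ioi t₀)).prod (volume.restrict Ω)) := by
  refine (hf.measurable.comp_aemeasurable S.meas).congr ?_
  filter_upwards [S.ae_nonneg] with z hz
  simp [hz]

/-- No measurability of `u₀` is assumed; it is recovered for `H(u₀)` by taking a root of the
integrable function `H(u₀) ^ (p + 1)`. -/
lemma aemeasurable_H_initial (S : IsSolutionWith Ω h a t₀ u₀ u w g l) (A : FluxGrowth h a p q c)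
    (hint : IntegrableOn (fun x ↦ H h (u₀ x) ^ (p + 1)) Ω) :
    AEMeasurable (fun x ↦ H h (u₀ x)) (volume.restrict Ω) := by
  have hp := A.p_pos
  refine (hint.aestronglyMeasurable.aemeasurable.pow_const (1 / (p + 1))).congr ?_
  filter_upwards [S.initial, S.ae_nonneg_slice le_rfl] with x hx hx0
  rw [← hx, ← Real.rpow_mul (A.adm.H_nonneg hx0), mul_one_div_cancel (by positivity),
    Real.rpow_one]

lemma integrable_weight_mul (S : IsSolutionWith Ω h a t₀ u₀ u w g l) (A : FluxGrowth h a p q c)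
    (j : ℕ) {t₁ t₂ : ℝ} (ht₁ : t₀ ≤ t₁) {f : ℝ × Euc N → ℝ}
    (hf : Integrable f ((volume.restrict (Ioc t₁ t₂)).prod (volume.restrict Ω))) :
    Integrable (fun z : ℝ × Euc N ↦ weight h a p j (u z.1 z.2) * f z)
      ((volume.restrict (Ioc t₁ t₂)).prod (volume.restrict Ω)) := by
  obtain ⟨K, hK⟩ := A.exists_weight_le j
  refine hf.bdd_mul (c := K) ((S.aemeasurable_of_continuous_max
    (A.continuous_weight_max j)).mono_measure (prod_le ht₁)).aestronglyMeasurable ?_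
  filter_upwards [ae_mono (prod_le ht₁) S.ae_nonneg] with z hz
  rw [Real.norm_eq_abs, abs_of_nonneg (A.weight_nonneg j hz)]
  exact hK _ hz

/-- Fundamental theorem of calculus for `weightPrim j (u t x)` at almost every point `x`. -/
lemma integrable_weightPrim_initial (S : IsSolutionWith Ω h a t₀ u₀ u w g l)
    (A : FluxGrowth h a p q c) (hint : IntegrableOn (fun x ↦ H h (u₀ x) ^ (p + 1)) Ω) (j : ℕ) :
    IntegrableOn (fun x ↦ weightPrim h a p j (u t₀ x)) Ω := by
  obtain ⟨K, Γ, hΓ, hΓs⟩ := A.exists_lipschitz_weightPrim j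
  have hm : AEMeasurable (fun x ↦ weightPrim h a p j (u t₀ x)) (volume.restrict Ω) := by
    refine (hΓ.continuous.measurable.comp_aemeasurable (S.aemeasurable_H_initial A hint)).congr ?_
    filter_upwards [S.initial, S.ae_nonneg_slice le_rfl] with x hx hx0
    rw [Function.comp_apply, ← hx, (hΓs _ hx0).1]
  refine (hint.div_const (p + 1)).mono' hm.aestronglyMeasurable ?_
  filter_upwards [S.initial, S.ae_nonneg_slice le_rfl] with x hx hx0
  rw [Real.norm_eq_abs, abs_of_nonneg (A.weightPrim_nonneg j hx0), ← hx]
  exact A.weightPrim_le j hx0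

variable [IsFiniteMeasure (volume.restrict (Ω : Set (Euc N)))]

lemma integrable_w (S : IsSolutionWith Ω h a t₀ u₀ u w g l) {t₁ t₂ : ℝ} (ht₁ : t₀ ≤ t₁) :
    Integrable (fun z : ℝ × Euc N ↦ w z.1 z.2)
      ((volume.restrict (Ioc t₁ t₂)).prod (volume.restrict Ω)) :=
  (S.time_sq.mono_measure (prod_le ht₁)).integrable (by norm_num)

lemma integrable_diff (S : IsSolutionWith Ω h a t₀ u₀ u w g l) {t₁ t₂ : ℝ} (ht₁ : t₀ ≤ t₁) :
    Integrable (fun z : ℝ × Euc N ↦ F h a (u z.1 z.2) * l z.1 z.2)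
      ((volume.restrict (Ioc t₁ t₂)).prod (volume.restrict Ω)) :=
  (S.diff_sq.mono_measure (prod_le ht₁)).integrable (by norm_num)

/-- For almost every `x` the function `H(u(·, x))` agrees at almost every time with a primitive of
`w`, and at both end times as well. The Lipschitz chain rule for `Γ` applies to that primitive. -/
lemma weightPrim_sub (S : IsSolutionWith Ω h a t₀ u₀ u w g l) (A : FluxGrowth h a p q c)
    (hint : IntegrableOn (fun x ↦ H h (u₀ x) ^ (p + 1)) Ω) (j : ℕ) {t₁ t₂ : ℝ} (ht₁ : t₀ ≤ t₁)
    (ht : t₁ ≤ t₂) :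
    ∀ᵐ x ∂(volume.restrict (Ω : Set (Euc N))),
      weightPrim h a p j (u t₂ x) - weightPrim h a p j (u t₁ x) =
        ∫ r in Ioc t₁ t₂, weight h a p j (u r x) * w r x := by
  obtain ⟨K, Γ, hΓ, hΓs⟩ := A.exists_lipschitz_weightPrim j
  have hcol := ae_ae_eq_add_integral (v := fun t x ↦ H h (u t x))
    (S.aemeasurable_of_continuous_max A.adm.continuous_H_max) S.time_sq.1
    (S.aemeasurable_H_initial A hint) S.time_deriv
  have hwint := (S.integrable_w (t₁ := t₀) (t₂ := t₂) le_rfl).prod_left_ae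
  filter_upwards [hcol, S.time_deriv t₁ ht₁, S.time_deriv t₂ (ht₁.trans ht), hwint,
    ae_restrict_mem Ω.isOpen.measurableSet] with x hx h1 h2 hw hxΩ
  have hw' : IntervalIntegrable (fun r ↦ w r x) volume t₀ t₂ :=
    (intervalIntegrable_iff_integrableOn_Ioc_of_le (ht₁.trans ht)).2 hw
  have hw1 : IntervalIntegrable (fun r ↦ w r x) volume t₀ t₁ :=
    hw'.mono_set (by rw [uIcc_of_le ht₁, uIcc_of_le (ht₁.trans ht)]; exact Icc_subset_Icc_right ht)
  have hw2 : IntervalIntegrable (fun r ↦ w r x) volume t₁ t₂ :=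
    hw'.mono_set (by rw [uIcc_of_le ht, uIcc_of_le (ht₁.trans ht)]; exact Icc_subset_Icc_left ht₁)
  have hch := integral_chain (κ := fun r ↦ weight h a p j (u r x)) (w := fun r ↦ w r x)
    (y := fun r ↦ H h (u₀ x) + ∫ v in t₀..r, w v x) (y₀ := H h (u t₁ x)) hΓ ht hw2
    (fun r hr ↦ ?_) ?_
  · rw [← h1, ← h2, (hΓs _ (S.nonneg t₁ ht₁ x hxΩ)).1,
      (hΓs _ (S.nonneg t₂ (ht₁.trans ht) x hxΩ)).1, intervalIntegral.integral_of_le ht] at hch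
    exact hch
  · rw [h1, add_assoc, intervalIntegral.integral_add_adjacent_intervals hw1]
    exact hw2.mono_set (by
      rw [uIcc_of_le ht, uIcc_of_le hr.1]; exact Icc_subset_Icc_right hr.2)
  · have hsub : Ioc t₁ t₂ ⊆ Ioi t₀ := fun _ hr ↦ lt_of_le_of_lt ht₁ hr.1
    filter_upwards [ae_mono (Measure.restrict_mono hsub le_rfl) hx,
      ae_restrict_mem measurableSet_Ioc] with r hr hrI
    rw [← hr]
    exact (hΓs _ (S.nonneg r (le_of_lt (hsub hrI)) x hxΩ)).2

/-- The truncated dissipation `-∫ ramp j (flux u) Δu`. -/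
def dissipation (Ω : Opens (Euc N)) (h a : ℝ → ℝ) (p : ℝ) (u l : ℝ → Euc N → ℝ) (j : ℕ)
    (t : ℝ) : ℝ :=
  -∫ x in Ω, ramp j (flux h a p (u t x)) * l t x

/-- Only `F(u) Δu` is known to be integrable, and the truncated flux is the bounded weight times
`F`. -/
lemma integrable_ramp_mul (S : IsSolutionWith Ω h a t₀ u₀ u w g l) (A : FluxGrowth h a p q c)
    (j : ℕ) {t₁ t₂ : ℝ} (ht₁ : t₀ ≤ t₁) :
    Integrable (fun z : ℝ × Euc N ↦ ramp j (flux h a p (u z.1 z.2)) * l z.1 z.2)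
      ((volume.restrict (Ioc t₁ t₂)).prod (volume.restrict Ω)) := by
  refine (S.integrable_weight_mul A j ht₁ (S.integrable_diff ht₁)).congr ?_
  filter_upwards [ae_mono (prod_le ht₁) S.ae_nonneg] with z hz
  rw [← mul_assoc, A.weight_mul_F j hz]

lemma integrableOn_dissipation (S : IsSolutionWith Ω h a t₀ u₀ u w g l)
    (A : FluxGrowth h a p q c) (j : ℕ) {t₁ t₂ : ℝ} (ht₁ : t₀ ≤ t₁) :
    IntegrableOn (dissipation Ω h a p u l j) (Ioc t₁ t₂) :=
  (S.integrable_ramp_mul A j ht₁).integral_prod_left.neg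

lemma integrable_weightPrim (S : IsSolutionWith Ω h a t₀ u₀ u w g l)
    (A : FluxGrowth h a p q c) (hint : IntegrableOn (fun x ↦ H h (u₀ x) ^ (p + 1)) Ω) (j : ℕ)
    {t : ℝ} (ht : t₀ ≤ t) : IntegrableOn (fun x ↦ weightPrim h a p j (u t x)) Ω := by
  have h1 := (S.integrable_weight_mul A j le_rfl (S.integrable_w (t₂ := t) le_rfl)).integral_prod_right
  refine ((S.integrable_weightPrim_initial A hint j).add h1).congr ?_
  filter_upwards [S.weightPrim_sub A hint j le_rfl ht] with x hx
  rw [Pi.add_apply, ← hx]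
  ring

/-- The energy inequality for the truncations. -/
lemma integral_weightPrim_sub_le (S : IsSolutionWith Ω h a t₀ u₀ u w g l)
    (A : FluxGrowth h a p q c) (hint : IntegrableOn (fun x ↦ H h (u₀ x) ^ (p + 1)) Ω) (j : ℕ)
    {t₁ t₂ : ℝ} (ht₁ : t₀ ≤ t₁) (ht : t₁ ≤ t₂) :
    (∫ x in Ω, weightPrim h a p j (u t₂ x)) - ∫ x in Ω, weightPrim h a p j (u t₁ x) ≤
      -∫ t in Ioc t₁ t₂, dissipation Ω h a p u l j t := by
  have iw := S.integrable_weight_mul A j ht₁ (S.integrable_w (t₂ := t₂) ht₁)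
  have ir := S.integrable_ramp_mul A j (t₂ := t₂) ht₁
  rw [← integral_sub (S.integrable_weightPrim A hint j (ht₁.trans ht))
    (S.integrable_weightPrim A hint j ht₁),
    integral_congr_ae (S.weightPrim_sub A hint j ht₁ ht)]
  have e1 := integral_prod_symm _ iw
  have e2 := integral_prod _ ir
  simp only at e1 e2
  rw [← e1]
  unfold dissipation
  rw [integral_neg, neg_neg, ← e2]
  refine integral_mono_ae iw ir ?_
  filter_upwards [ae_mono (prod_le ht₁) S.ae_nonneg, ae_mono (prod_le ht₁) S.ineq] with z hz hz'
  rw [← A.weight_mul_F j hz, mul_assoc]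
  exact mul_le_mul_of_nonneg_left (by linarith) (A.weight_nonneg j hz)

/-- If the truncated dissipations are nonnegative and increasing, then `Y` is finite and satisfies
the energy inequality. -/
lemma Y_sub_le (S : IsSolutionWith Ω h a t₀ u₀ u w g l)
    (A : FluxGrowth h a p q c) (hint : IntegrableOn (fun x ↦ H h (u₀ x) ^ (p + 1)) Ω)
    (hE : ∀ᵐ t ∂(volume.restrict (Ioi t₀)), (∀ j, 0 ≤ dissipation Ω h a p u l j t) ∧
      Monotone fun j ↦ dissipation Ω h a p u l j t) :
    (∀ t ≥ t₀, IntegrableOn (fun x ↦ H h (u t x) ^ (p + 1)) Ω) ∧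
      ∀ j, ∀ t₁ ≥ t₀, ∀ t₂ ≥ t₁, Y Ω h (p + 1) u t₂ - Y Ω h (p + 1) u t₁ ≤
        -((p + 1) * ∫ t in Ioc t₁ t₂, dissipation Ω h a p u l j t) := by
  have hp := A.p_pos
  have hsub : ∀ {t₁ t₂ : ℝ}, t₀ ≤ t₁ → Ioc t₁ t₂ ⊆ Ioi t₀ :=
    fun ht₁ _ hr ↦ lt_of_le_of_lt ht₁ hr.1
  have hfin : ∀ t ≥ t₀, IntegrableOn (fun x ↦ H h (u t x) ^ (p + 1) / (p + 1)) Ω := by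
    intro t ht
    have hlim : ∀ᵐ x ∂(volume.restrict (Ω : Set (Euc N))),
        Tendsto (fun j ↦ weightPrim h a p j (u t x)) atTop (𝓝 (H h (u t x) ^ (p + 1) / (p + 1))) := by
      filter_upwards [S.ae_nonneg_slice ht] with x hx using A.tendsto_weightPrim hx
    have hbd : ∀ j, ∫ x in Ω, weightPrim h a p j (u t x) ≤
        ∫ x in Ω, H h (u₀ x) ^ (p + 1) / (p + 1) := by
      intro j
      have h1 := S.integral_weightPrim_sub_le A hint j le_rfl ht
      have h2 : 0 ≤ ∫ s in Ioc t₀ t, dissipation Ω h a p u l j s := by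
        refine integral_nonneg_of_ae ?_
        filter_upwards [ae_mono (Measure.restrict_mono (hsub le_rfl) le_rfl) hE] with s hs
        exact hs.1 j
      have h3 : ∫ x in Ω, weightPrim h a p j (u t₀ x) ≤
          ∫ x in Ω, H h (u₀ x) ^ (p + 1) / (p + 1) := by
        refine integral_mono_ae (S.integrable_weightPrim_initial A hint j)
          (hint.div_const (p + 1)) ?_
        filter_upwards [S.initial, S.ae_nonneg_slice le_rfl] with x hx hx0
        rw [← hx]
        exact A.weightPrim_le j hx0
      linarith
    refine ⟨aestronglyMeasurable_of_tendsto_ae atTop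
      (fun j ↦ (S.integrable_weightPrim A hint j ht).1) hlim, ?_⟩
    rw [hasFiniteIntegral_iff_norm]
    -- Finiteness of `Y` is not assumed at later times: it follows by Fatou's lemma from the bound
    -- of the truncated integrals by the initial value.
    calc ∫⁻ x in Ω, ENNReal.ofReal ‖H h (u t x) ^ (p + 1) / (p + 1)‖
        = ∫⁻ x in Ω, liminf (fun j ↦ ENNReal.ofReal (weightPrim h a p j (u t x))) atTop := by
          refine lintegral_congr_ae ?_
          filter_upwards [hlim, S.ae_nonneg_slice ht] with x hx hx0
          have hH := A.adm.H_nonneg hx0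
          rw [Real.norm_eq_abs, abs_of_nonneg (by positivity)]
          exact ((ENNReal.continuous_ofReal.tendsto _).comp hx).liminf_eq.symm
      _ ≤ liminf (fun j ↦ ∫⁻ x in Ω, ENNReal.ofReal (weightPrim h a p j (u t x))) atTop :=
          lintegral_liminf_le' fun j ↦
            (S.integrable_weightPrim A hint j ht).1.aemeasurable.ennreal_ofReal
      _ ≤ ENNReal.ofReal (∫ x in Ω, H h (u₀ x) ^ (p + 1) / (p + 1)) := by
          refine (liminf_le_liminf (v := fun _ ↦ ENNReal.ofReal
            (∫ x in Ω, H h (u₀ x) ^ (p + 1) / (p + 1))) (Eventually.of_forall fun j ↦ ?_)).trans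
              (by simp)
          rw [← ofReal_integral_eq_lintegral_ofReal (S.integrable_weightPrim A hint j ht)]
          · exact ENNReal.ofReal_le_ofReal (hbd j)
          · filter_upwards [S.ae_nonneg_slice ht] with x hx using A.weightPrim_nonneg j hx
      _ < ∞ := ENNReal.ofReal_lt_top
  refine ⟨fun t ht ↦ ?_, fun i t₁ ht₁ t₂ ht₂ ↦ ?_⟩
  · refine ((hfin t ht).mul_const (p + 1)).congr (Eventually.of_forall fun x ↦ ?_)
    simp only
    field_simp
  · have hYlim : ∀ t ≥ t₀, Tendsto (fun j ↦ ∫ x in Ω, weightPrim h a p j (u t x)) atTop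
        (𝓝 (Y Ω h (p + 1) u t / (p + 1))) := by
      intro t ht
      have h1 := integral_tendsto_of_tendsto_of_monotone
        (fun j ↦ S.integrable_weightPrim A hint j ht) (hfin t ht)
        (by filter_upwards [S.ae_nonneg_slice ht] with x hx using A.weightPrim_mono hx)
        (by filter_upwards [S.ae_nonneg_slice ht] with x hx using A.tendsto_weightPrim hx)
      rwa [integral_div] at h1
    have hlim := (hYlim t₂ (le_trans ht₁ ht₂)).sub (hYlim t₁ ht₁)
    have hle : Y Ω h (p + 1) u t₂ / (p + 1) - Y Ω h (p + 1) u t₁ / (p + 1) ≤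
        -∫ t in Ioc t₁ t₂, dissipation Ω h a p u l i t := by
      refine le_of_tendsto hlim ?_
      -- Only the left side passes to the limit in `j`. On the right, monotonicity replaces the
      -- dissipation of index `j` by that of the fixed index `i`.
      filter_upwards [eventually_ge_atTop i] with j hij
      refine (S.integral_weightPrim_sub_le A hint j ht₁ ht₂).trans (neg_le_neg ?_)
      refine integral_mono_ae (S.integrableOn_dissipation A i ht₁)
        (S.integrableOn_dissipation A j ht₁) ?_
      filter_upwards [ae_mono (Measure.restrict_mono (hsub ht₁) le_rfl) hE] with t ht
      exact ht.2 hij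
    rw [← sub_div, div_le_iff₀ (by positivity)] at hle
    linarith

end IsSolutionWith

/-- Differentiation of an integral inequality. -/
lemma ae_deriv_le_of_sub_le {y e : ℝ → ℝ} {t₀ : ℝ} (hy : AntitoneOn y (Ici t₀))
    (he : ∀ t, IntegrableOn e (Ioc t₀ t))
    (hle : ∀ t₁ ≥ t₀, ∀ t₂ ≥ t₁, y t₂ - y t₁ ≤ -∫ t in Ioc t₁ t₂, e t) :
    ∀ᵐ t ∂(volume.restrict (Ioi t₀)), DifferentiableAt ℝ y t ∧ deriv y t ≤ -e t := by
  -- Monotonicity alone gives differentiability almost everywhere, so absolute continuity of `y` is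
  -- not needed.
  have hdiff : ∀ᵐ t, t ∈ Ici t₀ → DifferentiableWithinAt ℝ (fun s ↦ -y s) (Ici t₀) t :=
    hy.neg.ae_differentiableWithinAt_of_mem
  have hii : ∀ t ≥ t₀, IntervalIntegrable e volume t₀ t := fun t ht ↦
    (intervalIntegrable_iff_integrableOn_Ioc_of_le ht).2 (he t)
  have hleb : ∀ᵐ t, ∀ n : ℕ, t ∈ uIcc t₀ (t₀ + n) →
      ∀ b ∈ uIcc t₀ (t₀ + n), HasDerivAt (fun s ↦ ∫ r in b..s, e r) (e t) t :=
    ae_all_iff.2 fun n ↦ (hii (t₀ + n) (by simp)).ae_hasDerivAt_integral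
  rw [ae_restrict_iff' measurableSet_Ioi]
  filter_upwards [hdiff, hleb] with t h1 h2 ht
  have ht' : t₀ < t := ht
  have hnhds : Ici t₀ ∈ 𝓝 t := Ici_mem_nhds ht'
  have hyd : DifferentiableAt ℝ y t := by
    have := ((h1 ht'.le).differentiableAt hnhds).neg
    simpa [Pi.neg_def] using this
  obtain ⟨n, hn⟩ := exists_nat_ge (t - t₀)
  have hE : HasDerivAt (fun s ↦ ∫ r in t₀..s, e r) (e t) t :=
    h2 n (by rw [uIcc_of_le (by simp)]; exact ⟨ht'.le, by linarith⟩) t₀ left_mem_uIcc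
  refine ⟨hyd, ?_⟩
  -- The integral inequality says that `y` plus the primitive of `e` is nonincreasing; at almost
  -- every point the primitive has derivative `e`, and the sum has nonpositive derivative.
  have hanti : AntitoneOn (fun s ↦ y s + ∫ r in t₀..s, e r) (Ici t₀) := by
    intro s hs r hr hsr
    have h3 := hle s hs r hsr
    have h4 := intervalIntegral.integral_interval_sub_left (hii r hr) (hii s hs)
    rw [intervalIntegral.integral_of_le hsr] at h4
    simp only
    linarith
  have h5 := hanti.derivWithin_nonpos (x := t)
  have h6 : HasDerivAt (fun s ↦ y s + ∫ r in t₀..s, e r) (deriv y t + e t) t :=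
    hyd.hasDerivAt.add hE
  rw [derivWithin_of_mem_nhds hnhds, h6.deriv] at h5
  linarith

end Einstein

end

/-! ### Time slices and the differential inequality -/

section

namespace Einstein

lemma memLp_two_slice {α β : Type*} [MeasurableSpace α] [MeasurableSpace β] {ν : Measure α}
    {μ : Measure β} [SFinite ν] [SFinite μ] {f : α × β → ℝ} (hf : MemLp f 2 (ν.prod μ)) :
    ∀ᵐ t ∂ν, MemLp (fun x ↦ f (t, x)) 2 μ := by
  have h2 := (memLp_two_iff_integrable_sq hf.1).1 hf
  filter_upwards [hf.1.prodMk_left, h2.prod_right_ae] with t ht ht2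
  exact (memLp_two_iff_integrable_sq ht).2 ht2

variable {N : ℕ} {Ω : Opens (Euc N)} {h a : ℝ → ℝ} {p q c : ℝ} {t₀ : ℝ} {u₀ : Euc N → ℝ}
  {u w : ℝ → Euc N → ℝ} {g : ℝ → Euc N → Euc N} {l : ℝ → Euc N → ℝ}

namespace FluxGrowth

lemma bump_mul_energy_nonneg (A : FluxGrowth h a p q c) (j : ℕ) (r s : ℝ) :
    0 ≤ bump j r * (deriv (fluxInv A) r * s ^ 2) := by
  rcases le_or_gt r 0 with hr | hr
  · rw [bump_of_le j (hr.trans (by positivity)), zero_mul]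
  · have := A.deriv_fluxInv_pos hr
    have := bump_nonneg j r
    positivity

lemma bump_mul_energy_mono (A : FluxGrowth h a p q c) (r s : ℝ) :
    Monotone fun j ↦ bump j r * (deriv (fluxInv A) r * s ^ 2) := by
  intro i j hij
  rcases le_or_gt r 0 with hr | hr
  · simp only [bump_of_le i (hr.trans (by positivity)), bump_of_le j (hr.trans (by positivity)),
      zero_mul, le_refl]
  · have := A.deriv_fluxInv_pos hr
    exact mul_le_mul_of_nonneg_right (bump_mono hij) (by positivity)

end FluxGrowth

namespace IsSolutionWith

variable [IsFiniteMeasure (volume.restrict (Ω : Set (Euc N)))]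

/-- On almost every time slice the spatial energy identity turns the dissipation into the integral
of a nonnegative density increasing with `j`. The same approximation of the flux is retained for the
interpolation inequality. -/
lemma ae_dissipation (S : IsSolutionWith Ω h a t₀ u₀ u w g l) (A : FluxGrowth h a p q c)
    (hbc : ∀ᵐ t ∂(volume.restrict (Ioi t₀)), MemW012 Ω (fun x ↦ flux h a p (u t x))) :
    ∀ᵐ t ∂(volume.restrict (Ioi t₀)),
      ((∀ j, 0 ≤ dissipation Ω h a p u l j t) ∧ Monotone fun j ↦ dissipation Ω h a p u l j t) ∧
      ∃ f η G, DominatedApprox Ω (fun x ↦ flux h a p (u t x)) f η G ∧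
        ∀ R, (∀ j, dissipation Ω h a p u l j t ≤ R) →
          ∫⁻ x in Ω, ENNReal.ofReal (A.energyRoot (u t) f x ^ 2) ≤ ENNReal.ofReal R := by
  filter_upwards [S.grad, S.grad_sq, S.lapl, memLp_two_slice S.diff_sq, hbc,
    ae_restrict_mem measurableSet_Ioi] with t h1 h2 h3 h4 h5 ht
  obtain ⟨f, η, G, hf⟩ := h5.exists_dominatedApprox
  have hu0 := S.ae_nonneg_slice (le_of_lt ht)
  have hd := fun j ↦ A.integral_ramp_mul hf hu0 h1 h2 h3 h4 j
  have hd' : ∀ j, dissipation Ω h a p u l j t = ∫ x in Ω, bump j (flux h a p (u t x)) *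
      (deriv (fluxInv A) (flux h a p (u t x)) * ‖f x‖ ^ 2) := fun j ↦ by
    rw [dissipation, (hd j).2, neg_neg]
  refine ⟨⟨fun j ↦ ?_, fun i j hij ↦ ?_⟩, f, η, G, hf, fun R hR ↦ ?_⟩
  · rw [hd']
    exact integral_nonneg fun x ↦ A.bump_mul_energy_nonneg j _ _
  · simp only [hd']
    exact integral_mono (hd i).1 (hd j).1 fun x ↦ A.bump_mul_energy_mono _ _ hij
  · exact A.lintegral_energyRoot_sq_le hf hu0 h1 h2 h3 h4 hR

lemma antitoneOn_Y (S : IsSolutionWith Ω h a t₀ u₀ u w g l) (A : FluxGrowth h a p q c)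
    (hint : IntegrableOn (fun x ↦ H h (u₀ x) ^ (p + 1)) Ω)
    (hE : ∀ᵐ t ∂(volume.restrict (Ioi t₀)), (∀ j, 0 ≤ dissipation Ω h a p u l j t) ∧
      Monotone fun j ↦ dissipation Ω h a p u l j t) :
    AntitoneOn (Y Ω h (p + 1) u) (Ici t₀) := by
  intro s hs t _ hst
  have hp := A.p_pos
  have h1 := (S.Y_sub_le A hint hE).2 0 s hs t hst
  have h2 : 0 ≤ ∫ r in Ioc s t, dissipation Ω h a p u l 0 r := by
    refine integral_nonneg_of_ae ?_
    filter_upwards [ae_mono (Measure.restrict_mono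
      (fun r hr ↦ lt_of_le_of_lt hs hr.1 : Ioc s t ⊆ Ioi t₀) le_rfl) hE] with r hr using hr.1 0
  have h3 : 0 ≤ (p + 1) * ∫ r in Ioc s t, dissipation Ω h a p u l 0 r := by positivity
  linarith

/-- Each `j` gives its own null set of times, and their countable union is still null. One bound on
`Y'` therefore dominates all truncated energies at the same time `t`. -/
lemma ae_deriv_Y (S : IsSolutionWith Ω h a t₀ u₀ u w g l) (A : FluxGrowth h a p q c)
    (hint : IntegrableOn (fun x ↦ H h (u₀ x) ^ (p + 1)) Ω)
    (hE : ∀ᵐ t ∂(volume.restrict (Ioi t₀)), (∀ j, 0 ≤ dissipation Ω h a p u l j t) ∧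
      Monotone fun j ↦ dissipation Ω h a p u l j t) :
    ∀ᵐ t ∂(volume.restrict (Ioi t₀)), DifferentiableAt ℝ (Y Ω h (p + 1) u) t ∧
      ∀ j, deriv (Y Ω h (p + 1) u) t ≤ -((p + 1) * dissipation Ω h a p u l j t) := by
  have h1 := fun j ↦ ae_deriv_le_of_sub_le (S.antitoneOn_Y A hint hE)
    (e := fun t ↦ (p + 1) * dissipation Ω h a p u l j t)
    (fun t ↦ (S.integrableOn_dissipation A j le_rfl).const_mul _)
    (fun t₁ ht₁ t₂ ht ↦ by
      rw [integral_const_mul]; exact (S.Y_sub_le A hint hE).2 j t₁ ht₁ t₂ ht)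
  filter_upwards [ae_all_iff.2 h1] with t ht
  exact ⟨(ht 0).1, fun j ↦ (ht j).2⟩

end IsSolutionWith

/-- The passage from an estimate in `[0, ∞]` to the differential inequality. -/
lemma add_mul_toReal_rpow_le {K : ℝ≥0} {m e s y d : ℝ} {z E : ℝ≥0∞} (hm : 0 < m) (he : 0 < e)
    (hs : 0 < s) (hy : 0 ≤ y) (hd : d ≤ 0) (hE : E ≤ ENNReal.ofReal (-d / m))
    (hle : ENNReal.ofReal y ^ s ≤ K * (z ^ e * E)) :
    d + m / (K + 1) * ((z + 1) ^ (-e)).toReal * y ^ s ≤ 0 := by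
  -- For `z = ∞` the negative power is `0`, so only `d ≤ 0` remains to be used.
  rcases eq_or_ne z ∞ with rfl | hz
  · rw [top_add, ENNReal.top_rpow_of_neg (neg_neg_of_pos he)]
    simpa using hd
  have hz1 : z + 1 ≠ ∞ := ENNReal.add_ne_top.2 ⟨hz, ENNReal.one_ne_top⟩
  have hR : 0 ≤ -d / m := div_nonneg (by linarith) hm.le
  set x : ℝ := (z + 1).toReal with hx
  have hxpos : 0 < x := ENNReal.toReal_pos (by simp) hz1
  have hzx : z + 1 = ENNReal.ofReal x := (ENNReal.ofReal_toReal hz1).symm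
  have h1 : ENNReal.ofReal (y ^ s) ≤ ENNReal.ofReal (K * (x ^ e * (-d / m))) := by
    rw [← ENNReal.ofReal_rpow_of_nonneg hy hs.le, ENNReal.ofReal_mul K.coe_nonneg,
      ENNReal.ofReal_mul (by positivity), ENNReal.ofReal_coe_nnreal,
      ← ENNReal.ofReal_rpow_of_pos hxpos, ← hzx]
    refine hle.trans ?_
    gcongr
    exact le_self_add
  have h2 : y ^ s ≤ K * (x ^ e * (-d / m)) :=
    (ENNReal.ofReal_le_ofReal_iff (by positivity)).1 h1
  have hxe : 0 < x ^ e := by positivity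
  have h3 : ((z + 1) ^ (-e)).toReal = (x ^ e)⁻¹ := by
    rw [← ENNReal.toReal_rpow, Real.rpow_neg hxpos.le]
  have hK : (0 : ℝ) ≤ K := K.coe_nonneg
  rw [h3]
  -- Dividing by `K + 1` rather than `K` covers `K = 0`; the loss is the factor `K / (K + 1) ≤ 1`.
  have h4 : m / (K + 1) * (x ^ e)⁻¹ * y ^ s ≤
      m / (K + 1) * (x ^ e)⁻¹ * (K * (x ^ e * (-d / m))) := by gcongr
  have h5 : m / (K + 1) * (x ^ e)⁻¹ * (K * (x ^ e * (-d / m))) = K / (K + 1) * -d := by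
    field_simp
  have h6 : (K : ℝ) / (K + 1) * -d ≤ 1 * -d := by
    refine mul_le_mul_of_nonneg_right ?_ (by linarith)
    rw [div_le_one (by positivity)]
    linarith
  linarith

end Einstein

end

end

/-! ### Combination of the energy inequality with the interpolation inequality -/

theorem mainTheorem7 {N : ℕ} (hN : 2 ≤ N) (Ω : Opens (Einstein.Euc N))
    (hΩ : Bornology.IsBounded (Ω : Set (Einstein.Euc N)))
    (h a : ℝ → ℝ) (hha : Einstein.IsAdmissible h a)
    (p₁ q₁ c₃ γ₁ β c₄ : ℝ) (hp₁ : 0 < p₁) (hq₁ : 0 < q₁) (hc₃ : 0 < c₃)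
    (hγ₁ : 0 < γ₁) (hβ : 0 < β) (hc₄ : 0 < c₄)
    (hFH : ∀ s ∈ Ici (0 : ℝ),
      DifferentiableWithinAt ℝ (fun r ↦ Einstein.H h r ^ p₁ * Einstein.F h a r) (Ici 0) s ∧
      c₃ * Einstein.H h s ^ q₁ ≤
        derivWithin (fun r ↦ Einstein.H h r ^ p₁ * Einstein.F h a r) (Ici 0) s)
    (hH : ∀ s ∈ Ici (0 : ℝ),
      DifferentiableWithinAt ℝ (fun r ↦ Einstein.H h r ^ (γ₁ + 1)) (Ici 0) s ∧
      derivWithin (fun r ↦ Einstein.H h r ^ (γ₁ + 1)) (Ici 0) s ≤ c₄ * Einstein.H h s ^ β)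
    (hβq : q₁ / 2 < β)
    (δ₁ δ₂ p₀ : ℝ) (hδ₁ : δ₁ = (p₁ + 1) / (γ₁ + 1)) (hδ₁_ge : 1 ≤ δ₁) (hδ₁_lt : δ₁ < 2)
    (hδ₂ : δ₂ = Einstein.delta₂ N δ₁)
    (hp₀ : p₀ = (β - q₁ / 2) * (2 * δ₂ / (2 - δ₂))) :
    ∃ k : ℝ, 0 < k ∧
      ∀ (t₀ : ℝ) (u₀ : Einstein.Euc N → ℝ) (u : ℝ → Einstein.Euc N → ℝ),
        Einstein.IsSolution Ω h a t₀ u₀ u →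
        IntegrableOn (fun x ↦ Einstein.H h (u₀ x) ^ (p₁ + 1)) Ω →
        (∀ᵐ t ∂(volume.restrict (Ioi t₀)),
          Einstein.MemW012 Ω (fun x ↦ Einstein.H h (u t x) ^ p₁ * Einstein.F h a (u t x))) →
        (∀ t ≥ t₀, IntegrableOn (fun x ↦ Einstein.H h (u t x) ^ (p₁ + 1)) Ω) ∧
        AntitoneOn (Einstein.Y Ω h (p₁ + 1) u) (Ici t₀) ∧
        ∀ᵐ t ∂(volume.restrict (Ioi t₀)),
          DifferentiableAt ℝ (Einstein.Y Ω h (p₁ + 1) u) t ∧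
          deriv (Einstein.Y Ω h (p₁ + 1) u) t +
            k * ((Einstein.Z Ω h p₀ u t + 1) ^ (-((2 - δ₂) / δ₂))).toReal *
              Einstein.Y Ω h (p₁ + 1) u t ^ (2 / δ₁) ≤ 0 := by
  have : IsFiniteMeasure (volume.restrict (Ω : Set (Einstein.Euc N))) :=
    ⟨by simpa using hΩ.measure_lt_top⟩
  have A : Einstein.FluxGrowth h a p₁ q₁ c₃ := ⟨hha, hp₁, hq₁, hc₃, hFH⟩
  have B : Einstein.PowerGrowth h γ₁ β c₄ := ⟨hγ₁, hβ, hc₄, hH⟩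
  obtain ⟨h1, h2, h3, h4⟩ := Einstein.delta₂_spec hN hδ₁_ge hδ₁_lt
  rw [← hδ₂] at h1 h2 h3 h4
  obtain ⟨K, hK⟩ := A.exists_interpolation hΩ B hδ₁ h1 h2 h3 h4 hp₀
  -- The interpolation constant `K` is fixed before `t₀`, `u₀` and `u` are introduced, which gives
  -- the required uniformity.
  refine ⟨(p₁ + 1) / (K + 1), by positivity, fun t₀ u₀ u ⟨w, g, l, S⟩ hint hbc ↦ ?_⟩
  have hdis := S.ae_dissipation A hbc
  have hE := hdis.mono fun t ht ↦ ht.1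
  have hfin := (S.Y_sub_le A hint hE).1
  refine ⟨hfin, S.antitoneOn_Y A hint hE, ?_⟩
  filter_upwards [hdis, S.ae_deriv_Y A hint hE, ae_restrict_mem measurableSet_Ioi]
    with t ⟨⟨hpos, _⟩, f, η, G, hf, hR⟩ ⟨hdiff, hder⟩ ht
  have hu0 := S.ae_nonneg_slice (le_of_lt ht)
  have hH0 : ∀ᵐ x ∂(volume.restrict (Ω : Set (Einstein.Euc N))),
      0 ≤ Einstein.H h (u t x) ^ (p₁ + 1) :=
    hu0.mono fun x hx ↦ Real.rpow_nonneg (hha.H_nonneg hx) _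
  have hd0 : 0 ≤ (p₁ + 1) * Einstein.IsSolutionWith.dissipation Ω h a p₁ u l 0 t :=
    mul_nonneg (by linarith) (hpos 0)
  refine ⟨hdiff, Einstein.add_mul_toReal_rpow_le (by linarith)
    (div_pos (by linarith) (by linarith)) (by positivity) (integral_nonneg_of_ae hH0)
    (by linarith [hder 0]) (hR _ fun j ↦ ?_) ?_⟩
  · rw [le_div_iff₀ (by linarith)]
    linarith [hder j]
  · rw [Einstein.Y, ofReal_integral_eq_lintegral_ofReal (hfin t (le_of_lt ht)) hH0]
    exact hK (u t) f η G hf hu0
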